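/- **Definitions.** Let $R$ be an integral domain (for example $\mathbb{Z}$ or a field). For an integer $a\ge 0$ let $F_a$ be the Hirzebruch surface over $R$, that is, the toric scheme over $R$ of the complete fan in $\mathbb{R}^2$ whose rays are spanned by $(1,0)$, $(0,1)$, $(0,-1)$ and $(-1,a)$. For an integer $q\ge 2$, multiplication by $q$ on the lattice preserves the fan and induces an endomorphism $F$ of $X=F_a$, given on the torus by $x^u\mapsto x^{qu}$. A *splitting* of $X\times_R X$ (for $q$) is a map of $\mathcal{O}_{X\times X}$-modules $\pi:(F\times F)_*\mathcal{O}_{X\times X}\to\mathcal{O}_{X\times X}$ whose composition with the pullback $(F\times F)^*:\mathcal{O}_{X\times X}\to (F\times F)_*\mathcal{O}_{X\times X}$ is the identity; $X$ is *diagonally split for $q$* if there is such a $\pi$ with $\pi((F\times F)_*I_\Delta)\subseteq I_\Delta$, where $I_\Delta$ is the ideal sheaf of the diagonal. Similarly, a scheme $Y$ over a field $k$ of characteristic $p>0$ is *diagonally Frobenius split* if there is a splitting of $Y\times_k Y$ with respect to the absolute Frobenius morphism that is compatible with the diagonal in the same sense. **Statement.** 1. $F_0$ and $F_1$ are diagonally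 split for every $q\ge 2$. 2. $F_2$ is diagonally split for every odd $q\ge 2$. 3. If $a>2$, then $F_a$ is not diagonally split for any $q\ge 2$. 4. Let $k$ be an algebraically closed field, and let $G$ be the simple algebraic group of type $G_2$ over $k$, with Borel subgroup $B$. Some Schubert variety in the flag variety $G/B$ (the closure of a $B$-orbit, with its reduced structure) is isomorphic over $k$ to the Hirzebruch surface $F_3$ over $k$, which by 3 is not diagonally split for any $q\ge 2$; and if $k$ has characteristic $p>0$, then this Schubert variety is not diagonally Frobenius split. In particular, Schubert varieties are not diagonally split in general. -/

import Mathlib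

open AlgebraicGeometry CategoryTheory CategoryTheory.Limits Opposite TopologicalSpace

universe u

noncomputable section

/-! ## Splittings of schemes -/

/-- A splitting of a scheme `X` with respect to an endomorphism `F : X ⟶ X`:
a morphism of `𝒪_X`-modules `π : F_* 𝒪_X ⟶ 𝒪_X` such that `π ∘ F^*` is the identity of `𝒪_X`.
Spelled out: for every open `U` an additive map `Γ(X, F⁻¹ U) → Γ(X, U)`, compatible with
restrictions, linear over `Γ(X, U)` (which acts on `Γ(X, F⁻¹ U)` through the comorphism of `F`),
and left inverse to the comorphism of `F`. -/
structure SchemeSplitting {X : Scheme.{u}} (F : X ⟶ X) where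
  /-- The map on sections over `U`. -/
  toFun : ∀ U : X.Opens, Γ(X, F ⁻¹ᵁ U) →+ Γ(X, U)
  restrict : ∀ (U V : X.Opens) (i : V ⟶ U) (s : Γ(X, F ⁻¹ᵁ U)),
    toFun V (X.presheaf.map ((Opens.map F.base).map i).op s) = X.presheaf.map i.op (toFun U s)
  map_smul : ∀ (U : X.Opens) (r : Γ(X, U)) (s : Γ(X, F ⁻¹ᵁ U)),
    toFun U (F.app U r * s) = r * toFun U s
  comp_comorphism : ∀ (U : X.Opens) (r : Γ(X, U)), toFun U (F.app U r) = r

/-- `π (F_* I_Y) ⊆ I_Y`, where `I_Y` is the ideal sheaf of `i : Y ⟶ X`, that is, the kernel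
of `𝒪_X ⟶ i_* 𝒪_Y`. -/
def SchemeSplitting.IsCompatible {X Y : Scheme.{u}} {F : X ⟶ X} (π : SchemeSplitting F)
    (i : Y ⟶ X) : Prop :=
  ∀ (U : X.Opens) (s : Γ(X, F ⁻¹ᵁ U)), i.app (F ⁻¹ᵁ U) s = 0 → i.app U (π.toFun U s) = 0

/-- A Frobenius splitting of a scheme `X` of characteristic `p`: a splitting with respect to the
absolute Frobenius morphism, which is the identity on the underlying space and `r ↦ r ^ p` on
functions. -/
structure FrobeniusSplitting (p : ℕ) (X : Scheme.{u}) where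
  /-- The map on sections over `U`. -/
  toFun : ∀ U : X.Opens, Γ(X, U) →+ Γ(X, U)
  restrict : ∀ (U V : X.Opens) (i : V ⟶ U) (s : Γ(X, U)),
    toFun V (X.presheaf.map i.op s) = X.presheaf.map i.op (toFun U s)
  map_smul : ∀ (U : X.Opens) (r s : Γ(X, U)), toFun U (r ^ p * s) = r * toFun U s
  comp_comorphism : ∀ (U : X.Opens) (r : Γ(X, U)), toFun U (r ^ p) = r

/-- `π (F_* I_Y) ⊆ I_Y` for a Frobenius splitting `π` and a closed subscheme `i : Y ⟶ X`. -/
def FrobeniusSplitting.IsCompatible {p : ℕ} {X Y : Scheme.{u}} (π : FrobeniusSplitting p X)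
    (i : Y ⟶ X) : Prop :=
  ∀ (U : X.Opens) (s : Γ(X, U)), i.app U s = 0 → i.app U (π.toFun U s) = 0

/-- Given `f : X ⟶ S` and an endomorphism `F` of `X` over `S`: there is a splitting of `X ×_S X`,
with respect to `F × F`, that is compatible with the diagonal. -/
def IsDiagonallySplit {X S : Scheme.{u}} (f : X ⟶ S) (F : X ⟶ X) (hF : F ≫ f = f) : Prop :=
  ∃ π : SchemeSplitting (pullback.map f f f f F F (𝟙 S)
    (by rw [hF, Category.comp_id]) (by rw [hF, Category.comp_id])),
    π.IsCompatible (pullback.diagonal f)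

/-- For `X` over `S`, of characteristic `p`: there is a Frobenius splitting of `X ×_S X` that is
compatible with the diagonal. -/
def IsDiagonallyFrobeniusSplit (p : ℕ) {X S : Scheme.{u}} (f : X ⟶ S) : Prop :=
  ∃ π : FrobeniusSplitting p (pullback f f), π.IsCompatible (pullback.diagonal f)

/-! ## Toric schemes -/

/-- A simplicial fan in `ℝ ^ n` with respect to the lattice `N = ℤ ^ n`. A cone is given by
its set of rays, a ray by a lattice vector that spans it. Every subset of the rays of a cone spans a
face, which belongs to the fan, and any two cones are separated along their common face by some `u`
in the dual lattice `M = ℤ ^ n`. -/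
structure SimplicialFan (ι : Type) [DecidableEq ι] (n : ℕ) where
  /-- The lattice vectors spanning the rays. -/
  ray : ι → Fin n → ℤ
  /-- The cones of the fan. -/
  cones : Set (Finset ι)
  face_mem : ∀ σ ∈ cones, ∀ τ ⊆ σ, τ ∈ cones
  separation : ∀ σ ∈ cones, ∀ τ ∈ cones, ∃ u : Fin n → ℤ,
    (∀ i ∈ σ ∩ τ, u ⬝ᵥ ray i = 0) ∧ (∀ i ∈ σ \ τ, 0 < u ⬝ᵥ ray i) ∧
      (∀ i ∈ τ \ σ, u ⬝ᵥ ray i < 0)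

namespace SimplicialFan

variable {ι : Type} [DecidableEq ι] {n : ℕ} (Φ : SimplicialFan ι n)

/-- The monoid `σ^∨ ∩ M`. -/
def dualMonoid (σ : Finset ι) : AddSubmonoid (Fin n → ℤ) where
  carrier := {u | ∀ i ∈ σ, 0 ≤ u ⬝ᵥ Φ.ray i}
  zero_mem' := by intro i _; simp
  add_mem' := by
    intro a b ha hb i hi
    rw [add_dotProduct]
    exact add_nonneg (ha i hi) (hb i hi)

variable {Φ} in
theorem dualMonoid_anti {σ τ : Finset ι} (h : τ ≤ σ) : Φ.dualMonoid σ ≤ Φ.dualMonoid τ :=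
  fun _ hu i hi => hu i (h hi)

/-- The inclusion `R[σ^∨ ∩ M] → R[τ^∨ ∩ M]` for a face `τ` of `σ`. -/
def faceMap (R : Type u) [CommRing R] {σ τ : Finset ι} (h : τ ≤ σ) :
    AddMonoidAlgebra R (Φ.dualMonoid σ) →+* AddMonoidAlgebra R (Φ.dualMonoid τ) :=
  AddMonoidAlgebra.mapDomainRingHom R (AddSubmonoid.inclusion (dualMonoid_anti h))

/-- The diagram of affine toric schemes `U_σ = Spec R[σ^∨ ∩ M]`, indexed by the cones ordered by the
face relation. -/
def diagram (R : Type u) [CommRing R] : {σ : Finset ι // σ ∈ Φ.cones} ⥤ Scheme.{u} where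
  obj σ := Spec (CommRingCat.of (AddMonoidAlgebra R (Φ.dualMonoid σ.1)))
  map {_ _} h := Spec.map (CommRingCat.ofHom (Φ.faceMap R (leOfHom h)))
  map_id σ := by
    rw [← Spec.map_id]
    congr 1
    ext x
    · simp [faceMap]
    · simp [faceMap]
      rfl
  map_comp {σ τ ρ} f g := by
    rw [← Spec.map_comp]
    congr 1
    ext x
    · simp [faceMap]
    · simp [faceMap]
      rfl

theorem faceMap_single (R : Type u) [CommRing R] {σ τ : Finset ι} (h : τ ≤ σ)
    (a : Φ.dualMonoid σ) (r : R) :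
    Φ.faceMap R h (AddMonoidAlgebra.single a r) =
      AddMonoidAlgebra.single (AddSubmonoid.inclusion (dualMonoid_anti h) a) r := by
  simp [faceMap]

theorem faceMap_injective (R : Type u) [CommRing R] {σ τ : Finset ι} (h : τ ≤ σ) :
    Function.Injective (Φ.faceMap R h) :=
  AddMonoidAlgebra.mapDomain_injective (AddSubmonoid.inclusion_injective (dualMonoid_anti h))

/-- If `u ∈ σ^∨ ∩ M` cuts out the face `τ` of `σ`, then `R[τ^∨ ∩ M]` is the localization of
`R[σ^∨ ∩ M]` at `x ^ u`. -/
theorem isLocalization_faceMap (R : Type u) [CommRing R] {σ τ : Finset ι} (h : τ ≤ σ)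
    (u : Φ.dualMonoid σ) (h0 : ∀ i ∈ τ, u.1 ⬝ᵥ Φ.ray i = 0)
    (h1 : ∀ i ∈ σ \ τ, 0 < u.1 ⬝ᵥ Φ.ray i) :
    @IsLocalization.Away _ _ (AddMonoidAlgebra.single u (1 : R)) _ _
      (Φ.faceMap R h).toAlgebra := by
  let _ := (Φ.faceMap R h).toAlgebra
  have hmap : ∀ x, algebraMap (AddMonoidAlgebra R (Φ.dualMonoid σ))
      (AddMonoidAlgebra R (Φ.dualMonoid τ)) x = Φ.faceMap R h x := fun _ => rfl
  have hneg : -u.1 ∈ Φ.dualMonoid τ := by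
    intro i hi
    rw [neg_dotProduct, h0 i hi, neg_zero]
  refine (isLocalization_iff _ _).mpr ⟨?_, ?_, ?_⟩
  · rintro ⟨_, N, rfl⟩
    simp only [map_pow]
    refine IsUnit.pow _ (IsUnit.of_mul_eq_one (AddMonoidAlgebra.single ⟨-u.1, hneg⟩ 1) ?_)
    rw [hmap, faceMap_single, AddMonoidAlgebra.single_mul_single, AddMonoidAlgebra.one_def]
    congr 1
    · ext1
      simp
    · simp
  · suffices H : ∀ z : AddMonoidAlgebra R (Φ.dualMonoid τ), ∃ (N : ℕ)
        (x : AddMonoidAlgebra R (Φ.dualMonoid σ)),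
        z * Φ.faceMap R h (AddMonoidAlgebra.single u (1 : R)) ^ N = Φ.faceMap R h x by
      intro z
      obtain ⟨N, x, hx⟩ := H z
      exact ⟨⟨x, ⟨_, N, rfl⟩⟩, by simpa only [map_pow, hmap] using hx⟩
    intro z
    induction z using AddMonoidAlgebra.induction_linear with
    | zero => exact ⟨0, 0, by simp⟩
    | add z₁ z₂ ih₁ ih₂ =>
      obtain ⟨N₁, x₁, e₁⟩ := ih₁
      obtain ⟨N₂, x₂, e₂⟩ := ih₂
      refine ⟨N₁ + N₂, x₁ * AddMonoidAlgebra.single u (1 : R) ^ N₂ +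
        x₂ * AddMonoidAlgebra.single u (1 : R) ^ N₁, ?_⟩
      simp only [map_add, map_mul, map_pow, ← e₁, ← e₂]
      ring
    | single m r =>
      have hN : ∀ i ∈ σ, (m.1 ⬝ᵥ Φ.ray i).natAbs ≤ ∑ j ∈ σ, (m.1 ⬝ᵥ Φ.ray j).natAbs := fun i hi =>
        Finset.single_le_sum (f := fun j => (m.1 ⬝ᵥ Φ.ray j).natAbs) (fun _ _ => Nat.zero_le _) hi
      generalize (∑ j ∈ σ, (m.1 ⬝ᵥ Φ.ray j).natAbs) = N at hN
      have hmem : m.1 + N • u.1 ∈ Φ.dualMonoid σ := by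
        intro i hi
        rw [add_dotProduct, smul_dotProduct, nsmul_eq_mul]
        by_cases hτ : i ∈ τ
        · rw [h0 i hτ, mul_zero, add_zero]
          exact m.2 i hτ
        · have := h1 i (Finset.mem_sdiff.mpr ⟨hi, hτ⟩)
          have := hN i hi
          have : (N : ℤ) * 1 ≤ N * (u.1 ⬝ᵥ Φ.ray i) :=
            mul_le_mul_of_nonneg_left (by omega) (by omega)
          omega
      refine ⟨N, AddMonoidAlgebra.single ⟨_, hmem⟩ r, ?_⟩
      rw [faceMap_single, faceMap_single, AddMonoidAlgebra.single_pow,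
        AddMonoidAlgebra.single_mul_single]
      congr 1
      simp
  · intro x y hxy
    exact ⟨1, by rw [Φ.faceMap_injective R h hxy]⟩

theorem exists_face {σ τ : Finset ι} (hσ : σ ∈ Φ.cones) (h : τ ≤ σ) :
    ∃ u : Φ.dualMonoid σ, (∀ i ∈ τ, u.1 ⬝ᵥ Φ.ray i = 0) ∧
      (∀ i ∈ σ \ τ, 0 < u.1 ⬝ᵥ Φ.ray i) := by
  obtain ⟨u, h0, h1, -⟩ := Φ.separation σ hσ τ (Φ.face_mem σ hσ τ h)
  rw [Finset.inter_eq_right.mpr h] at h0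
  refine ⟨⟨u, fun i hi => ?_⟩, h0, h1⟩
  by_cases hτ : i ∈ τ
  · exact (h0 i hτ).ge
  · exact (h1 i (Finset.mem_sdiff.mpr ⟨hi, hτ⟩)).le

instance isOpenImmersion_diagram (R : Type u) [CommRing R]
    {σ τ : {σ : Finset ι // σ ∈ Φ.cones}} (h : σ ⟶ τ) :
    IsOpenImmersion ((Φ.diagram R).map h) := by
  obtain ⟨u, h0, h1⟩ := Φ.exists_face τ.2 (leOfHom h)
  let _ := (Φ.faceMap R (leOfHom h)).toAlgebra
  have := Φ.isLocalization_faceMap R (leOfHom h) u h0 h1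
  exact IsOpenImmersion.of_isLocalization (AddMonoidAlgebra.single u (1 : R))

theorem range_diagram_map (R : Type u) [CommRing R]
    {σ τ : {σ : Finset ι // σ ∈ Φ.cones}} (h : σ ⟶ τ) (u : Φ.dualMonoid τ.1)
    (h0 : ∀ i ∈ σ.1, u.1 ⬝ᵥ Φ.ray i = 0) (h1 : ∀ i ∈ τ.1 \ σ.1, 0 < u.1 ⬝ᵥ Φ.ray i) :
    Set.range ((Φ.diagram R).map h) =
      (PrimeSpectrum.basicOpen (AddMonoidAlgebra.single u (1 : R)) :
        Set (PrimeSpectrum (AddMonoidAlgebra R (Φ.dualMonoid τ.1)))) := by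
  let _ := (Φ.faceMap R (leOfHom h)).toAlgebra
  have := Φ.isLocalization_faceMap R (leOfHom h) u h0 h1
  exact PrimeSpectrum.localization_away_comap_range _ (AddMonoidAlgebra.single u (1 : R))

instance isLocallyDirected_diagram (R : Type u) [CommRing R] :
    (Φ.diagram R ⋙ Scheme.forget).IsLocallyDirected where
  cond := by
    intro σ τ ρ f g x y hxy
    obtain ⟨u, u0, u1⟩ := Φ.exists_face ρ.2 (leOfHom f)
    obtain ⟨v, v0, v1⟩ := Φ.exists_face ρ.2 (leOfHom g)
    have hσ : σ.1 ⊆ ρ.1 := leOfHom f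
    have hτ : τ.1 ⊆ ρ.1 := leOfHom g
    let κ : {σ : Finset ι // σ ∈ Φ.cones} :=
      ⟨σ.1 ∩ τ.1, Φ.face_mem σ.1 σ.2 _ Finset.inter_subset_left⟩
    let a : κ ⟶ σ := homOfLE (Finset.inter_subset_left : σ.1 ∩ τ.1 ⊆ σ.1)
    let b : κ ⟶ τ := homOfLE (Finset.inter_subset_right : σ.1 ∩ τ.1 ⊆ τ.1)
    have hab : a ≫ f = b ≫ g := Subsingleton.elim _ _
    have hx : (Φ.diagram R).map f x ∈ Set.range ((Φ.diagram R).map f) := ⟨x, rfl⟩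
    have hy : (Φ.diagram R).map g y ∈ Set.range ((Φ.diagram R).map g) := ⟨y, rfl⟩
    have hxy' : (Φ.diagram R).map f x = (Φ.diagram R).map g y := hxy
    rw [← hxy', Φ.range_diagram_map R g v v0 v1] at hy
    rw [Φ.range_diagram_map R f u u0 u1] at hx
    have hz : (Φ.diagram R).map f x ∈ Set.range ((Φ.diagram R).map (a ≫ f)) := by
      rw [Φ.range_diagram_map R (a ≫ f) (u + v)]
      · have e : AddMonoidAlgebra.single (u + v) (1 : R) =
            AddMonoidAlgebra.single u 1 * AddMonoidAlgebra.single v 1 := by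
          rw [AddMonoidAlgebra.single_mul_single, mul_one]
        rw [e, PrimeSpectrum.basicOpen_mul]
        exact ⟨hx, hy⟩
      · intro i hi
        have hi' := Finset.mem_inter.mp hi
        rw [AddSubmonoid.coe_add, add_dotProduct, u0 i hi'.1, v0 i hi'.2, add_zero]
      · intro i hi
        obtain ⟨hi, hn⟩ := Finset.mem_sdiff.mp hi
        rw [AddSubmonoid.coe_add, add_dotProduct]
        have hu := u.2 i hi
        have hv := v.2 i hi
        by_cases h : i ∈ σ.1
        · have h' : i ∉ τ.1 := fun h' => hn (Finset.mem_inter.mpr ⟨h, h'⟩)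
          exact add_pos_of_nonneg_of_pos hu (v1 i (Finset.mem_sdiff.mpr ⟨hi, h'⟩))
        · exact add_pos_of_pos_of_nonneg (u1 i (Finset.mem_sdiff.mpr ⟨hi, h⟩)) hv
    obtain ⟨z, hz⟩ := hz
    refine ⟨κ, a, b, z, ?_, ?_⟩
    · apply ((Φ.diagram R).map f).isOpenEmbedding.injective
      rw [← hz, Functor.map_comp]
      rfl
    · apply ((Φ.diagram R).map g).isOpenEmbedding.injective
      rw [← hxy', ← hz, hab, Functor.map_comp]
      rfl

/-- The toric scheme `X(Φ)` over `R`, glued from the `U_σ` along the `U_τ` for common faces `τ`. -/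
def toricScheme (R : Type u) [CommRing R] : Scheme.{u} := colimit (Φ.diagram R)

/-- The structure morphism of `X(Φ)`. -/
def toSpec (R : Type u) [CommRing R] : Φ.toricScheme R ⟶ Spec (CommRingCat.of R) :=
  colimit.desc (Φ.diagram R)
    { pt := Spec (CommRingCat.of R)
      ι :=
        { app := fun σ => Spec.map (CommRingCat.ofHom
            (algebraMap R (AddMonoidAlgebra R (Φ.dualMonoid σ.1))))
          naturality := by
            intro σ τ f
            dsimp [diagram]
            rw [Category.comp_id, ← Spec.map_comp, ← CommRingCat.ofHom_comp]
            congr 2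
            ext r
            simp [faceMap] } }

/-- The endomorphism of the diagram of the `U_σ` given by `x ^ u ↦ x ^ (q u)`. -/
def diagramFrobenius (R : Type u) [CommRing R] (q : ℕ) : Φ.diagram R ⟶ Φ.diagram R where
  app σ := Spec.map (CommRingCat.ofHom
    (AddMonoidAlgebra.mapDomainRingHom R (nsmulAddMonoidHom (α := Φ.dualMonoid σ.1) q)))
  naturality := by
    intro σ τ f
    dsimp [diagram]
    rw [← Spec.map_comp, ← Spec.map_comp, ← CommRingCat.ofHom_comp, ← CommRingCat.ofHom_comp]
    congr 2
    ext x
    · simp [faceMap]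
    · simp [faceMap]

/-- The endomorphism `F` of `X(Φ)` over `R` induced by multiplication by `q` on the lattice `N`. -/
def frobenius (R : Type u) [CommRing R] (q : ℕ) : Φ.toricScheme R ⟶ Φ.toricScheme R :=
  colimMap (Φ.diagramFrobenius R q)

theorem frobenius_toSpec (R : Type u) [CommRing R] (q : ℕ) :
    Φ.frobenius R q ≫ Φ.toSpec R = Φ.toSpec R := by
  refine colimit.hom_ext fun σ => ?_
  change colimit.ι (Φ.diagram R) σ ≫ colimMap (Φ.diagramFrobenius R q) ≫
    colimit.desc (Φ.diagram R) _ = colimit.ι (Φ.diagram R) σ ≫ colimit.desc (Φ.diagram R) _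
  rw [ι_colimMap_assoc, colimit.ι_desc]
  refine (Spec.map_comp _ _).symm.trans ?_
  congr 1
  ext r
  simp

/-- The toric scheme `X(Φ)` over `R` is diagonally split for `q`: there is a splitting of
`X(Φ) × X(Φ)`, with respect to the endomorphism induced by multiplication by `q`, that is compatible
with the diagonal. -/
def IsDiagonallySplit (R : Type u) [CommRing R] (q : ℕ) : Prop :=
  _root_.IsDiagonallySplit (Φ.toSpec R) (Φ.frobenius R q) (Φ.frobenius_toSpec R q)

end SimplicialFan

/-- The primitive generators `(1, 0)`, `(0, 1)`, `(-1, a)`, `(0, -1)`, in cyclic order, of the rays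
of the fan of the Hirzebruch surface `F_a`. -/
def hirzebruchRay (a : ℕ) : Fin 4 → Fin 2 → ℤ :=
  ![![1, 0], ![0, 1], ![-1, a], ![0, -1]]

/-- The complete fan in `ℝ ^ 2` with rays `(1, 0)`, `(0, 1)`, `(-1, a)`, `(0, -1)`: a set of rays
spans a cone if and only if it does not contain two opposite members of the cyclic order.
The associated toric surface is the Hirzebruch surface `F_a`. -/
def hirzebruchFan (a : ℕ) : SimplicialFan (Fin 4) 2 where
  ray := hirzebruchRay a
  cones := {σ | ¬ (0 ∈ σ ∧ 2 ∈ σ) ∧ ¬ (1 ∈ σ ∧ 3 ∈ σ)}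
  face_mem := fun σ hσ τ h => ⟨fun ⟨x, y⟩ => hσ.1 ⟨h x, h y⟩, fun ⟨x, y⟩ => hσ.2 ⟨h x, h y⟩⟩
  separation := by
    rintro σ ⟨hσ, hσ'⟩ τ ⟨hτ, hτ'⟩
    obtain ⟨y, hy, hy', y1, y2, y3, y4, y5, y6⟩ : ∃ y : ℤ, -2 ≤ y ∧ y ≤ 2 ∧
        (1 ∈ σ → 1 ∈ τ → y = 0) ∧ (1 ∈ σ → 1 ∉ τ → 0 < y) ∧ (1 ∈ τ → 1 ∉ σ → y < 0) ∧
        (3 ∈ σ → 3 ∈ τ → y = 0) ∧ (3 ∈ σ → 3 ∉ τ → y < 0) ∧ (3 ∈ τ → 3 ∉ σ → 0 < y) := by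
      refine ⟨(if 1 ∈ σ then 1 else 0) - (if 1 ∈ τ then 1 else 0) -
        ((if 3 ∈ σ then 1 else 0) - (if 3 ∈ τ then 1 else 0)), ?_⟩
      by_cases p1 : 1 ∈ σ <;> by_cases p3 : 3 ∈ σ <;> by_cases r1 : 1 ∈ τ <;>
        by_cases r3 : 3 ∈ τ <;> simp_all
    obtain ⟨w, hw⟩ : ∃ w : ℤ, w = a * y := ⟨_, rfl⟩
    have hw1 : -(2 * a : ℤ) ≤ w := by nlinarith
    have hw2 : w ≤ 2 * a := by nlinarith
    obtain ⟨x, x1, x2, x3, x4, x5, x6⟩ : ∃ x : ℤ,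
        (0 ∈ σ → 0 ∈ τ → x = 0) ∧ (0 ∈ σ → 0 ∉ τ → 0 < x) ∧ (0 ∈ τ → 0 ∉ σ → x < 0) ∧
        (2 ∈ σ → 2 ∈ τ → w - x = 0) ∧ (2 ∈ σ → 2 ∉ τ → 0 < w - x) ∧
        (2 ∈ τ → 2 ∉ σ → w - x < 0) := by
      refine ⟨if 2 ∈ σ ∧ 2 ∈ τ then w else (2 * a + 1) *
        ((if 0 ∈ σ then 1 else 0) - (if 0 ∈ τ then 1 else 0) -
          ((if 2 ∈ σ then 1 else 0) - (if 2 ∈ τ then 1 else 0))), ?_⟩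
      by_cases p0 : 0 ∈ σ <;> by_cases p2 : 2 ∈ σ <;> by_cases r0 : 0 ∈ τ <;>
        by_cases r2 : 2 ∈ τ <;> simp_all <;> omega
    have d0 : ![x, y] ⬝ᵥ hirzebruchRay a 0 = x := by simp [hirzebruchRay, dotProduct]
    have d1 : ![x, y] ⬝ᵥ hirzebruchRay a 1 = y := by simp [hirzebruchRay, dotProduct]
    have d2 : ![x, y] ⬝ᵥ hirzebruchRay a 2 = w - x := by
      simp [hirzebruchRay, dotProduct, hw]
      ring
    have d3 : ![x, y] ⬝ᵥ hirzebruchRay a 3 = -y := by simp [hirzebruchRay, dotProduct]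
    refine ⟨![x, y], fun i hi => ?_, fun i hi => ?_, fun i hi => ?_⟩
    · obtain ⟨h, h'⟩ := Finset.mem_inter.mp hi
      fin_cases i
      exacts [d0.trans (x1 h h'), d1.trans (y1 h h'), d2.trans (x4 h h'),
        d3.trans (neg_eq_zero.mpr (y4 h h'))]
    · obtain ⟨h, h'⟩ := Finset.mem_sdiff.mp hi
      fin_cases i
      exacts [(x2 h h').trans_eq d0.symm, (y2 h h').trans_eq d1.symm, (x5 h h').trans_eq d2.symm,
        (neg_pos.mpr (y5 h h')).trans_eq d3.symm]
    · obtain ⟨h, h'⟩ := Finset.mem_sdiff.mp hi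
      fin_cases i
      exacts [d0.trans_lt (x3 h h'), d1.trans_lt (y3 h h'), d2.trans_lt (x6 h h'),
        d3.trans_lt (neg_lt_zero.mpr (y6 h h'))]

/-! ## The flag variety of `G₂` and its Schubert varieties -/

/-- The multiplication of the split octonion algebra over `k`, realized by Zorn's vector matrices:
the coordinates `(a, u₁, u₂, u₃, v₁, v₂, v₃, b)` stand for the matrix `(a u; v b)`, and
`(a u; v b) (a' u'; v' b') = (a a' + u ⬝ v', a u' + b' u - v × v'; a' v + b v' + u × u', b b' + v ⬝ u')`.
-/
def octonionMul {k : Type u} [CommRing k] (x y : Fin 8 → k) : Fin 8 → k :=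
  ![x 0 * y 0 + (x 1 * y 4 + x 2 * y 5 + x 3 * y 6),
    x 0 * y 1 + y 7 * x 1 - (x 5 * y 6 - x 6 * y 5),
    x 0 * y 2 + y 7 * x 2 - (x 6 * y 4 - x 4 * y 6),
    x 0 * y 3 + y 7 * x 3 - (x 4 * y 5 - x 5 * y 4),
    y 0 * x 4 + x 7 * y 4 + (x 2 * y 3 - x 3 * y 2),
    y 0 * x 5 + x 7 * y 5 + (x 3 * y 1 - x 1 * y 3),
    y 0 * x 6 + x 7 * y 6 + (x 1 * y 2 - x 2 * y 1),
    x 7 * y 7 + (x 4 * y 1 + x 5 * y 2 + x 6 * y 3)]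

section G2

open scoped Pointwise

attribute [local instance] MvPolynomial.gradedAlgebra

variable (k : Type u) [Field k]

/-- The group `G₂` of `k`-points: the automorphism group of the split octonion algebra. -/
def G2 : Subgroup ((Fin 8 → k) ≃ₗ[k] (Fin 8 → k)) where
  carrier := {g | ∀ x y, g (octonionMul x y) = octonionMul (g x) (g y)}
  one_mem' := fun _ _ => rfl
  mul_mem' := by
    intro g h hg hh x y
    rw [LinearEquiv.mul_apply, hh, hg]
    rfl
  inv_mem' := by
    intro g hg x y
    apply g.injective
    rw [hg]
    simp only [← LinearEquiv.mul_apply, mul_inv_cancel, LinearEquiv.coe_one, id]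

/-- A `k`-point of the flag variety of `G₂`: a flag `V₁ ⊂ V₂` of a line in a plane in the split
octonions such that the product of any two elements of `V₂` is zero. These flags (whose members
automatically consist of octonions of trace zero) form a single orbit of `G₂`, and their stabilizers
are the Borel subgroups. -/
structure G2Flag where
  /-- The line of the flag. -/
  line : Submodule k (Fin 8 → k)
  /-- The plane of the flag. -/
  plane : Submodule k (Fin 8 → k)
  finrank_line : Module.finrank k line = 1
  finrank_plane : Module.finrank k plane = 2
  line_le_plane : line ≤ plane
  mul_eq_zero : ∀ x ∈ plane, ∀ y ∈ plane, octonionMul x y = 0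

/-- The standard flag, spanned by the octonions with `u = (1, 0, 0)` and with `v = (0, 1, 0)`, and all
other entries zero. -/
def standardFlag : G2Flag k where
  line := Submodule.span k {Pi.single 1 1}
  plane := Submodule.span k {Pi.single 1 1, Pi.single 5 1}
  finrank_line := finrank_span_singleton (by simp)
  finrank_plane := by
    have h : LinearIndependent k ![(Pi.single 1 1 : Fin 8 → k), Pi.single 5 1] := by
      rw [LinearIndependent.pair_iff]
      intro s t hst
      have h1 := congrFun hst 1
      have h5 := congrFun hst 5
      simp at h1 h5
      exact ⟨h1, h5⟩
    have := finrank_span_eq_card h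
    rw [Matrix.range_cons_cons_empty] at this
    simpa using this
  line_le_plane := Submodule.span_mono (by simp)
  mul_eq_zero := by
    intro x hx y hy
    obtain ⟨a, b, rfl⟩ := Submodule.mem_span_pair.mp hx
    obtain ⟨c, d, rfl⟩ := Submodule.mem_span_pair.mp hy
    funext i
    fin_cases i <;> simp [octonionMul]

/-- The Borel subgroup `B` of `G₂`: the stabilizer of the standard flag. -/
def G2Borel : Subgroup ((Fin 8 → k) ≃ₗ[k] (Fin 8 → k)) :=
  G2 k ⊓ MulAction.stabilizer _ (standardFlag k).line ⊓
    MulAction.stabilizer _ (standardFlag k).plane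

variable {k}

/-- The `B`-orbit of a point of the flag variety. -/
def borelOrbit (E : G2Flag k) : Set (G2Flag k) :=
  {E' | ∃ b ∈ G2Borel k, b • E.line = E'.line ∧ b • E.plane = E'.plane}

/-- The coordinates of the flag `⟨x⟩ ⊂ ⟨x, y⟩` under the embedding of flags into
`ℙ(V) × ℙ(⋀² V) ⊂ ℙ(V ⊗ V ⊗ V)` for `V = k ^ 8`, that is, those of `x ⊗ (x ∧ y)`. -/
def flagCoord (x y : Fin 8 → k) : Fin 8 × Fin 8 × Fin 8 → k :=
  fun i => x i.1 * (x i.2.1 * y i.2.2 - x i.2.2 * y i.2.1)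

variable (k) in
/-- The ambient projective space `ℙ(V ⊗ V ⊗ V)`. -/
def flagSpace : Scheme.{u} :=
  Proj (MvPolynomial.homogeneousSubmodule (Fin 8 × Fin 8 × Fin 8) k)

variable (k) in
/-- The structure morphism of the ambient projective space. -/
def flagSpaceToSpec : flagSpace k ⟶ Spec (CommRingCat.of k) :=
  Proj.toSpecZero (MvPolynomial.homogeneousSubmodule (Fin 8 × Fin 8 × Fin 8) k) ≫
    Spec.map (CommRingCat.ofHom
      (algebraMap k (MvPolynomial.homogeneousSubmodule (Fin 8 × Fin 8 × Fin 8) k 0)))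

/-- The Zariski closure of the `B`-orbit of `E`: the common zero locus of all homogeneous forms that
vanish on the orbit. -/
def orbitClosure (E : G2Flag k) : Closeds (flagSpace k) :=
  ⟨ProjectiveSpectrum.zeroLocus (MvPolynomial.homogeneousSubmodule (Fin 8 × Fin 8 × Fin 8) k)
    {f | (∃ d, f.IsHomogeneous d) ∧ ∀ E' ∈ borelOrbit E, ∀ x y : Fin 8 → k,
      E'.line = Submodule.span k {x} → E'.plane = Submodule.span k {x, y} →
        MvPolynomial.eval (flagCoord x y) f = 0},
    ProjectiveSpectrum.isClosed_zeroLocus _ _⟩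

/-- The Schubert variety of the `B`-orbit of `E`: the closure of the orbit, with its reduced scheme
structure. -/
def schubertVariety (E : G2Flag k) : Scheme.{u} :=
  (Scheme.IdealSheafData.vanishingIdeal (orbitClosure E)).subscheme

/-- The structure morphism of a Schubert variety. -/
def schubertToSpec (E : G2Flag k) : schubertVariety E ⟶ Spec (CommRingCat.of k) :=
  (Scheme.IdealSheafData.vanishingIdeal (orbitClosure E)).subschemeι ≫ flagSpaceToSpec k

end G2

end

/-! ## Splittings from splittings on affine charts -/

namespace AlgebraicGeometry

/-! Diagonal splitting of a toric scheme is a question about lattice points. Let v_i be the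
generators of the rays, and let T be the torus. If every class in M / qM has a representative r with
|⟨r, v_i⟩| < q for all i, there is a diagonal splitting. Conversely, a diagonal splitting forces
such representatives to exist, for rays of the fan with primitive v_i.

Sufficiency (`Rounding.isDiagonallySplit`): put e(u) = (u + r(-u)) / q. Send x^u ⊗ x^v to x^(e(u)) ⊗
x^(w - e(u)) if u + v = q w, and to 0 if u + v is not in qM. By the bounds on r, the new exponents
pair with v_i to something greater than -1, hence nonnegative, whenever the old ones pair
nonnegatively. So every chart U_σ × U_τ is preserved. On the diagonal the map becomes x^(qw) ↦ x^w,
which depends only on u + v, so the ideal of the diagonal is preserved. The chart maps are glued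
inside the function field of the integral scheme X × X (`SplittingCover.splitting`).

Necessity (`DiagonalSplitting.exists_abs_lt`): x^u ⊗ x^(-u) equals 1 on the diagonal, so its image
under a compatible splitting contains some x^m ⊗ x^(-m). By semilinearity the image of x^v ⊗ x^(-v),
with v = u - q m, has a nonzero constant term. If |⟨v, v_i⟩| ≥ q, multiplying by a q-th power in one
factor gives a function regular along the divisor of v_i whose image has a pole there. Only
semilinearity over monomials is used, so the argument covers both the toric endomorphism and the
absolute Frobenius.

For F_a the representatives (x, y) must satisfy |x|, |y|, |a y - x| < q. Rounding down works for a ≤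
1. For a = 2 and q odd, y is rounded to the nearest multiple of q and x in the same direction as y.
For a ≥ 3, the class of (0, j) with j / q between 1/3 and 2/3 has no representative.

For G₂, consider the flags whose line lies in the plane ⟨e₁, e₅⟩ of the standard flag. A line ⟨s e₁
+ t e₅⟩ lies in a pencil of planes with zero multiplication, spanned by it and α e₁ + β e₅ + μ n(s,
t), with n quadratic in (s, t). In the coordinates s, t, λ = s β - t α, μ, the embedding of flags is
given by λ times linear monomials in s, t and μ times quartic ones. The exponents lie in a trapezoid
with horizontal edges of lengths 1 and 4, the polygon of F₃. A form vanishes on the Borel orbit of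
`surfaceFlag` if and only if it vanishes on this surface (`vanishesOnOrbit_iff`), because the orbit
lies in the surface and contains a dense torus orbit. So the Schubert variety is F₃, and
nonexistence carries over along the isomorphism. -/

theorem IsAffineOpen.exists_mul_res_pow_eq {X : Scheme.{u}} {U : X.Opens} (hU : IsAffineOpen U)
    (f : Γ(X, U)) (s : Γ(X, X.basicOpen f)) :
    ∃ (n : ℕ) (a : Γ(X, U)),
      s * X.presheaf.map (homOfLE (X.basicOpen_le f)).op (f ^ n) =
        X.presheaf.map (homOfLE (X.basicOpen_le f)).op a := by
  have := hU.isLocalization_basicOpen f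
  obtain ⟨n, a, h⟩ := IsLocalization.Away.surj f s
  refine ⟨n, a, ?_⟩
  rw [map_pow]
  exact h

theorem IsAffineOpen.exists_pow_mul_eq_zero {X : Scheme.{u}} {U : X.Opens} (hU : IsAffineOpen U)
    (f s : Γ(X, U)) (h : X.presheaf.map (homOfLE (X.basicOpen_le f)).op s = 0) :
    ∃ n : ℕ, f ^ n * s = 0 := by
  have := hU.isLocalization_basicOpen f
  obtain ⟨⟨_, n, rfl⟩, hc⟩ := (IsLocalization.map_eq_zero_iff (Submonoid.powers f)
    Γ(X, X.basicOpen f) s).mp h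
  exact ⟨n, hc⟩

theorem genericPoint_mem {X : Scheme.{u}} [IrreducibleSpace X] {U : X.Opens}
    (h : (U : Set X).Nonempty) : genericPoint X ∈ U :=
  ((genericPoint_spec X).mem_open_set_iff U.isOpen).mpr (by simpa using h)

theorem Scheme.germ_map {X : Scheme.{u}} {U V : X.Opens} (i : V ⟶ U) (x : X) (hx : x ∈ V)
    (s : Γ(X, U)) : X.presheaf.germ V x hx (X.presheaf.map i.op s) =
      X.presheaf.germ U x (i.le hx) s :=
  TopCat.Presheaf.germ_res_apply _ _ _ _ _

theorem Scheme.map_map {X : Scheme.{u}} {U V W : X.Opens} (i : V ⟶ U) (j : W ⟶ V) (s : Γ(X, U)) :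
    X.presheaf.map j.op (X.presheaf.map i.op s) = X.presheaf.map (j ≫ i).op s := by
  rw [op_comp, Functor.map_comp, CommRingCat.comp_apply]

theorem Scheme.app_map {X Y : Scheme.{u}} (f : Y ⟶ X) {U V : X.Opens} (i : V ⟶ U) (s : Γ(X, U)) :
    f.app V (X.presheaf.map i.op s) =
      Y.presheaf.map (homOfLE (f.preimage_mono i.le)).op (f.app U s) := by
  rw [← CommRingCat.comp_apply, f.naturality, CommRingCat.comp_apply]
  rfl

end AlgebraicGeometry

/-- A splitting of the functions on an open subset `V` with `V ⊆ F⁻¹ V`. -/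
structure ChartSplitting {P : Scheme.{u}} (F : P ⟶ P) (V : P.Opens) where
  /-- `V` is mapped to itself. -/
  le : V ≤ F ⁻¹ᵁ V
  /-- The map on sections. -/
  toFun : Γ(P, V) →+ Γ(P, V)
  map_smul : ∀ r s : Γ(P, V), toFun (F.appLE V V le r * s) = r * toFun s
  map_one : toFun 1 = 1

/-! ### Extension of a chart splitting to rational functions. -/

namespace ChartSplitting

variable {P : Scheme.{u}} {F : P ⟶ P} {V : P.Opens}

theorem map_appLE (π : ChartSplitting F V) (r : Γ(P, V)) : π.toFun (F.appLE V V π.le r) = r := by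
  have := π.map_smul r 1
  rwa [mul_one, π.map_one, mul_one] at this

theorem appLE_injective (π : ChartSplitting F V) : Function.Injective (F.appLE V V π.le) :=
  Function.LeftInverse.injective π.map_appLE

variable [IsIntegral P] (π : ChartSplitting F V) (hV : genericPoint P ∈ V)

/-- The extension of a splitting on a chart to rational functions, as a relation. -/
def FractionRel (s t : P.functionField) : Prop :=
  ∃ g b : Γ(P, V), g ≠ 0 ∧
    s * P.presheaf.germ V _ hV (F.appLE V V π.le g) = P.presheaf.germ V _ hV b ∧
    t * P.presheaf.germ V _ hV g = P.presheaf.germ V _ hV (π.toFun b)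

variable {π hV}

theorem germ_ne_zero {g : Γ(P, V)} (hg : g ≠ 0) : P.presheaf.germ V _ hV g ≠ 0 :=
  (map_ne_zero_iff _ (germ_injective_of_isIntegral P _ hV)).mpr hg

/-- Sections inject into the function field, so equal fractions give F^*g' · b = F^*g · b' on V.
Semilinearity turns this into g' · π b = g · π b'. -/
theorem FractionRel.unique {s t t' : P.functionField} (h : π.FractionRel hV s t)
    (h' : π.FractionRel hV s t') : t = t' := by
  obtain ⟨g, b, hg, e₁, e₂⟩ := h
  obtain ⟨g', b', hg', e₁', e₂'⟩ := h'
  have key : F.appLE V V π.le g' * b = F.appLE V V π.le g * b' := by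
    apply germ_injective_of_isIntegral P _ hV
    rw [map_mul, map_mul, ← e₁, ← e₁']
    ring
  have key' : g' * π.toFun b = g * π.toFun b' := by
    rw [← π.map_smul, ← π.map_smul, key]
  have key'' := congrArg (P.presheaf.germ V _ hV) key'
  rw [map_mul, map_mul, ← e₂, ← e₂'] at key''
  have := mul_ne_zero (germ_ne_zero (hV := hV) hg) (germ_ne_zero (hV := hV) hg')
  apply mul_right_cancel₀ this
  linear_combination key''

theorem FractionRel.add {s t s' t' : P.functionField} (h : π.FractionRel hV s t)
    (h' : π.FractionRel hV s' t') : π.FractionRel hV (s + s') (t + t') := by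
  obtain ⟨g, b, hg, e₁, e₂⟩ := h
  obtain ⟨g', b', hg', e₁', e₂'⟩ := h'
  have : Nonempty V := ⟨⟨_, hV⟩⟩
  refine ⟨g * g', F.appLE V V π.le g' * b + F.appLE V V π.le g * b', mul_ne_zero hg hg', ?_, ?_⟩
  · simp only [map_mul, map_add, ← e₁, ← e₁']
    ring
  · simp only [map_mul, map_add, π.map_smul, ← e₂, ← e₂']
    ring

theorem FractionRel.of_mem (b : Γ(P, V)) : π.FractionRel hV (P.presheaf.germ V _ hV b)
    (P.presheaf.germ V _ hV (π.toFun b)) := by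
  have : Nonempty V := ⟨⟨_, hV⟩⟩
  exact ⟨1, b, one_ne_zero, by simp, by simp⟩

/-- Semilinearity for a fraction r = c / g, with r' = F^*c / F^*g in the role of its pullback. -/
theorem FractionRel.mul {r s t r' : P.functionField} (h : π.FractionRel hV s t)
    {g c : Γ(P, V)} (hg : g ≠ 0) (hr : r * P.presheaf.germ V _ hV g = P.presheaf.germ V _ hV c)
    (hr' : r' * P.presheaf.germ V _ hV (F.appLE V V π.le g) =
      P.presheaf.germ V _ hV (F.appLE V V π.le c)) :
    π.FractionRel hV (r' * s) (r * t) := by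
  obtain ⟨g', b, hg', e₁, e₂⟩ := h
  have : Nonempty V := ⟨⟨_, hV⟩⟩
  refine ⟨g * g', F.appLE V V π.le c * b, mul_ne_zero hg hg', ?_, ?_⟩
  · simp only [map_mul, ← hr', ← e₁]
    ring
  · simp only [map_mul, π.map_smul, ← hr, ← e₂]
    ring

/-- By integrality a nonzero denominator stays nonzero on a smaller chart. This allows all charts to
be compared on the smallest one. -/
theorem FractionRel.restrict {W : P.Opens} {π' : ChartSplitting F W} (i : W ⟶ V)
    (hW : genericPoint P ∈ W)
    (hπ : ∀ s, P.presheaf.map i.op (π.toFun s) = π'.toFun (P.presheaf.map i.op s))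
    {s t : P.functionField} (h : π.FractionRel hV s t) : π'.FractionRel hW s t := by
  obtain ⟨g, b, hg, e₁, e₂⟩ := h
  have : Nonempty W := ⟨⟨_, hW⟩⟩
  refine ⟨P.presheaf.map i.op g, P.presheaf.map i.op b,
    (map_ne_zero_iff _ (map_injective_of_isIntegral P i)).mpr hg, ?_, ?_⟩
  · have : F.appLE W W π'.le (P.presheaf.map i.op g) =
        P.presheaf.map i.op (F.appLE V V π.le g) := by
      rw [← CommRingCat.comp_apply, ← CommRingCat.comp_apply, Scheme.Hom.map_appLE,
        Scheme.Hom.appLE_map]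
    rw [this, Scheme.germ_map, Scheme.germ_map, e₁]
  · rw [← hπ, Scheme.germ_map, Scheme.germ_map, e₂]

/-- F is dominant: a splitting makes F^* injective on V, so F^*g ≠ 0 for a nonzero g with D(g) ⊆ U,
and D(F^*g) is a nonempty open subset of F⁻¹ U. -/
theorem preimage_nonempty (π : ChartSplitting F V) (hV : genericPoint P ∈ V)
    (hVa : IsAffineOpen V) {U : P.Opens}
    (hU : (U : Set P).Nonempty) : genericPoint P ∈ F ⁻¹ᵁ U := by
  obtain ⟨g, hg, hx⟩ := hVa.exists_basicOpen_le ⟨genericPoint P, genericPoint_mem hU⟩ hV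
  have hg0 : g ≠ 0 := by
    rintro rfl
    simp at hx
  have : P.basicOpen (F.appLE V V π.le g) ≠ ⊥ := by
    rw [Ne, basicOpen_eq_bot_iff, map_eq_zero_iff _ π.appLE_injective]
    exact hg0
  rw [Scheme.basicOpen_appLE] at this
  have h := genericPoint_mem (X := P) ((Opens.ne_bot_iff_nonempty _).mp this)
  exact F.preimage_mono hg h.2

end ChartSplitting

namespace ChartSplitting

variable {P : Scheme.{u}} {F : P ⟶ P} {V : P.Opens}

/-- If `s` is a function on `F⁻¹ U` and `D(g) ⊆ U` for a function `g` on the chart `V`, then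
`s = b / (F^* g)^n` on `D(F^* g)`, and `π b / g^n` is a function on `D(g)`. -/
theorem exists_fraction (π : ChartSplitting F V) (hV : IsAffineOpen V) {U : P.Opens}
    (s : Γ(P, F ⁻¹ᵁ U)) (g : Γ(P, V))
    (hg' : P.basicOpen (F.appLE V V π.le g) ≤ F ⁻¹ᵁ U) :
    ∃ (n : ℕ) (b : Γ(P, V)) (t : Γ(P, P.basicOpen g)),
      P.presheaf.map (homOfLE hg').op s *
          P.presheaf.map (homOfLE (P.basicOpen_le _)).op (F.appLE V V π.le (g ^ n)) =
        P.presheaf.map (homOfLE (P.basicOpen_le _)).op b ∧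
      t * P.presheaf.map (homOfLE (P.basicOpen_le g)).op (g ^ n) =
        P.presheaf.map (homOfLE (P.basicOpen_le g)).op (π.toFun b) := by
  obtain ⟨n, b, h⟩ := hV.exists_mul_res_pow_eq _ (P.presheaf.map (homOfLE hg').op s)
  have := hV.isLocalization_basicOpen g
  have hu : IsUnit (P.presheaf.map (homOfLE (P.basicOpen_le g)).op (g ^ n)) := by
    rw [map_pow]
    exact (IsLocalization.Away.algebraMap_isUnit g).pow n
  obtain ⟨c, hc⟩ := hu.exists_left_inv
  refine ⟨n, b, P.presheaf.map (homOfLE (P.basicOpen_le g)).op (π.toFun b) * c, ?_, ?_⟩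
  · rw [map_pow]
    exact h
  · rw [mul_assoc, hc, mul_one]

theorem basicOpen_appLE_le (π : ChartSplitting F V) {U : P.Opens} {g : Γ(P, V)}
    (hg : P.basicOpen g ≤ U) : P.basicOpen (F.appLE V V π.le g) ≤ F ⁻¹ᵁ U := by
  rw [Scheme.basicOpen_appLE]
  exact inf_le_right.trans (F.preimage_mono hg)

end ChartSplitting

/-- Compatible splittings of the functions on the members of an affine open cover of an integral
scheme, one of which, `V i₀`, is contained in all the others. -/
structure SplittingCover {P : Scheme.{u}} (F : P ⟶ P) (ι : Type*) where
  /-- The charts. -/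
  V : ι → P.Opens
  isAffineOpen : ∀ i, IsAffineOpen (V i)
  covers : ∀ x : P, ∃ i, x ∈ V i
  /-- The smallest chart. -/
  i₀ : ι
  nonempty : (V i₀ : Set P).Nonempty
  le : ∀ i, V i₀ ≤ V i
  /-- The splittings on the charts. -/
  π : ∀ i, ChartSplitting F (V i)
  res : ∀ i s, P.presheaf.map (homOfLE (le i)).op ((π i).toFun s) =
    (π i₀).toFun (P.presheaf.map (homOfLE (le i)).op s)

/-! ### Gluing chart splittings. -/

namespace SplittingCover

variable {P : Scheme.{u}} {F : P ⟶ P} {ι : Type*} (𝒱 : SplittingCover F ι) [IsIntegral P]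

theorem genericPoint_mem : genericPoint P ∈ 𝒱.V 𝒱.i₀ :=
  AlgebraicGeometry.genericPoint_mem 𝒱.nonempty

theorem genericPoint_mem_preimage (𝒱 : SplittingCover F ι) {U : P.Opens} (hU : genericPoint P ∈ U) :
    genericPoint P ∈ F ⁻¹ᵁ U :=
  (𝒱.π 𝒱.i₀).preimage_nonempty 𝒱.genericPoint_mem (𝒱.isAffineOpen _) ⟨_, hU⟩

/-- The splitting on rational functions, as a relation. -/
def Rel (s t : P.functionField) : Prop :=
  (𝒱.π 𝒱.i₀).FractionRel 𝒱.genericPoint_mem s t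

theorem rel_of_eq {U W : P.Opens} (hU : genericPoint P ∈ U) (hW : genericPoint P ∈ W) (i : ι)
    {s : Γ(P, U)} {t : Γ(P, W)} {g b : Γ(P, 𝒱.V i)} (hg : g ≠ 0)
    (hs : P.presheaf.germ U _ hU s *
        P.presheaf.germ _ _ (𝒱.le i 𝒱.genericPoint_mem) (F.appLE _ _ (𝒱.π i).le g) =
      P.presheaf.germ _ _ (𝒱.le i 𝒱.genericPoint_mem) b)
    (ht : P.presheaf.germ W _ hW t * P.presheaf.germ _ _ (𝒱.le i 𝒱.genericPoint_mem) g =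
      P.presheaf.germ _ _ (𝒱.le i 𝒱.genericPoint_mem) ((𝒱.π i).toFun b)) :
    𝒱.Rel (P.presheaf.germ U _ hU s) (P.presheaf.germ W _ hW t) :=
  ChartSplitting.FractionRel.restrict (homOfLE (𝒱.le i)) _ (𝒱.res i) ⟨g, b, hg, hs, ht⟩

theorem exists_local {U : P.Opens} (s : Γ(P, F ⁻¹ᵁ U)) (x : P) (hx : x ∈ U) :
    ∃ (W : P.Opens) (_ : x ∈ W) (_ : W ≤ U) (hW : genericPoint P ∈ W)
      (hU : genericPoint P ∈ F ⁻¹ᵁ U) (t : Γ(P, W)),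
      𝒱.Rel (P.presheaf.germ _ _ hU s) (P.presheaf.germ W _ hW t) := by
  obtain ⟨i, hi⟩ := 𝒱.covers x
  obtain ⟨g, hg, hxg⟩ := (𝒱.isAffineOpen i).exists_basicOpen_le ⟨x, hx⟩ hi
  have hg0 : g ≠ 0 := by
    rintro rfl
    simp at hxg
  obtain ⟨n, b, t, h₁, h₂⟩ := (𝒱.π i).exists_fraction (𝒱.isAffineOpen i) s g
    ((𝒱.π i).basicOpen_appLE_le hg)
  have hW := AlgebraicGeometry.genericPoint_mem (X := P) ⟨x, hxg⟩
  have hU := 𝒱.genericPoint_mem_preimage (hg hW)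
  have hξ := 𝒱.le i 𝒱.genericPoint_mem
  have hW' : genericPoint P ∈ P.basicOpen (F.appLE _ _ (𝒱.π i).le g) := by
    rw [Scheme.basicOpen_appLE]
    exact ⟨hξ, 𝒱.genericPoint_mem_preimage hW⟩
  have : Nonempty (𝒱.V i) := ⟨⟨_, hξ⟩⟩
  refine ⟨P.basicOpen g, hxg, hg, hW, hU, t, 𝒱.rel_of_eq hU hW i (pow_ne_zero n hg0) (b := b) ?_ ?_⟩
  · have := congrArg (P.presheaf.germ _ _ hW') h₁
    rwa [map_mul, Scheme.germ_map, Scheme.germ_map, Scheme.germ_map] at this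
  · have := congrArg (P.presheaf.germ _ _ hW) h₂
    rwa [map_mul, Scheme.germ_map, Scheme.germ_map] at this

/-- The local candidates have the same germ at the generic point, since the relation is
single-valued. Hence they agree on overlaps and glue. -/
theorem exists_section (U : P.Opens) (s : Γ(P, F ⁻¹ᵁ U)) :
    ∃ t : Γ(P, U), ∀ (hU : genericPoint P ∈ F ⁻¹ᵁ U) (hU' : genericPoint P ∈ U),
      𝒱.Rel (P.presheaf.germ _ _ hU s) (P.presheaf.germ U _ hU' t) := by
  choose W hxW hWU hW hU t ht using 𝒱.exists_local s
  obtain ⟨t', ht', -⟩ := TopCat.Sheaf.existsUnique_gluing' P.sheaf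
    (fun x : U => W x.1 x.2) U (fun x => homOfLE (hWU x.1 x.2))
    (fun x hx => Opens.mem_iSup.mpr ⟨⟨x, hx⟩, hxW x hx⟩) (fun x => t x.1 x.2) (by
      intro x y
      have hxy : genericPoint P ∈ W x.1 x.2 ⊓ W y.1 y.2 := ⟨hW x.1 x.2, hW y.1 y.2⟩
      apply germ_injective_of_isIntegral P (genericPoint P) hxy
      refine (Scheme.germ_map _ _ _ _).trans (Eq.trans ?_ (Scheme.germ_map _ _ _ _).symm)
      exact (ht x.1 x.2).unique (ht y.1 y.2))
  refine ⟨t', fun h₁ h₂ => ?_⟩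
  have h := ht' ⟨_, h₂⟩
  have h' := ht _ h₂
  rw [← h] at h'
  convert h' using 1
  exact (Scheme.germ_map _ _ (hW _ h₂) _).symm

/-- The splitting on sections over an open subset. -/
noncomputable def sectionMap (U : P.Opens) (s : Γ(P, F ⁻¹ᵁ U)) : Γ(P, U) :=
  (𝒱.exists_section U s).choose

theorem rel_sectionMap {U : P.Opens} (s : Γ(P, F ⁻¹ᵁ U)) (hU : genericPoint P ∈ F ⁻¹ᵁ U)
    (hU' : genericPoint P ∈ U) :
    𝒱.Rel (P.presheaf.germ _ _ hU s) (P.presheaf.germ U _ hU' (𝒱.sectionMap U s)) :=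
  (𝒱.exists_section U s).choose_spec hU hU'

/-- Reduces every identity for the glued map to the relation on rational functions. An open set that
misses the generic point is empty and has only one section. -/
theorem sectionMap_eq {U : P.Opens} {s : Γ(P, F ⁻¹ᵁ U)} {t : Γ(P, U)}
    (h : ∀ (hU : genericPoint P ∈ F ⁻¹ᵁ U) (hU' : genericPoint P ∈ U),
      𝒱.Rel (P.presheaf.germ _ _ hU s) (P.presheaf.germ U _ hU' t)) :
    𝒱.sectionMap U s = t := by
  by_cases hU' : genericPoint P ∈ U
  · have hU := 𝒱.genericPoint_mem_preimage hU'
    exact germ_injective_of_isIntegral P _ hU' ((𝒱.rel_sectionMap s hU hU').unique (h hU hU'))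
  · have : U = ⊥ := by
      by_contra hne
      exact hU' (AlgebraicGeometry.genericPoint_mem ((Opens.ne_bot_iff_nonempty _).mp hne))
    subst this
    exact Subsingleton.elim _ _

/-- Writes r as c / g and F^*r as F^*c / F^*g with the same c and g, the input that
`FractionRel.mul` needs. -/
theorem exists_fraction (U : P.Opens) (hU : genericPoint P ∈ U) (r : Γ(P, U)) :
    ∃ g c : Γ(P, 𝒱.V 𝒱.i₀), g ≠ 0 ∧
      P.presheaf.germ U _ hU r * P.presheaf.germ _ _ 𝒱.genericPoint_mem g =
        P.presheaf.germ _ _ 𝒱.genericPoint_mem c ∧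
      P.presheaf.germ (F ⁻¹ᵁ U) _ (𝒱.genericPoint_mem_preimage hU) (F.app U r) *
          P.presheaf.germ _ _ 𝒱.genericPoint_mem (F.appLE _ _ (𝒱.π 𝒱.i₀).le g) =
        P.presheaf.germ _ _ 𝒱.genericPoint_mem (F.appLE _ _ (𝒱.π 𝒱.i₀).le c) := by
  have hξ := 𝒱.genericPoint_mem
  obtain ⟨g, hg, hxg⟩ := (𝒱.isAffineOpen 𝒱.i₀).exists_basicOpen_le ⟨_, hU⟩ hξ
  have hg0 : g ≠ 0 := by
    rintro rfl
    simp at hxg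
  obtain ⟨n, c, h⟩ := (𝒱.isAffineOpen 𝒱.i₀).exists_mul_res_pow_eq g
    (P.presheaf.map (homOfLE hg).op r)
  have : Nonempty (𝒱.V 𝒱.i₀) := ⟨⟨_, hξ⟩⟩
  refine ⟨g ^ n, c, pow_ne_zero n hg0, ?_, ?_⟩
  · have := congrArg (P.presheaf.germ _ _ hxg) h
    rwa [map_mul, Scheme.germ_map, Scheme.germ_map, Scheme.germ_map] at this
  · have hD := 𝒱.genericPoint_mem_preimage hxg
    have h' := congrArg (F.app (P.basicOpen g)) h
    have h'' := congrArg (P.presheaf.germ _ _ hD) h'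
    have key : ∀ {W : P.Opens} (i : P.basicOpen g ⟶ W) (r : Γ(P, W)),
        P.presheaf.germ _ _ hD (F.app (P.basicOpen g) (P.presheaf.map i.op r)) =
        P.presheaf.germ (F ⁻¹ᵁ W) _ (𝒱.genericPoint_mem_preimage (i.le hxg)) (F.app W r) := by
      intro W i r
      rw [Scheme.app_map]
      exact Scheme.germ_map _ _ _ _
    have key' : ∀ r, P.presheaf.germ (F ⁻¹ᵁ 𝒱.V 𝒱.i₀) _ (𝒱.genericPoint_mem_preimage hξ)
        (F.app _ r) = P.presheaf.germ _ _ 𝒱.genericPoint_mem (F.appLE _ _ (𝒱.π 𝒱.i₀).le r) := by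
      intro r
      rw [Scheme.Hom.appLE, CommRingCat.comp_apply]
      exact (Scheme.germ_map _ _ _ _).symm
    rw [map_mul, map_mul, key, key, key, key', key'] at h''
    exact h''

/-- The splitting obtained by gluing. -/
noncomputable def splitting : SchemeSplitting F where
  toFun U :=
    { toFun := 𝒱.sectionMap U
      map_zero' := 𝒱.sectionMap_eq fun hU hU' => by
        have := ChartSplitting.FractionRel.of_mem (π := 𝒱.π 𝒱.i₀) (hV := 𝒱.genericPoint_mem) 0
        simp only [map_zero] at this ⊢
        exact this
      map_add' := fun s t => 𝒱.sectionMap_eq fun hU hU' => by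
        rw [map_add, map_add]
        exact (𝒱.rel_sectionMap s hU hU').add (𝒱.rel_sectionMap t hU hU') }
  restrict U V i s := 𝒱.sectionMap_eq fun hV hV' => by
    rw [Scheme.germ_map, Scheme.germ_map]
    exact 𝒱.rel_sectionMap _ _ _
  map_smul U r s := 𝒱.sectionMap_eq fun hU hU' => by
    obtain ⟨g, c, hg, h₁, h₂⟩ := 𝒱.exists_fraction U hU' r
    rw [map_mul, map_mul]
    exact (𝒱.rel_sectionMap s hU hU').mul hg h₁ h₂
  comp_comorphism U r := 𝒱.sectionMap_eq fun hU hU' => by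
    obtain ⟨g, c, hg, h₁, h₂⟩ := 𝒱.exists_fraction U hU' r
    refine ⟨g, _, hg, h₂, ?_⟩
    rw [ChartSplitting.map_appLE]
    exact h₁

/-- On D(g), for g on any chart and not only the smallest, the glued splitting is π b / g^n, since
both are the same rational function. -/
theorem splitting_mul_eq (i : ι) {U : P.Opens} (s : Γ(P, F ⁻¹ᵁ U)) (g : Γ(P, 𝒱.V i))
    (hg : P.basicOpen g ≤ U) {n : ℕ} {b : Γ(P, 𝒱.V i)}
    (h : P.presheaf.map (homOfLE ((𝒱.π i).basicOpen_appLE_le hg)).op s *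
          P.presheaf.map (homOfLE (P.basicOpen_le _)).op (F.appLE _ _ (𝒱.π i).le (g ^ n)) =
        P.presheaf.map (homOfLE (P.basicOpen_le _)).op b) :
    P.presheaf.map (homOfLE hg).op (𝒱.splitting.toFun U s) *
        P.presheaf.map (homOfLE (P.basicOpen_le g)).op (g ^ n) =
      P.presheaf.map (homOfLE (P.basicOpen_le g)).op ((𝒱.π i).toFun b) := by
  by_cases hW : genericPoint P ∈ P.basicOpen g
  swap
  · have : P.basicOpen g = ⊥ := by
      by_contra hne
      exact hW (AlgebraicGeometry.genericPoint_mem ((Opens.ne_bot_iff_nonempty _).mp hne))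
    have : Subsingleton Γ(P, P.basicOpen g) := by
      rw [this]
      infer_instance
    exact Subsingleton.elim _ _
  have hg0 : g ≠ 0 := by
    rintro rfl
    simp at hW
  have hU := 𝒱.genericPoint_mem_preimage (hg hW)
  have hξ := 𝒱.le i 𝒱.genericPoint_mem
  have hW' : genericPoint P ∈ P.basicOpen (F.appLE _ _ (𝒱.π i).le g) := by
    rw [Scheme.basicOpen_appLE]
    exact ⟨hξ, 𝒱.genericPoint_mem_preimage hW⟩
  have : Nonempty (𝒱.V i) := ⟨⟨_, hξ⟩⟩
  have : Nonempty (P.basicOpen g) := ⟨⟨_, hW⟩⟩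
  have hgn : P.presheaf.germ _ _ hξ (g ^ n) ≠ 0 :=
    (map_ne_zero_iff _ (germ_injective_of_isIntegral P _ hξ)).mpr (pow_ne_zero n hg0)
  obtain ⟨t, ht⟩ : ∃ t, t * P.presheaf.germ _ _ hξ (g ^ n) =
      P.presheaf.germ _ _ hξ ((𝒱.π i).toFun b) := ⟨_, div_mul_cancel₀ _ hgn⟩
  have hrel : 𝒱.Rel (P.presheaf.germ _ _ hU s) t := by
    refine ChartSplitting.FractionRel.restrict (homOfLE (𝒱.le i)) _ (𝒱.res i)
      (hV := hξ) ⟨g ^ n, b, pow_ne_zero n hg0, ?_, ht⟩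
    have := congrArg (P.presheaf.germ _ _ hW') h
    rwa [map_mul, Scheme.germ_map, Scheme.germ_map, Scheme.germ_map] at this
  have hEq := (𝒱.rel_sectionMap s hU (hg hW)).unique hrel
  apply germ_injective_of_isIntegral P _ hW
  rw [map_mul, Scheme.germ_map, Scheme.germ_map, Scheme.germ_map, ← ht, ← hEq]
  rfl

/-- The glued splitting is compatible with `f : Y ⟶ P` if the splittings on enough charts are. -/
theorem splitting_isCompatible {Y : Scheme.{u}} (f : Y ⟶ P) (J : Set ι)
    (hY : ∀ y : Y, ∃ i ∈ J, f y ∈ 𝒱.V i) (hJ : ∀ i ∈ J, IsAffineOpen (f ⁻¹ᵁ 𝒱.V i))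
    (hker : ∀ i ∈ J, ∀ s, f.app (𝒱.V i) s = 0 → f.app (𝒱.V i) ((𝒱.π i).toFun s) = 0) :
    𝒱.splitting.IsCompatible f := by
  intro U s hs
  refine TopCat.Sheaf.eq_of_locally_eq' Y.sheaf
    (fun x : {p : (Σ i, Γ(P, 𝒱.V i)) // p.1 ∈ J ∧ P.basicOpen p.2 ≤ U} =>
      f ⁻¹ᵁ P.basicOpen x.1.2) (f ⁻¹ᵁ U) (fun x => homOfLE (f.preimage_mono x.2.2)) ?_ _ _ ?_
  · intro y hy
    obtain ⟨i, hi, hyi⟩ := hY y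
    obtain ⟨g, hg, hxg⟩ := (𝒱.isAffineOpen i).exists_basicOpen_le ⟨f y, hy⟩ hyi
    exact Opens.mem_iSup.mpr ⟨⟨⟨i, g⟩, hi, hg⟩, hxg⟩
  · rintro ⟨⟨i, g⟩, hi, hg⟩
    dsimp only at hi hg ⊢
    have hfg := (𝒱.π i).basicOpen_appLE_le hg
    obtain ⟨n, b, t, h₁, -⟩ := (𝒱.π i).exists_fraction (𝒱.isAffineOpen i) s g hfg
    have hz : Y.presheaf.map (homOfLE (Y.basicOpen_le _)).op
        (f.app _ b) = (0 : Γ(Y, Y.basicOpen (f.app _ (F.appLE _ _ (𝒱.π i).le g)))) := by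
      have h₃ := congrArg (f.app _) h₁
      rw [map_mul, Scheme.app_map, Scheme.app_map, Scheme.app_map, hs, map_zero, zero_mul] at h₃
      have e := f.preimage_basicOpen (F.appLE _ _ (𝒱.π i).le g)
      have h₄ := congrArg (Y.presheaf.map (homOfLE e.ge).op) h₃
      rw [map_zero, Scheme.map_map] at h₄
      exact h₄.symm
    -- f⁻¹ V_i is affine, so a function that vanishes on D(f^*F^*g) is killed by a power of f^*F^*g.
    obtain ⟨N, hN⟩ := (hJ i hi).exists_pow_mul_eq_zero _ _ hz
    -- (F^*g)^N b lies in the kernel on the whole chart, where compatibility is known. Its image is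
    -- g^N π b, and g is a unit on D(g).
    have hN' : f.app _ (g ^ N * (𝒱.π i).toFun b) = 0 := by
      rw [← (𝒱.π i).map_smul]
      apply hker i hi
      rw [map_mul, map_pow, map_pow, hN]
    have hs' := 𝒱.splitting_mul_eq i s g hg h₁
    have := (𝒱.isAffineOpen i).isLocalization_basicOpen g
    have hu : ∀ n : ℕ, IsUnit (f.app _ (P.presheaf.map (homOfLE (P.basicOpen_le g)).op (g ^ n))) := by
      intro n
      rw [map_pow, map_pow]
      exact ((IsLocalization.Away.algebraMap_isUnit (S := Γ(P, P.basicOpen g)) g).map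
        (f.app _).hom).pow n
    change Y.presheaf.map _ (f.app U _) = Y.presheaf.map _ 0
    rw [map_zero, ← (hu n).mul_left_eq_zero, ← (hu N).mul_right_eq_zero]
    have h₅ := congrArg (f.app _) hs'
    rw [map_mul, Scheme.app_map] at h₅
    rw [h₅, ← map_mul, ← map_mul, Scheme.app_map, hN', map_zero]

end SplittingCover

/-! ## Sections over affine charts -/

namespace AlgebraicGeometry

variable {B B' : CommRingCat.{u}} {P P' : Scheme.{u}}

/-- The sections over the range of an open immersion of an affine scheme. -/
noncomputable def chartSections (c : Spec B ⟶ P) [IsOpenImmersion c] : B ≅ Γ(P, c.opensRange) :=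
  (Scheme.ΓSpecIso B).symm ≪≫ IsOpenImmersion.ΓIsoTop c

theorem chartSections_hom_appLE (c : Spec B ⟶ P) [IsOpenImmersion c] (h) :
    (chartSections c).hom ≫ c.appLE c.opensRange ⊤ h = (Scheme.ΓSpecIso B).inv := by
  simp [chartSections, IsOpenImmersion.ΓIsoTop]

theorem isIso_appLE_opensRange (c : Spec B ⟶ P) [IsOpenImmersion c] (h) :
    IsIso (c.appLE c.opensRange ⊤ h) := by
  have := chartSections_hom_appLE c h
  rw [← Iso.eq_inv_comp] at this
  rw [this]
  infer_instance

/-- Both sides agree after pulling back along c' to Spec B', and this pullback is an isomorphism on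
sections over the range of c'. -/
theorem chartSections_naturality (c : Spec B ⟶ P) [IsOpenImmersion c] (c' : Spec B' ⟶ P')
    [IsOpenImmersion c'] (g : P' ⟶ P) (φ : B ⟶ B') (h : c' ≫ g = Spec.map φ ≫ c)
    (hle : c'.opensRange ≤ g ⁻¹ᵁ c.opensRange) :
    (chartSections c).hom ≫ g.appLE _ _ hle = φ ≫ (chartSections c').hom := by
  have h₀ : ⊤ ≤ c' ⁻¹ᵁ c'.opensRange := by simp
  have h₁ : ⊤ ≤ c ⁻¹ᵁ c.opensRange := by simp
  have := isIso_appLE_opensRange c' h₀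
  rw [← cancel_mono (c'.appLE c'.opensRange ⊤ h₀), Category.assoc, Category.assoc,
    Scheme.Hom.appLE_comp_appLE, chartSections_hom_appLE, Scheme.ΓSpecIso_inv_naturality]
  have e : (c' ≫ g).appLE c.opensRange ⊤ (h₀.trans (c'.preimage_mono hle)) =
      (Spec.map φ ≫ c).appLE c.opensRange ⊤ (by rw [← h]; exact h₀.trans (c'.preimage_mono hle)) := by
    congr 1
  rw [e, ← Scheme.Hom.appLE_comp_appLE (Spec.map φ) c c.opensRange ⊤ ⊤ h₁ le_rfl,
    ← Category.assoc, chartSections_hom_appLE]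
  simp [Scheme.Hom.appTop, Scheme.Hom.app_eq_appLE]

theorem opensRange_le_preimage {c : Spec B ⟶ P} [IsOpenImmersion c] {c' : Spec B' ⟶ P'}
    [IsOpenImmersion c'] {g : P' ⟶ P} {f : Spec B' ⟶ Spec B} (h : c' ≫ g = f ≫ c) :
    c'.opensRange ≤ g ⁻¹ᵁ c.opensRange := by
  rintro _ ⟨x, rfl⟩
  exact ⟨f x, by rw [← Scheme.Hom.comp_apply, ← Scheme.Hom.comp_apply, h]⟩

end AlgebraicGeometry

/-! ## The square of a toric scheme -/

namespace SimplicialFan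

noncomputable section

variable {ι : Type} [DecidableEq ι] {n : ℕ} (Φ : SimplicialFan ι n)

/-- The cones of a fan. -/
abbrev Cone : Type := {σ : Finset ι // σ ∈ Φ.cones}

variable (R : Type u) [CommRing R]

/-- The open immersion of `U_σ` into the toric scheme. -/
def coneι (σ : Φ.Cone) :
    Spec (CommRingCat.of (AddMonoidAlgebra R (Φ.dualMonoid σ.1))) ⟶ Φ.toricScheme R :=
  colimit.ι (Φ.diagram R) σ

instance (σ : Φ.Cone) : IsOpenImmersion (Φ.coneι R σ) :=
  inferInstanceAs (IsOpenImmersion (colimit.ι (Φ.diagram R) σ))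

theorem coneι_toSpec (σ : Φ.Cone) : Φ.coneι R σ ≫ Φ.toSpec R =
    Spec.map (CommRingCat.ofHom (algebraMap R (AddMonoidAlgebra R (Φ.dualMonoid σ.1)))) :=
  colimit.ι_desc _ _

theorem coneι_frobenius (q : ℕ) (σ : Φ.Cone) : Φ.coneι R σ ≫ Φ.frobenius R q =
    Spec.map (CommRingCat.ofHom (AddMonoidAlgebra.mapDomainRingHom R
      (nsmulAddMonoidHom (α := Φ.dualMonoid σ.1) q))) ≫ Φ.coneι R σ :=
  ι_colimMap _ _

theorem faceMap_coneι {σ τ : Φ.Cone} (h : σ ≤ τ) :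
    Spec.map (CommRingCat.ofHom (Φ.faceMap R (σ := τ.1) (τ := σ.1) h)) ≫ Φ.coneι R τ =
      Φ.coneι R σ :=
  colimit.w (Φ.diagram R) (homOfLE h)

theorem exists_coneι_eq (x : Φ.toricScheme R) : ∃ (σ : Φ.Cone) (y : _), Φ.coneι R σ y = x :=
  Scheme.IsLocallyDirected.ι_jointly_surjective (Φ.diagram R) x

theorem coneι_eq_coneι_iff {σ τ : Φ.Cone}
    {x : Spec (CommRingCat.of (AddMonoidAlgebra R (Φ.dualMonoid σ.1)))}
    {y : Spec (CommRingCat.of (AddMonoidAlgebra R (Φ.dualMonoid τ.1)))} :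
    Φ.coneι R σ x = Φ.coneι R τ y ↔ ∃ (κ : Φ.Cone) (f : κ ≤ σ) (g : κ ≤ τ) (z : _),
      Spec.map (CommRingCat.ofHom (Φ.faceMap R (σ := σ.1) (τ := κ.1) f)) z = x ∧
      Spec.map (CommRingCat.ofHom (Φ.faceMap R (σ := τ.1) (τ := κ.1) g)) z = y := by
  refine (Scheme.IsLocallyDirected.ι_eq_ι_iff (Φ.diagram R)).trans ?_
  constructor
  · rintro ⟨κ, f, g, z, h⟩
    exact ⟨κ, leOfHom f, leOfHom g, z, h⟩
  · rintro ⟨κ, f, g, z, h⟩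
    exact ⟨κ, homOfLE f, homOfLE g, z, h⟩

/-- The functions `R[(σ^∨ × τ^∨) ∩ (M × M)]` on `U_σ × U_τ`. -/
abbrev ProdRing (σ τ : Finset ι) : Type u :=
  AddMonoidAlgebra R (Φ.dualMonoid σ × Φ.dualMonoid τ)

/-- The comorphism of the first projection. -/
def prodFst (σ τ : Finset ι) : AddMonoidAlgebra R (Φ.dualMonoid σ) →+* Φ.ProdRing R σ τ :=
  AddMonoidAlgebra.mapDomainRingHom R (AddMonoidHom.inl _ _)

/-- The comorphism of the second projection. -/
def prodSnd (σ τ : Finset ι) : AddMonoidAlgebra R (Φ.dualMonoid τ) →+* Φ.ProdRing R σ τ :=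
  AddMonoidAlgebra.mapDomainRingHom R (AddMonoidHom.inr _ _)

variable {R} in
/-- The universal property of `R[(σ^∨ × τ^∨) ∩ (M × M)]`. -/
def prodLift {σ τ : Finset ι} {T : Type u} [CommRing T]
    (f : AddMonoidAlgebra R (Φ.dualMonoid σ) →+* T) (g : AddMonoidAlgebra R (Φ.dualMonoid τ) →+* T) :
    Φ.ProdRing R σ τ →+* T :=
  AddMonoidAlgebra.liftNCRingHom (f.comp AddMonoidAlgebra.singleZeroRingHom)
    { toFun := fun m => f (AddMonoidAlgebra.single m.toAdd.1 1) *
        g (AddMonoidAlgebra.single m.toAdd.2 1)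
      map_one' := by
        simp [← AddMonoidAlgebra.one_def]
      map_mul' := by
        intro a b
        have h : ∀ {N : Type} [AddCommMonoid N] (a b : N),
            (AddMonoidAlgebra.single (a + b) 1 : AddMonoidAlgebra R N) =
              AddMonoidAlgebra.single a 1 * AddMonoidAlgebra.single b 1 := by
          intro N _ a b
          rw [AddMonoidAlgebra.single_mul_single, mul_one]
        simp only [toAdd_mul, Prod.fst_add, Prod.snd_add, h, map_mul]
        ring } (fun _ _ => mul_comm _ _)

theorem prodLift_single {σ τ : Finset ι} {T : Type u} [CommRing T]
    (f : AddMonoidAlgebra R (Φ.dualMonoid σ) →+* T) (g : AddMonoidAlgebra R (Φ.dualMonoid τ) →+* T)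
    (m : Φ.dualMonoid σ × Φ.dualMonoid τ) (r : R) :
    Φ.prodLift f g (AddMonoidAlgebra.single m r) =
      f (AddMonoidAlgebra.single m.1 r) * g (AddMonoidAlgebra.single m.2 1) := by
  refine (AddMonoidAlgebra.liftNC_single _ _ _ _).trans ?_
  change f (AddMonoidAlgebra.single 0 r) * (f (AddMonoidAlgebra.single m.1 1) *
    g (AddMonoidAlgebra.single m.2 1)) = _
  rw [← mul_assoc, ← map_mul, AddMonoidAlgebra.single_mul_single, zero_add, mul_one]

theorem prodFst_single {σ τ : Finset ι} (m : Φ.dualMonoid σ) (r : R) :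
    Φ.prodFst R σ τ (AddMonoidAlgebra.single m r) = AddMonoidAlgebra.single (m, 0) r := by
  simp [prodFst]

theorem prodSnd_single {σ τ : Finset ι} (m : Φ.dualMonoid τ) (r : R) :
    Φ.prodSnd R σ τ (AddMonoidAlgebra.single m r) = AddMonoidAlgebra.single (0, m) r := by
  simp [prodSnd]

theorem addMonoidAlgebra_hom_ext {G : Type} [AddCommMonoid G] {T : Type*} [CommRing T]
    {f g : AddMonoidAlgebra R G →+* T}
    (h : ∀ m r, f (AddMonoidAlgebra.single m r) = g (AddMonoidAlgebra.single m r)) : f = g :=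
  AddMonoidAlgebra.ringHom_ext (fun _ => h _ _) (fun _ => h _ _)

/-- x^(m, n) = x^(m, 0) x^(0, n), so the algebra of a product of monoids is the coproduct of
R-algebras. `Spec` turns this into the fibre product U_σ × U_τ. -/
theorem isPushout_prod (σ τ : Finset ι) :
    IsPushout (CommRingCat.ofHom (algebraMap R (AddMonoidAlgebra R (Φ.dualMonoid σ))))
      (CommRingCat.ofHom (algebraMap R (AddMonoidAlgebra R (Φ.dualMonoid τ))))
      (CommRingCat.ofHom (Φ.prodFst R σ τ)) (CommRingCat.ofHom (Φ.prodSnd R σ τ)) where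
  w := by
    ext r
    simp [prodFst, prodSnd]
  isColimit' := by
    refine ⟨PushoutCocone.IsColimit.mk _
      (fun s => CommRingCat.ofHom (Φ.prodLift s.inl.hom s.inr.hom)) ?_ ?_ ?_⟩
    · intro s
      refine CommRingCat.hom_ext (addMonoidAlgebra_hom_ext R fun x r => ?_)
      change Φ.prodLift _ _ (Φ.prodFst R σ τ _) = _
      rw [prodFst_single, prodLift_single, ← AddMonoidAlgebra.one_def, map_one, mul_one]
    · intro s
      have hs := s.condition
      refine CommRingCat.hom_ext (addMonoidAlgebra_hom_ext R fun x r => ?_)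
      have h : s.inl.hom (AddMonoidAlgebra.single 0 r) = s.inr.hom (AddMonoidAlgebra.single 0 r) :=
        congrArg (fun f => f.hom r) hs
      change Φ.prodLift _ _ (Φ.prodSnd R σ τ _) = _
      rw [prodSnd_single, prodLift_single, h, ← map_mul, AddMonoidAlgebra.single_mul_single,
        zero_add, mul_one]
    · intro s m h₁ h₂
      refine CommRingCat.hom_ext (addMonoidAlgebra_hom_ext R fun x r => ?_)
      change _ = Φ.prodLift _ _ _
      rw [prodLift_single, ← h₁, ← h₂]
      change _ = m.hom (Φ.prodFst R σ τ _) * m.hom (Φ.prodSnd R σ τ _)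
      rw [← map_mul, prodFst_single, prodSnd_single, AddMonoidAlgebra.single_mul_single]
      simp

/-- The open immersion of `U_σ × U_τ` into the square of the toric scheme. -/
def prodι (σ τ : Φ.Cone) : Spec (CommRingCat.of (Φ.ProdRing R σ.1 τ.1)) ⟶
    pullback (Φ.toSpec R) (Φ.toSpec R) :=
  pullback.lift (Spec.map (CommRingCat.ofHom (Φ.prodFst R σ.1 τ.1)) ≫ Φ.coneι R σ)
    (Spec.map (CommRingCat.ofHom (Φ.prodSnd R σ.1 τ.1)) ≫ Φ.coneι R τ) (by
      rw [Category.assoc, Category.assoc, coneι_toSpec, coneι_toSpec, ← Spec.map_comp,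
        ← Spec.map_comp, (Φ.isPushout_prod R σ.1 τ.1).w])

theorem prodι_fst (σ τ : Φ.Cone) : Φ.prodι R σ τ ≫ pullback.fst _ _ =
    Spec.map (CommRingCat.ofHom (Φ.prodFst R σ.1 τ.1)) ≫ Φ.coneι R σ :=
  pullback.lift_fst _ _ _

theorem prodι_snd (σ τ : Φ.Cone) : Φ.prodι R σ τ ≫ pullback.snd _ _ =
    Spec.map (CommRingCat.ofHom (Φ.prodSnd R σ.1 τ.1)) ≫ Φ.coneι R τ :=
  pullback.lift_snd _ _ _

theorem isPullback_prod (σ τ : Φ.Cone) :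
    IsPullback (Spec.map (CommRingCat.ofHom (Φ.prodFst R σ.1 τ.1)))
      (Spec.map (CommRingCat.ofHom (Φ.prodSnd R σ.1 τ.1)))
      (Φ.coneι R σ ≫ Φ.toSpec R) (Φ.coneι R τ ≫ Φ.toSpec R) := by
  rw [coneι_toSpec, coneι_toSpec]
  exact (Φ.isPushout_prod R σ.1 τ.1).flip.op.map Scheme.Spec

/-- An isomorphism followed by a product of open immersions: this shows that `prodι` is an open
immersion and determines its range. -/
theorem prodι_eq (σ τ : Φ.Cone) : Φ.prodι R σ τ =
    (Φ.isPullback_prod R σ τ).isoPullback.hom ≫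
      pullback.map _ _ _ _ (Φ.coneι R σ) (Φ.coneι R τ) (𝟙 _) (Category.comp_id _)
        (Category.comp_id _) := by
  apply pullback.hom_ext
  · rw [prodι_fst, Category.assoc, pullback.map, pullback.lift_fst, ← Category.assoc,
      IsPullback.isoPullback_hom_fst]
  · rw [prodι_snd, Category.assoc, pullback.map, pullback.lift_snd, ← Category.assoc,
      IsPullback.isoPullback_hom_snd]

instance (σ τ : Φ.Cone) : IsOpenImmersion (Φ.prodι R σ τ) := by
  rw [prodι_eq]
  infer_instance

theorem mem_opensRange_prodι {σ τ : Φ.Cone} (x : ↑(pullback (Φ.toSpec R) (Φ.toSpec R))) :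
    x ∈ (Φ.prodι R σ τ).opensRange ↔
      pullback.fst (Φ.toSpec R) (Φ.toSpec R) x ∈ (Φ.coneι R σ).opensRange ∧
      pullback.snd (Φ.toSpec R) (Φ.toSpec R) x ∈ (Φ.coneι R τ).opensRange := by
  constructor
  · rintro ⟨y, rfl⟩
    rw [← Scheme.Hom.comp_apply, ← Scheme.Hom.comp_apply, prodι_fst, prodι_snd]
    exact ⟨⟨_, rfl⟩, ⟨_, rfl⟩⟩
  · intro h
    change x ∈ Set.range (Φ.prodι R σ τ)
    rw [prodι_eq, Scheme.Hom.comp_base, TopCat.coe_comp, Set.range_comp,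
      Set.range_eq_univ.mpr (Scheme.Hom.surjective _), Set.image_univ, Scheme.Pullback.range_map]
    exact h

theorem exists_mem_prodι (x : ↑(pullback (Φ.toSpec R) (Φ.toSpec R))) :
    ∃ σ τ : Φ.Cone, x ∈ (Φ.prodι R σ τ).opensRange := by
  obtain ⟨σ, y, hy⟩ := Φ.exists_coneι_eq R (pullback.fst (Φ.toSpec R) (Φ.toSpec R) x)
  obtain ⟨τ, z, hz⟩ := Φ.exists_coneι_eq R (pullback.snd (Φ.toSpec R) (Φ.toSpec R) x)
  exact ⟨σ, τ, (Φ.mem_opensRange_prodι R x).mpr ⟨⟨y, hy⟩, ⟨z, hz⟩⟩⟩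

end

end SimplicialFan

/-! ### Restriction, F × F and the diagonal on the charts of the square. -/

namespace SimplicialFan

noncomputable section

variable {ι : Type} [DecidableEq ι] {n : ℕ} (Φ : SimplicialFan ι n) (R : Type u) [CommRing R]

/-- The restriction from `U_σ × U_τ` to `U_σ' × U_τ'`. -/
def prodFaceMap {σ τ σ' τ' : Finset ι} (h : σ' ≤ σ) (h' : τ' ≤ τ) :
    Φ.ProdRing R σ τ →+* Φ.ProdRing R σ' τ' :=
  AddMonoidAlgebra.mapDomainRingHom R
    ((AddSubmonoid.inclusion (dualMonoid_anti h)).prodMap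
      (AddSubmonoid.inclusion (dualMonoid_anti h')))

/-- The comorphism of `F × F`. -/
def prodFrobenius (q : ℕ) (σ τ : Finset ι) : Φ.ProdRing R σ τ →+* Φ.ProdRing R σ τ :=
  AddMonoidAlgebra.mapDomainRingHom R (nsmulAddMonoidHom q)

/-- The comorphism of the diagonal. -/
def prodDiag (σ : Finset ι) : Φ.ProdRing R σ σ →+* AddMonoidAlgebra R (Φ.dualMonoid σ) :=
  AddMonoidAlgebra.mapDomainRingHom R
    ((AddMonoidHom.id (Φ.dualMonoid σ)).coprod (AddMonoidHom.id (Φ.dualMonoid σ)))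

variable {R}

theorem prodFaceMap_single {σ τ σ' τ' : Finset ι} (h : σ' ≤ σ) (h' : τ' ≤ τ)
    (m : Φ.dualMonoid σ × Φ.dualMonoid τ) (r : R) :
    Φ.prodFaceMap R h h' (AddMonoidAlgebra.single m r) = AddMonoidAlgebra.single
      (AddSubmonoid.inclusion (dualMonoid_anti h) m.1,
        AddSubmonoid.inclusion (dualMonoid_anti h') m.2) r := by
  simp [prodFaceMap]
  rfl

theorem prodFrobenius_single (q : ℕ) {σ τ : Finset ι} (m : Φ.dualMonoid σ × Φ.dualMonoid τ)
    (r : R) : Φ.prodFrobenius R q σ τ (AddMonoidAlgebra.single m r) =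
      AddMonoidAlgebra.single (q • m) r := by
  simp [prodFrobenius]

theorem prodDiag_single {σ : Finset ι} (m : Φ.dualMonoid σ × Φ.dualMonoid σ) (r : R) :
    Φ.prodDiag R σ (AddMonoidAlgebra.single m r) = AddMonoidAlgebra.single (m.1 + m.2) r := by
  simp [prodDiag]

theorem prodFaceMap_injective {σ τ σ' τ' : Finset ι} (h : σ' ≤ σ) (h' : τ' ≤ τ) :
    Function.Injective (Φ.prodFaceMap R h h') :=
  AddMonoidAlgebra.mapDomain_injective
    ((AddSubmonoid.inclusion_injective (dualMonoid_anti h)).prodMap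
      (AddSubmonoid.inclusion_injective (dualMonoid_anti h')))

variable (R)

theorem prodFaceMap_prodι {σ τ σ' τ' : Φ.Cone} (h : σ' ≤ σ) (h' : τ' ≤ τ) :
    Spec.map (CommRingCat.ofHom (Φ.prodFaceMap R h h')) ≫ Φ.prodι R σ τ = Φ.prodι R σ' τ' := by
  apply pullback.hom_ext
  · rw [Category.assoc, prodι_fst, prodι_fst, ← Φ.faceMap_coneι R h, ← Category.assoc,
      ← Category.assoc, ← Spec.map_comp, ← Spec.map_comp]
    congr 2
    refine CommRingCat.hom_ext (addMonoidAlgebra_hom_ext R fun x r => ?_)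
    change Φ.prodFaceMap R h h' (Φ.prodFst R _ _ _) = Φ.prodFst R _ _ (Φ.faceMap R h _)
    rw [prodFst_single, prodFaceMap_single, faceMap_single, prodFst_single, map_zero]
  · rw [Category.assoc, prodι_snd, prodι_snd, ← Φ.faceMap_coneι R h', ← Category.assoc,
      ← Category.assoc, ← Spec.map_comp, ← Spec.map_comp]
    congr 2
    refine CommRingCat.hom_ext (addMonoidAlgebra_hom_ext R fun x r => ?_)
    change Φ.prodFaceMap R h h' (Φ.prodSnd R _ _ _) = Φ.prodSnd R _ _ (Φ.faceMap R h' _)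
    rw [prodSnd_single, prodFaceMap_single, faceMap_single, prodSnd_single, map_zero]

/-- The endomorphism `F × F` of the square of the toric scheme. -/
abbrev squareFrobenius (q : ℕ) :
    pullback (Φ.toSpec R) (Φ.toSpec R) ⟶ pullback (Φ.toSpec R) (Φ.toSpec R) :=
  pullback.map _ _ _ _ (Φ.frobenius R q) (Φ.frobenius R q) (𝟙 _)
    (by rw [Φ.frobenius_toSpec, Category.comp_id]) (by rw [Φ.frobenius_toSpec, Category.comp_id])

theorem squareFrobenius_fst (q : ℕ) : Φ.squareFrobenius R q ≫ pullback.fst _ _ =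
    pullback.fst _ _ ≫ Φ.frobenius R q :=
  pullback.lift_fst _ _ _

theorem squareFrobenius_snd (q : ℕ) : Φ.squareFrobenius R q ≫ pullback.snd _ _ =
    pullback.snd _ _ ≫ Φ.frobenius R q :=
  pullback.lift_snd _ _ _

theorem prodι_squareFrobenius (q : ℕ) (σ τ : Φ.Cone) :
    Φ.prodι R σ τ ≫ Φ.squareFrobenius R q =
      Spec.map (CommRingCat.ofHom (Φ.prodFrobenius R q σ.1 τ.1)) ≫ Φ.prodι R σ τ := by
  apply pullback.hom_ext
  · rw [Category.assoc, squareFrobenius_fst, ← Category.assoc, prodι_fst, Category.assoc, coneι_frobenius,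
      Category.assoc, prodι_fst, ← Category.assoc, ← Category.assoc, ← Spec.map_comp,
      ← Spec.map_comp]
    congr 2
    refine CommRingCat.hom_ext (addMonoidAlgebra_hom_ext R fun x r => ?_)
    change Φ.prodFst R _ _ (AddMonoidAlgebra.mapDomainRingHom R _ _) =
      Φ.prodFrobenius R q _ _ (Φ.prodFst R _ _ _)
    rw [prodFst_single, prodFrobenius_single, AddMonoidAlgebra.mapDomainRingHom_apply,
      AddMonoidAlgebra.mapDomain_single, prodFst_single]
    simp
  · rw [Category.assoc, squareFrobenius_snd, ← Category.assoc, prodι_snd, Category.assoc, coneι_frobenius,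
      Category.assoc, prodι_snd, ← Category.assoc, ← Category.assoc, ← Spec.map_comp,
      ← Spec.map_comp]
    congr 2
    refine CommRingCat.hom_ext (addMonoidAlgebra_hom_ext R fun x r => ?_)
    change Φ.prodSnd R _ _ (AddMonoidAlgebra.mapDomainRingHom R _ _) =
      Φ.prodFrobenius R q _ _ (Φ.prodSnd R _ _ _)
    rw [prodSnd_single, prodFrobenius_single, AddMonoidAlgebra.mapDomainRingHom_apply,
      AddMonoidAlgebra.mapDomain_single, prodSnd_single]
    simp

theorem coneι_diagonal (σ : Φ.Cone) :
    Φ.coneι R σ ≫ pullback.diagonal (Φ.toSpec R) =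
      Spec.map (CommRingCat.ofHom (Φ.prodDiag R σ.1)) ≫ Φ.prodι R σ σ := by
  apply pullback.hom_ext
  · rw [Category.assoc, pullback.diagonal_fst, Category.assoc, prodι_fst, ← Category.assoc,
      ← Spec.map_comp]
    have : CommRingCat.ofHom (Φ.prodFst R σ.1 σ.1) ≫ CommRingCat.ofHom (Φ.prodDiag R σ.1) =
        𝟙 _ := by
      refine CommRingCat.hom_ext (addMonoidAlgebra_hom_ext R fun x r => ?_)
      change Φ.prodDiag R _ (Φ.prodFst R _ _ _) = AddMonoidAlgebra.single x r
      rw [prodFst_single, prodDiag_single, add_zero]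
    rw [this, Spec.map_id, Category.id_comp, Category.comp_id]
  · rw [Category.assoc, pullback.diagonal_snd, Category.assoc, prodι_snd, ← Category.assoc,
      ← Spec.map_comp]
    have : CommRingCat.ofHom (Φ.prodSnd R σ.1 σ.1) ≫ CommRingCat.ofHom (Φ.prodDiag R σ.1) =
        𝟙 _ := by
      refine CommRingCat.hom_ext (addMonoidAlgebra_hom_ext R fun x r => ?_)
      change Φ.prodDiag R _ (Φ.prodSnd R _ _ _) = AddMonoidAlgebra.single x r
      rw [prodSnd_single, prodDiag_single, zero_add]
    rw [this, Spec.map_id, Category.id_comp, Category.comp_id]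

/-! ### Preimages of charts -/

theorem diagonal_preimage (σ : Φ.Cone) :
    pullback.diagonal (Φ.toSpec R) ⁻¹ᵁ (Φ.prodι R σ σ).opensRange = (Φ.coneι R σ).opensRange := by
  ext x
  refine (Φ.mem_opensRange_prodι R _).trans ?_
  rw [← Scheme.Hom.comp_apply, ← Scheme.Hom.comp_apply, pullback.diagonal_fst,
    pullback.diagonal_snd]
  exact and_self_iff

/-- Inside U_τ, a smaller chart U_κ is the locus D(x^u) for a u that cuts out the face κ. Since
F^*(x^u) = (x^u)^q, a point of U_τ lies in D(x^u) if its image under F does. -/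
theorem frobenius_preimage {q : ℕ} (hq : 0 < q) (σ : Φ.Cone) :
    Φ.frobenius R q ⁻¹ᵁ (Φ.coneι R σ).opensRange = (Φ.coneι R σ).opensRange := by
  apply le_antisymm
  · intro x hx
    obtain ⟨τ, y, rfl⟩ := Φ.exists_coneι_eq R x
    obtain ⟨z, hz⟩ : Φ.frobenius R q (Φ.coneι R τ y) ∈ Set.range (Φ.coneι R σ) := hx
    rw [← Scheme.Hom.comp_apply, coneι_frobenius, Scheme.Hom.comp_apply,
      coneι_eq_coneι_iff] at hz
    obtain ⟨κ, f, g, w, -, hw⟩ := hz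
    obtain ⟨u, u0, u1⟩ := Φ.exists_face τ.2 g
    have hr := Φ.range_diagram_map R (homOfLE g) u u0 u1
    have hy : y ∈ Set.range ((Φ.diagram R).map (homOfLE g)) := by
      have h₁ : Spec.map (CommRingCat.ofHom (AddMonoidAlgebra.mapDomainRingHom R
          (nsmulAddMonoidHom (α := Φ.dualMonoid τ.1) q))) y ∈
          Set.range ((Φ.diagram R).map (homOfLE g)) := ⟨w, hw⟩
      rw [hr] at h₁ ⊢
      have h₂ : AddMonoidAlgebra.mapDomainRingHom R (nsmulAddMonoidHom (α := Φ.dualMonoid τ.1) q)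
          (AddMonoidAlgebra.single u (1 : R)) ∉ y.asIdeal := h₁
      have h₃ : AddMonoidAlgebra.mapDomainRingHom R (nsmulAddMonoidHom (α := Φ.dualMonoid τ.1) q)
          (AddMonoidAlgebra.single u (1 : R)) = AddMonoidAlgebra.single u (1 : R) ^ q := by
        simp [AddMonoidAlgebra.single_pow]
      rw [h₃] at h₂
      exact fun h => h₂ (y.asIdeal.pow_mem_of_mem h q hq)
    obtain ⟨w', hw'⟩ := hy
    refine ⟨Spec.map (CommRingCat.ofHom (Φ.faceMap R (σ := σ.1) (τ := κ.1) f)) w', ?_⟩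
    rw [← hw']
    exact (Φ.coneι_eq_coneι_iff R).mpr ⟨κ, f, g, w', rfl, rfl⟩
  · exact opensRange_le_preimage (Φ.coneι_frobenius R q σ)

theorem squareFrobenius_preimage {q : ℕ} (hq : 0 < q) (σ τ : Φ.Cone) :
    Φ.squareFrobenius R q ⁻¹ᵁ (Φ.prodι R σ τ).opensRange = (Φ.prodι R σ τ).opensRange := by
  ext x
  refine (Φ.mem_opensRange_prodι R _).trans (Iff.trans ?_ (Φ.mem_opensRange_prodι R x).symm)
  rw [← Scheme.Hom.comp_apply, ← Scheme.Hom.comp_apply, squareFrobenius_fst,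
    squareFrobenius_snd, Scheme.Hom.comp_apply, Scheme.Hom.comp_apply]
  have h : ∀ (σ : Φ.Cone) (y : Φ.toricScheme R),
      Φ.frobenius R q y ∈ (Φ.coneι R σ).opensRange ↔ y ∈ (Φ.coneι R σ).opensRange := by
    intro σ y
    conv_rhs => rw [← Φ.frobenius_preimage R hq σ]
    rfl
  rw [h, h]

theorem opensRange_prodι_mono {σ τ σ' τ' : Φ.Cone} (h : σ' ≤ σ) (h' : τ' ≤ τ) :
    (Φ.prodι R σ' τ').opensRange ≤ (Φ.prodι R σ τ).opensRange := by
  rintro _ ⟨x, rfl⟩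
  refine ⟨Spec.map (CommRingCat.ofHom (Φ.prodFaceMap R h h')) x, ?_⟩
  rw [← Scheme.Hom.comp_apply, Φ.prodFaceMap_prodι R h h']

/-! ### Integrality -/

section Domain

variable [IsDomain R]

instance isDomain_dualMonoid (σ : Finset ι) :
    IsDomain (AddMonoidAlgebra R (Φ.dualMonoid σ)) := by
  have h : Function.Injective (AddMonoidAlgebra.mapDomainRingHom R (Φ.dualMonoid σ).subtype) :=
    AddMonoidAlgebra.mapDomain_injective Subtype.val_injective
  exact h.isDomain _

instance isDomain_prodRing (σ τ : Finset ι) : IsDomain (Φ.ProdRing R σ τ) := by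
  have h : Function.Injective (AddMonoidAlgebra.mapDomainRingHom R
      ((Φ.dualMonoid σ).subtype.prodMap (Φ.dualMonoid τ).subtype)) :=
    AddMonoidAlgebra.mapDomain_injective (Subtype.val_injective.prodMap Subtype.val_injective)
  exact h.isDomain _

end Domain

end

end SimplicialFan

/-- A scheme covered by integral affine schemes, one of which is dense in the others, is integral. -/
theorem AlgebraicGeometry.isIntegral_of_charts {X : Scheme.{u}} {ι : Type*} (B : ι → CommRingCat.{u})
    [∀ i, IsDomain (B i)] (c : ∀ i, Spec (B i) ⟶ X) [∀ i, IsOpenImmersion (c i)] (i₀ : ι)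
    (ρ : ∀ i, B i ⟶ B i₀) (hρ : ∀ i, Function.Injective (ρ i)) (h : ∀ i, Spec.map (ρ i) ≫ c i = c i₀)
    (hc : ∀ x, ∃ i, x ∈ (c i).opensRange) : IsIntegral X := by
  have hred : IsReduced X := by
    have : ∀ x : X, _root_.IsReduced (X.presheaf.stalk x) := by
      intro x
      obtain ⟨i, y, rfl⟩ := hc x
      exact isReduced_of_injective _
        (ConcreteCategory.bijective_of_isIso ((c i).stalkMap y)).injective
    exact isReduced_of_isReduced_stalk X
  obtain ⟨η, hη⟩ : ∃ η : ∀ i, Spec (B i), ∀ i, η i = (⊥ : PrimeSpectrum (B i)) :=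
    ⟨_, fun _ => rfl⟩
  -- The zero ideal pulls back to the zero ideal along an injective map, so all charts share one
  -- generic point, which is dense in X.
  have hmap : ∀ i, Spec.map (ρ i) (η i₀) = η i := by
    intro i
    rw [hη, hη]
    exact PrimeSpectrum.ext ((RingHom.ker_eq_comap_bot (ρ i).hom).symm.trans
      ((RingHom.injective_iff_ker_eq_bot _).mp (hρ i)))
  have hcl : closure {c i₀ (η i₀)} = Set.univ := by
    refine Set.eq_univ_of_forall fun x => ?_
    obtain ⟨i, y, rfl⟩ := hc x
    rw [← h i, Scheme.Hom.comp_apply, hmap, ← specializes_iff_mem_closure]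
    refine Specializes.map ?_ (c i).continuous
    rw [hη]
    exact (PrimeSpectrum.le_iff_specializes _ _).mp bot_le
  have hirr : IrreducibleSpace X := by
    have h₁ : IsIrreducible (closure {c i₀ (η i₀)}) := isIrreducible_singleton.closure
    rw [hcl] at h₁
    exact { isPreirreducible_univ := h₁.2, toNonempty := ⟨c i₀ (η i₀)⟩ }
  exact isIntegral_of_irreducibleSpace_of_isReduced X

/-! ## Existence of diagonal splittings -/

namespace SimplicialFan

noncomputable section

variable {ι : Type} [DecidableEq ι] {n : ℕ} (Φ : SimplicialFan ι n)

/-- A choice, for every class `c` in `M / q M`, of a representative `r` of `c` with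
`|⟨r, v⟩| < q` for all rays `v`, in the guise of the map `u ↦ (u + r(-u)) / q` on `M`. -/
structure Rounding (q : ℕ) where
  /-- The map `u ↦ (u + r(-u)) / q`. -/
  toFun : (Fin n → ℤ) → Fin n → ℤ
  map_nsmul_add : ∀ m u, toFun (q • m + u) = m + toFun u
  toFun_zero : toFun 0 = 0
  pos : 0 < q
  lt_ray : ∀ u i, -q < q * (toFun u ⬝ᵥ Φ.ray i) - u ⬝ᵥ Φ.ray i
  ray_lt : ∀ u i, q * (toFun u ⬝ᵥ Φ.ray i) - u ⬝ᵥ Φ.ray i < q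

variable {Φ}

namespace Rounding

variable {q : ℕ} (e : Φ.Rounding q)

/-- For a ray v, ⟨e(u), v⟩ > ⟨u, v⟩ / q - 1 ≥ -1, and the left side is an integer. -/
theorem mem_left {σ : Finset ι} (u : Φ.dualMonoid σ) : e.toFun u.1 ∈ Φ.dualMonoid σ := by
  intro i hi
  have h₁ := e.lt_ray u.1 i
  have h₂ := u.2 i hi
  by_contra! h
  nlinarith

/-- For a ray ρ, q ⟨w - e(u), ρ⟩ = ⟨v, ρ⟩ - (q ⟨e(u), ρ⟩ - ⟨u, ρ⟩) > -q, so the integer ⟨w - e(u),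
ρ⟩ is nonnegative. -/
theorem mem_right {τ : Finset ι} (u : Fin n → ℤ) (v : Φ.dualMonoid τ) (w : Fin n → ℤ)
    (h : u + v.1 = q • w) : w - e.toFun u ∈ Φ.dualMonoid τ := by
  intro i hi
  have h₁ := e.ray_lt u i
  have h₂ := v.2 i hi
  have h₃ := congrArg (· ⬝ᵥ Φ.ray i) h
  simp only [add_dotProduct, smul_dotProduct, ← Nat.cast_smul_eq_nsmul ℤ, smul_eq_mul] at h₃
  rw [sub_dotProduct]
  by_contra! h
  nlinarith

theorem nsmul_injective (e : Φ.Rounding q) {w w' : Fin n → ℤ} (h : q • w = q • w') : w = w' :=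
  nsmul_right_injective e.pos.ne' h

variable (R : Type u) [CommRing R]

open Classical in
/-- The splitting on `R[(σ^∨ × τ^∨) ∩ (M × M)]`. -/
def chartMap (σ τ : Finset ι) : Φ.ProdRing R σ τ →+ Φ.ProdRing R σ τ :=
  (Finsupp.liftAddHom fun m =>
    if h : ∃ w, m.1.1 + m.2.1 = q • w then
      AddMonoidAlgebra.singleAddHom (⟨e.toFun m.1.1, e.mem_left m.1⟩,
        ⟨h.choose - e.toFun m.1.1, e.mem_right _ m.2 _ h.choose_spec⟩)
    else 0).comp AddMonoidAlgebra.coeffAddEquiv.toAddMonoidHom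

variable {R} {σ τ : Finset ι}

theorem chartMap_single (m : Φ.dualMonoid σ × Φ.dualMonoid τ) (r : R) (w : Fin n → ℤ)
    (h : m.1.1 + m.2.1 = q • w) : e.chartMap R σ τ (AddMonoidAlgebra.single m r) =
      AddMonoidAlgebra.single (⟨e.toFun m.1.1, e.mem_left m.1⟩,
        ⟨w - e.toFun m.1.1, e.mem_right _ m.2 _ h⟩) r := by
  have h' : ∃ w, m.1.1 + m.2.1 = q • w := ⟨w, h⟩
  have hw : h'.choose = w := e.nsmul_injective (h'.choose_spec.symm.trans h)
  refine (Finsupp.liftAddHom_apply_single _ m r).trans ?_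
  rw [dif_pos h']
  simp only [hw]
  rfl

theorem chartMap_single_of_not (m : Φ.dualMonoid σ × Φ.dualMonoid τ) (r : R)
    (h : ¬ ∃ w, m.1.1 + m.2.1 = q • w) :
    e.chartMap R σ τ (AddMonoidAlgebra.single m r) = 0 := by
  refine (Finsupp.liftAddHom_apply_single _ m r).trans ?_
  rw [dif_neg h]
  rfl

theorem chartMap_one : e.chartMap R σ τ 1 = 1 := by
  rw [AddMonoidAlgebra.one_def, e.chartMap_single 0 1 0 (by simp)]
  congr 1
  ext1 <;> ext1 <;> simp [e.toFun_zero]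

theorem chartMap_smul (r s : Φ.ProdRing R σ τ) :
    e.chartMap R σ τ (Φ.prodFrobenius R q σ τ r * s) = r * e.chartMap R σ τ s := by
  induction r using AddMonoidAlgebra.induction_linear with
  | zero => simp
  | add r₁ r₂ h₁ h₂ => simp only [map_add, add_mul, h₁, h₂]
  | single m c =>
    induction s using AddMonoidAlgebra.induction_linear with
    | zero => simp
    | add r₁ r₂ h₁ h₂ => simp only [map_add, mul_add, h₁, h₂]
    | single u d =>
      rw [prodFrobenius_single, AddMonoidAlgebra.single_mul_single]
      by_cases h : ∃ w, u.1.1 + u.2.1 = q • w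
      · obtain ⟨w, hw⟩ := h
        rw [e.chartMap_single u d w hw, AddMonoidAlgebra.single_mul_single,
          e.chartMap_single _ _ (m.1.1 + m.2.1 + w) (by
            rw [smul_add, ← hw]
            simp
            abel)]
        congr 1
        ext1 <;> ext1 <;> simp [e.map_nsmul_add, -nsmul_eq_mul]
        abel
      · rw [e.chartMap_single_of_not _ _ h, mul_zero, e.chartMap_single_of_not]
        rintro ⟨w, hw⟩
        refine h ⟨w - m.1.1 - m.2.1, ?_⟩
        rw [smul_sub, smul_sub, ← hw]
        simp
        abel

/-- The formula for the new exponents does not mention the cones. -/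
theorem chartMap_faceMap {σ' τ' : Finset ι} (h : σ' ≤ σ) (h' : τ' ≤ τ) (s : Φ.ProdRing R σ τ) :
    Φ.prodFaceMap R h h' (e.chartMap R σ τ s) = e.chartMap R σ' τ' (Φ.prodFaceMap R h h' s) := by
  induction s using AddMonoidAlgebra.induction_linear with
  | zero => simp
  | add r₁ r₂ h₁ h₂ => simp only [map_add, h₁, h₂]
  | single u d =>
    rw [prodFaceMap_single]
    by_cases hu : ∃ w, u.1.1 + u.2.1 = q • w
    · obtain ⟨w, hw⟩ := hu
      rw [e.chartMap_single u d w hw, prodFaceMap_single,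
        e.chartMap_single (σ := σ') (τ := τ') _ d w hw]
      rfl
    · rw [e.chartMap_single_of_not _ _ hu,
        e.chartMap_single_of_not (σ := σ') (τ := τ') _ _ hu, map_zero]

theorem chartMap_diag (s : Φ.ProdRing R σ σ) (h : Φ.prodDiag R σ s = 0) :
    Φ.prodDiag R σ (e.chartMap R σ σ s) = 0 := by
  classical
  have hmem : ∀ (u : Φ.dualMonoid σ) (w : Fin n → ℤ), u.1 = q • w → w ∈ Φ.dualMonoid σ := by
    intro u w hw i hi
    have h₁ := u.2 i hi
    have h₂ := congrArg (· ⬝ᵥ Φ.ray i) hw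
    simp only [← Nat.cast_smul_eq_nsmul ℤ, smul_dotProduct, smul_eq_mul] at h₂
    have h₃ := e.pos
    by_contra! h
    nlinarith
  -- π is the standard splitting of U_σ: x^(qw) ↦ x^w, and the other monomials go to 0. Restriction
  -- to the diagonal intertwines the chart map with π, so its kernel is preserved.
  obtain ⟨π, hπ, hπ'⟩ : ∃ π : AddMonoidAlgebra R (Φ.dualMonoid σ) →+
      AddMonoidAlgebra R (Φ.dualMonoid σ),
      (∀ (u : Φ.dualMonoid σ) (r : R) (w : Fin n → ℤ) (hw : u.1 = q • w), π (AddMonoidAlgebra.single u r) =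
        AddMonoidAlgebra.single ⟨w, hmem u w hw⟩ r) ∧
      ∀ (u : Φ.dualMonoid σ) (r : R), (¬ ∃ w, u.1 = q • w) → π (AddMonoidAlgebra.single u r) = 0 := by
    refine ⟨(Finsupp.liftAddHom fun u => if h : ∃ w, u.1 = q • w then
      AddMonoidAlgebra.singleAddHom ⟨h.choose, hmem u _ h.choose_spec⟩
      else 0).comp AddMonoidAlgebra.coeffAddEquiv.toAddMonoidHom, ?_, ?_⟩
    · intro u r w hw
      have h' : ∃ w, u.1 = q • w := ⟨w, hw⟩
      have hw : h'.choose = w := e.nsmul_injective (h'.choose_spec.symm.trans hw)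
      refine (Finsupp.liftAddHom_apply_single _ u r).trans ?_
      rw [dif_pos h']
      simp only [hw]
      rfl
    · intro u r h
      refine (Finsupp.liftAddHom_apply_single _ u r).trans ?_
      rw [dif_neg h]
      rfl
  have key : ∀ s, Φ.prodDiag R σ (e.chartMap R σ σ s) = π (Φ.prodDiag R σ s) := by
    intro s
    induction s using AddMonoidAlgebra.induction_linear with
    | zero => simp
    | add r₁ r₂ h₁ h₂ => simp only [map_add, h₁, h₂]
    | single u d =>
      rw [prodDiag_single]
      by_cases hu : ∃ w, u.1.1 + u.2.1 = q • w
      · obtain ⟨w, hw⟩ := hu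
        rw [e.chartMap_single u d w hw, prodDiag_single, hπ _ d w hw]
        congr 1
        ext1
        simp
      · rw [e.chartMap_single_of_not _ _ hu, hπ' _ _ hu, map_zero]
  rw [key, h, map_zero]

end Rounding

end

end SimplicialFan

/-! ### From a rounding to a splitting of the square. -/

namespace SimplicialFan

noncomputable section

variable {ι : Type} [DecidableEq ι] {n : ℕ} (Φ : SimplicialFan ι n)

variable {Φ} in
/-- The cone `{0}`. -/
def zeroCone (h₀ : ∅ ∈ Φ.cones) : Φ.Cone := ⟨∅, h₀⟩

variable {Φ} in
theorem zeroCone_le (h₀ : ∅ ∈ Φ.cones) (σ : Φ.Cone) : zeroCone h₀ ≤ σ :=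
  Finset.empty_subset _

variable (R : Type u) [CommRing R]

theorem isIntegral_toricScheme [IsDomain R] (h₀ : ∅ ∈ Φ.cones) : IsIntegral (Φ.toricScheme R) := by
  refine isIntegral_of_charts
    (fun σ : Φ.Cone => CommRingCat.of (AddMonoidAlgebra R (Φ.dualMonoid σ.1)))
    (Φ.coneι R) (zeroCone h₀) (fun σ => CommRingCat.ofHom (Φ.faceMap R (zeroCone_le h₀ σ)))
    (fun σ => Φ.faceMap_injective R (zeroCone_le h₀ σ)) (fun σ => Φ.faceMap_coneι R (zeroCone_le h₀ σ)) fun x => ?_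
  obtain ⟨σ, y, hy⟩ := Φ.exists_coneι_eq R x
  exact ⟨σ, y, hy⟩

theorem isIntegral_square [IsDomain R] (h₀ : ∅ ∈ Φ.cones) :
    IsIntegral (pullback (Φ.toSpec R) (Φ.toSpec R)) := by
  refine isIntegral_of_charts
    (fun σ : Φ.Cone × Φ.Cone => CommRingCat.of (Φ.ProdRing R σ.1.1 σ.2.1))
    (fun σ => Φ.prodι R σ.1 σ.2) (zeroCone h₀, zeroCone h₀)
    (fun σ => CommRingCat.ofHom
      (Φ.prodFaceMap R (zeroCone_le h₀ σ.1) (zeroCone_le h₀ σ.2)))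
    (fun σ => Φ.prodFaceMap_injective (zeroCone_le h₀ σ.1) (zeroCone_le h₀ σ.2))
    (fun σ => Φ.prodFaceMap_prodι R (zeroCone_le h₀ σ.1) (zeroCone_le h₀ σ.2)) fun x => ?_
  obtain ⟨σ, τ, h⟩ := Φ.exists_mem_prodι R x
  exact ⟨(σ, τ), h⟩

/-- The functions on `U_σ × U_τ`. -/
def prodSections (σ τ : Φ.Cone) : Φ.ProdRing R σ.1 τ.1 ≃+*
    Γ(pullback (Φ.toSpec R) (Φ.toSpec R), (Φ.prodι R σ τ).opensRange) :=
  (chartSections (Φ.prodι R σ τ)).commRingCatIsoToRingEquiv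

variable {R}

theorem prodSections_res {σ τ σ' τ' : Φ.Cone} (h : σ' ≤ σ) (h' : τ' ≤ τ)
    (s : Φ.ProdRing R σ.1 τ.1) :
    (pullback (Φ.toSpec R) (Φ.toSpec R)).presheaf.map
        (homOfLE (Φ.opensRange_prodι_mono R h h')).op (Φ.prodSections R σ τ s) =
      Φ.prodSections R σ' τ' (Φ.prodFaceMap R h h' s) := by
  have := chartSections_naturality (Φ.prodι R σ τ) (Φ.prodι R σ' τ') (𝟙 _)
    (CommRingCat.ofHom (Φ.prodFaceMap R h h'))
    (by rw [Category.comp_id, Φ.prodFaceMap_prodι R h h']) (Φ.opensRange_prodι_mono R h h')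
  have h₁ : (𝟙 (pullback (Φ.toSpec R) (Φ.toSpec R)) : _).appLE (Φ.prodι R σ τ).opensRange
      (Φ.prodι R σ' τ').opensRange (Φ.opensRange_prodι_mono R h h') =
      (pullback (Φ.toSpec R) (Φ.toSpec R)).presheaf.map
        (homOfLE (Φ.opensRange_prodι_mono R h h')).op := by
    simp only [Scheme.Hom.appLE, Scheme.Hom.id_app]
    exact Category.id_comp _
  rw [h₁] at this
  exact congrArg (fun f => f.hom s) this

theorem prodSections_frobenius (q : ℕ) (σ τ : Φ.Cone) (h) (s : Φ.ProdRing R σ.1 τ.1) :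
    (Φ.squareFrobenius R q).appLE (Φ.prodι R σ τ).opensRange (Φ.prodι R σ τ).opensRange h
      (Φ.prodSections R σ τ s) = Φ.prodSections R σ τ (Φ.prodFrobenius R q σ.1 τ.1 s) :=
  congrArg (fun f => f.hom s) (chartSections_naturality (Φ.prodι R σ τ) (Φ.prodι R σ τ)
    (Φ.squareFrobenius R q) _ (Φ.prodι_squareFrobenius R q σ τ) h)

theorem prodSections_diagonal (σ : Φ.Cone) (s : Φ.ProdRing R σ.1 σ.1) :
    (pullback.diagonal (Φ.toSpec R)).app (Φ.prodι R σ σ).opensRange (Φ.prodSections R σ σ s) = 0 ↔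
      Φ.prodDiag R σ.1 s = 0 := by
  have e := Φ.diagonal_preimage R σ
  have h := congrArg (fun f => f.hom s) (chartSections_naturality (Φ.prodι R σ σ) (Φ.coneι R σ)
    (pullback.diagonal (Φ.toSpec R)) _ (Φ.coneι_diagonal R σ) e.ge)
  have h₁ : (Φ.toricScheme R).presheaf.map (homOfLE e.ge).op
      ((pullback.diagonal (Φ.toSpec R)).app _ (Φ.prodSections R σ σ s)) =
      (chartSections (Φ.coneι R σ)).commRingCatIsoToRingEquiv (Φ.prodDiag R σ.1 s) := h
  have hi : Function.Injective ((Φ.toricScheme R).presheaf.map (homOfLE e.ge).op) := by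
    have : IsIso (homOfLE e.ge) := ⟨homOfLE e.le, Subsingleton.elim _ _, Subsingleton.elim _ _⟩
    exact (ConcreteCategory.bijective_of_isIso _).injective
  rw [← map_eq_zero_iff _ hi, h₁, RingEquiv.map_eq_zero_iff]

variable {Φ} (R)

namespace Rounding

variable {q : ℕ} (e : Φ.Rounding q)

/-- The splitting on `U_σ × U_τ`. -/
def chartSplitting (σ τ : Φ.Cone) :
    ChartSplitting (Φ.squareFrobenius R q) (Φ.prodι R σ τ).opensRange where
  le := (Φ.squareFrobenius_preimage R e.pos σ τ).ge
  toFun := (Φ.prodSections R σ τ).toAddMonoidHom.comp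
    ((e.chartMap R σ.1 τ.1).comp (Φ.prodSections R σ τ).symm.toAddMonoidHom)
  map_smul r s := by
    obtain ⟨r, rfl⟩ := (Φ.prodSections R σ τ).surjective r
    obtain ⟨s, rfl⟩ := (Φ.prodSections R σ τ).surjective s
    rw [prodSections_frobenius, ← map_mul]
    change Φ.prodSections R σ τ (e.chartMap R σ.1 τ.1 ((Φ.prodSections R σ τ).symm _)) =
      _ * Φ.prodSections R σ τ (e.chartMap R σ.1 τ.1 ((Φ.prodSections R σ τ).symm _))
    rw [RingEquiv.symm_apply_apply, RingEquiv.symm_apply_apply, chartMap_smul, map_mul]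
  map_one := by
    change Φ.prodSections R σ τ (e.chartMap R σ.1 τ.1 ((Φ.prodSections R σ τ).symm _)) = _
    rw [map_one, chartMap_one, map_one]

theorem chartSplitting_apply (σ τ : Φ.Cone) (s : Φ.ProdRing R σ.1 τ.1) :
    (e.chartSplitting R σ τ).toFun (Φ.prodSections R σ τ s) =
      Φ.prodSections R σ τ (e.chartMap R σ.1 τ.1 s) := by
  change Φ.prodSections R σ τ (e.chartMap R σ.1 τ.1 ((Φ.prodSections R σ τ).symm _)) = _
  rw [RingEquiv.symm_apply_apply]

/-- The splittings on the charts `U_σ × U_τ`. -/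
def splittingCover (h₀ : ∅ ∈ Φ.cones) [Nontrivial R] :
    SplittingCover (Φ.squareFrobenius R q) (Φ.Cone × Φ.Cone) where
  V σ := (Φ.prodι R σ.1 σ.2).opensRange
  isAffineOpen σ := isAffineOpen_opensRange _
  covers x := by
    obtain ⟨σ, τ, h⟩ := Φ.exists_mem_prodι R x
    exact ⟨(σ, τ), h⟩
  i₀ := (zeroCone h₀, zeroCone h₀)
  nonempty := ⟨_, ⟨Classical.choice (inferInstanceAs (Nonempty (PrimeSpectrum (Φ.ProdRing R ∅ ∅)))),
    rfl⟩⟩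
  le σ := Φ.opensRange_prodι_mono R (zeroCone_le h₀ σ.1) (zeroCone_le h₀ σ.2)
  π σ := e.chartSplitting R σ.1 σ.2
  res σ s := by
    obtain ⟨s, rfl⟩ := (Φ.prodSections R σ.1 σ.2).surjective s
    have h₁ := zeroCone_le h₀ σ.1
    have h₂ := zeroCone_le h₀ σ.2
    rw [chartSplitting_apply, prodSections_res _ h₁ h₂, prodSections_res _ h₁ h₂]
    refine Eq.trans ?_ (e.chartSplitting_apply R (zeroCone h₀) (zeroCone h₀) _).symm
    rw [chartMap_faceMap]

/-- A rounding gives a diagonal splitting. -/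
theorem isDiagonallySplit (e : Φ.Rounding q) (h₀ : ∅ ∈ Φ.cones) [IsDomain R] :
    Φ.IsDiagonallySplit R q := by
  have := Φ.isIntegral_square R h₀
  refine ⟨(e.splittingCover R h₀).splitting,
    (e.splittingCover R h₀).splitting_isCompatible _ (Set.range fun σ => (σ, σ)) ?_ ?_ ?_⟩
  · intro x
    obtain ⟨σ, y, hy⟩ := Φ.exists_coneι_eq R x
    refine ⟨(σ, σ), ⟨σ, rfl⟩, ?_⟩
    have : x ∈ pullback.diagonal (Φ.toSpec R) ⁻¹ᵁ (Φ.prodι R σ σ).opensRange := by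
      rw [diagonal_preimage]
      exact ⟨y, hy⟩
    exact this
  · rintro _ ⟨σ, rfl⟩
    change IsAffineOpen (pullback.diagonal (Φ.toSpec R) ⁻¹ᵁ (Φ.prodι R σ σ).opensRange)
    rw [diagonal_preimage]
    exact isAffineOpen_opensRange _
  · rintro _ ⟨σ, rfl⟩ s
    change Γ(pullback (Φ.toSpec R) (Φ.toSpec R), (Φ.prodι R σ σ).opensRange) at s
    obtain ⟨s, rfl⟩ := (Φ.prodSections R σ σ).surjective s
    change (pullback.diagonal (Φ.toSpec R)).app (Φ.prodι R σ σ).opensRange _ = 0 →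
      (pullback.diagonal (Φ.toSpec R)).app (Φ.prodι R σ σ).opensRange
        ((e.chartSplitting R σ σ).toFun _) = 0
    rw [chartSplitting_apply, prodSections_diagonal, prodSections_diagonal]
    exact e.chartMap_diag s

end Rounding

end

end SimplicialFan

/-! ### Hirzebruch surfaces -/

theorem empty_mem_hirzebruchFan (a : ℕ) : ∅ ∈ (hirzebruchFan a).cones := by
  simp [hirzebruchFan]

theorem dotProduct_hirzebruchRay (a : ℕ) (u : Fin 2 → ℤ) :
    u ⬝ᵥ hirzebruchRay a 0 = u 0 ∧ u ⬝ᵥ hirzebruchRay a 1 = u 1 ∧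
      u ⬝ᵥ hirzebruchRay a 2 = a * u 1 - u 0 ∧ u ⬝ᵥ hirzebruchRay a 3 = -u 1 := by
  simp [hirzebruchRay, dotProduct]
  ring

/-- A rounding for the fan of a Hirzebruch surface, in coordinates. -/
def hirzebruchRounding (a q : ℕ) (hq : 0 < q) (f : ℤ → ℤ → ℤ) (g : ℤ → ℤ)
    (hf : ∀ m m' x y, f (q * m + x) (q * m' + y) = m + f x y)
    (hg : ∀ m y, g (q * m + y) = m + g y) (hf₀ : f 0 0 = 0) (hg₀ : g 0 = 0)
    (h₁ : ∀ x y, |q * f x y - x| < q) (h₂ : ∀ y, |q * g y - y| < q)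
    (h₃ : ∀ x y, |a * (q * g y - y) - (q * f x y - x)| < q) : (hirzebruchFan a).Rounding q :=
  have key : ∀ u i, |q * (![f (u 0) (u 1), g (u 1)] ⬝ᵥ (hirzebruchFan a).ray i) -
      u ⬝ᵥ (hirzebruchFan a).ray i| < q := by
    intro u i
    obtain ⟨e₀, e₁, e₂, e₃⟩ := dotProduct_hirzebruchRay a u
    obtain ⟨f₀, f₁, f₂, f₃⟩ := dotProduct_hirzebruchRay a ![f (u 0) (u 1), g (u 1)]
    simp only [Matrix.cons_val_zero, Matrix.cons_val_one] at f₀ f₁ f₂ f₃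
    change |q * (_ ⬝ᵥ hirzebruchRay a i) - _ ⬝ᵥ hirzebruchRay a i| < q
    fin_cases i
    · simp only [Fin.zero_eta]
      rw [e₀, f₀]
      exact h₁ _ _
    · simp only [Fin.mk_one]
      rw [e₁, f₁]
      exact h₂ _
    · simp only [Fin.reduceFinMk]
      rw [e₂, f₂]
      convert h₃ (u 0) (u 1) using 2
      ring
    · simp only [Fin.reduceFinMk]
      rw [e₃, f₃]
      convert h₂ (u 1) using 1
      rw [← abs_neg]
      congr 1
      ring
  { toFun := fun u => ![f (u 0) (u 1), g (u 1)]
    map_nsmul_add := by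
      intro m u
      funext i
      fin_cases i
      · simpa using hf _ _ _ _
      · simpa using hg _ _
    toFun_zero := by
      funext i
      fin_cases i
      · simpa using hf₀
      · simpa using hg₀
    pos := hq
    lt_ray := fun u i => (abs_lt.mp (key u i)).1
    ray_lt := fun u i => (abs_lt.mp (key u i)).2 }

/-- With both coordinates rounded down, the representatives have coordinates in (-q, 0], and for a ≤
1 the difference a y - x of two such numbers has absolute value less than q. -/
theorem isDiagonallySplit_hirzebruchFan_of_le_one (a : ℕ) (ha : a ≤ 1) (R : Type u) [CommRing R]
    [IsDomain R] (q : ℕ) (hq : 2 ≤ q) : (hirzebruchFan a).IsDiagonallySplit R q := by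
  have hq₀ : (0 : ℤ) < q := by omega
  have hd : ∀ x : ℤ, -q < q * (x / q) - x ∧ q * (x / q) - x ≤ 0 := fun x => by
    have := Int.emod_add_mul_ediv x q
    have := Int.emod_nonneg x hq₀.ne'
    have := Int.emod_lt_of_pos x hq₀
    omega
  refine (hirzebruchRounding a q (by omega) (fun x _ => x / q) (fun y => y / q) ?_ ?_ ?_ ?_ ?_ ?_
    ?_).isDiagonallySplit R (empty_mem_hirzebruchFan a)
  · intro m _ x _
    rw [add_comm, Int.add_mul_ediv_left _ _ hq₀.ne', add_comm]
  · intro m y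
    rw [add_comm, Int.add_mul_ediv_left _ _ hq₀.ne', add_comm]
  · simp
  · simp
  · intro x _
    have := hd x
    exact abs_lt.mpr (by omega)
  · intro y
    have := hd y
    exact abs_lt.mpr (by omega)
  · intro x y
    have := hd x
    have := hd y
    rw [abs_lt]
    interval_cases a <;> push_cast <;> constructor <;> linarith

theorem isDiagonallySplit_hirzebruchFan_two (R : Type u) [CommRing R] [IsDomain R] (q : ℕ)
    (hq' : Odd q) : (hirzebruchFan 2).IsDiagonallySplit R q := by
  obtain ⟨k, hk⟩ := hq'
  have hq₀ : (0 : ℤ) < q := by omega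
  have hd : ∀ x : ℤ, -q < q * (x / q) - x ∧ q * (x / q) - x ≤ 0 := fun x => by
    have := Int.emod_add_mul_ediv x q
    have := Int.emod_nonneg x hq₀.ne'
    have := Int.emod_lt_of_pos x hq₀
    omega
  -- With q = 2k + 1, g rounds y / q to the nearest integer, so the representative has second
  -- coordinate in [-k, k], and twice it lies in [-(q - 1), q - 1].
  obtain ⟨g, hg⟩ : ∃ g : ℤ → ℤ, ∀ y, g y = (y + k) / q := ⟨_, fun _ => rfl⟩
  have hg' : ∀ y, -k ≤ q * g y - y ∧ q * g y - y ≤ k := fun y => by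
    have := hd (y + k)
    rw [← hg] at this
    omega
  have hgm : ∀ m y, g (q * m + y) = m + g y := by
    intro m y
    rw [hg, hg, show q * m + y + k = y + k + q * m by ring, Int.add_mul_ediv_left _ _ hq₀.ne',
      add_comm]
  -- x is rounded down or up so that its remainder never has the sign opposite to that of y. Then 2y
  -- - x is a difference of two numbers of absolute value less than q that do not have opposite
  -- signs.
  obtain ⟨f, hf⟩ : ∃ f : ℤ → ℤ → ℤ, ∀ x y, f x y =
    if q * g y - y ≤ 0 then x / q else -(-x / q) := ⟨_, fun _ _ => rfl⟩
  have hfm : ∀ m m' x y, f (q * m + x) (q * m' + y) = m + f x y := by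
    intro m m' x y
    rw [hf, hf, hgm, show q * (m' + g y) - (q * m' + y) = q * g y - y by ring]
    split_ifs
    · rw [add_comm, Int.add_mul_ediv_left _ _ hq₀.ne', add_comm]
    · rw [show -(q * m + x) = -x + q * (-m) by ring, Int.add_mul_ediv_left _ _ hq₀.ne']
      ring
  have hq' : (q : ℤ) = 2 * k + 1 := by exact_mod_cast hk
  have hf₁ : ∀ x y, |q * f x y - x| < q ∧ |2 * (q * g y - y) - (q * f x y - x)| < q := by
    intro x y
    have h₁ := hg' y
    have h₂ := hd x
    have h₃ := hd (-x)
    rw [hf, abs_lt, abs_lt]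
    split_ifs
    · refine ⟨⟨?_, ?_⟩, ?_, ?_⟩ <;> linarith
    · rw [mul_neg]
      refine ⟨⟨?_, ?_⟩, ?_, ?_⟩ <;> linarith
  refine (hirzebruchRounding 2 q (by omega) f g hfm hgm ?_ ?_ (fun x y => (hf₁ x y).1) ?_
    fun x y => by exact_mod_cast (hf₁ x y).2).isDiagonallySplit R (empty_mem_hirzebruchFan 2)
  · rw [hf]
    simp
  · rw [hg, zero_add]
    exact Int.ediv_eq_zero_of_lt (by omega) (by omega)
  · intro y
    have := hg' y
    exact abs_lt.mpr (by omega)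

/-! ## Nonexistence of diagonal splittings -/

theorem AddMonoidAlgebra.exists_of_coeff_mapDomain_ne_zero {R M N : Type*} [Semiring R] {f : M → N}
    {x : AddMonoidAlgebra R M} {y : N} (h : (AddMonoidAlgebra.mapDomain f x).coeff y ≠ 0) :
    ∃ a, f a = y ∧ x.coeff a ≠ 0 := by
  classical
  rw [AddMonoidAlgebra.coeff_mapDomain] at h
  obtain ⟨a, ha, hay⟩ := Finset.mem_image.mp (Finsupp.mapDomain_support (Finsupp.mem_support_iff.mpr h))
  exact ⟨a, hay, Finsupp.mem_support_iff.mp ha⟩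

namespace SimplicialFan

noncomputable section

variable {ι : Type} [DecidableEq ι] {n : ℕ} (Φ : SimplicialFan ι n) (R : Type u) [CommRing R]

/-- A splitting of the square of a toric scheme, compatible with the diagonal, in terms of the
functions on the `U_σ × U_τ`. -/
structure DiagonalSplitting (q : ℕ) where
  /-- The splitting on `U_σ × U_τ`. -/
  toFun : ∀ σ τ : Φ.Cone, Φ.ProdRing R σ.1 τ.1 →+ Φ.ProdRing R σ.1 τ.1
  map_face : ∀ {σ τ σ' τ' : Φ.Cone} (h : σ' ≤ σ) (h' : τ' ≤ τ) (s : Φ.ProdRing R σ.1 τ.1),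
    toFun σ' τ' (Φ.prodFaceMap R h h' s) = Φ.prodFaceMap R h h' (toFun σ τ s)
  map_single_mul : ∀ {σ τ : Φ.Cone} (m : Φ.dualMonoid σ.1 × Φ.dualMonoid τ.1)
    (s : Φ.ProdRing R σ.1 τ.1), toFun σ τ (AddMonoidAlgebra.single (q • m) 1 * s) =
      AddMonoidAlgebra.single m 1 * toFun σ τ s
  toFun_one : ∀ σ τ : Φ.Cone, toFun σ τ 1 = 1
  diag : ∀ (σ : Φ.Cone) (s : Φ.ProdRing R σ.1 σ.1), Φ.prodDiag R σ.1 s = 0 →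
    Φ.prodDiag R σ.1 (toFun σ σ s) = 0

variable {Φ} in
theorem mem_dualMonoid_zeroCone (h₀ : ∅ ∈ Φ.cones) (u : Fin n → ℤ) :
    u ∈ Φ.dualMonoid (zeroCone h₀).1 :=
  fun _ h => absurd h (Finset.notMem_empty _)

variable {Φ R} in
/-- If the square of a toric scheme has a splitting compatible with the diagonal, then every class in
`M / q M` has a representative whose pairing with any primitive generator of a ray is less than `q`
in absolute value. -/
theorem DiagonalSplitting.exists_abs_lt [Nontrivial R] {q : ℕ} (D : Φ.DiagonalSplitting R q)
    (h₀ : ∅ ∈ Φ.cones) (u : Fin n → ℤ) : ∃ m : Fin n → ℤ, ∀ i, {i} ∈ Φ.cones →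
      (∃ m₀ : Fin n → ℤ, m₀ ⬝ᵥ Φ.ray i = 1) → |(u - q • m) ⬝ᵥ Φ.ray i| < q := by
  obtain ⟨χ, hχ⟩ : ∃ χ : (Fin n → ℤ) → (Fin n → ℤ) →
      Φ.dualMonoid (zeroCone h₀).1 × Φ.dualMonoid (zeroCone h₀).1,
      ∀ a b, χ a b = (⟨a, mem_dualMonoid_zeroCone h₀ a⟩, ⟨b, mem_dualMonoid_zeroCone h₀ b⟩) :=
    ⟨_, fun _ _ => rfl⟩
  have hadd : ∀ a b a' b', χ a b + χ a' b' = χ (a + a') (b + b') := by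
    intro a b a' b'
    rw [hχ, hχ, hχ]
    rfl
  -- Semilinearity for coefficients: translating the argument by q (c, d) translates the value by
  -- (c, d).
  have hshift : ∀ a b c d e f,
      (D.toFun (zeroCone h₀) (zeroCone h₀) (AddMonoidAlgebra.single (χ a b) 1)).coeff (χ e f) =
      (D.toFun (zeroCone h₀) (zeroCone h₀)
        (AddMonoidAlgebra.single (χ (q • c + a) (q • d + b)) 1)).coeff (χ (c + e) (d + f)) := by
    intro a b c d e f
    have hq : q • χ c d = χ (q • c) (q • d) := by
      rw [hχ, hχ]
      rfl
    rw [← hadd, ← hadd c d, ← hq, ← one_mul (1 : R), ← AddMonoidAlgebra.single_mul_single, one_mul,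
      D.map_single_mul, AddMonoidAlgebra.coeff_single_mul_add, one_mul]
  -- x^u ⊗ x^(-u) and 1 agree on the diagonal, so the image of the former restricts to 1 there and
  -- has a nonzero coefficient in some degree (m, -m).
  obtain ⟨m, hm⟩ : ∃ m, (D.toFun (zeroCone h₀) (zeroCone h₀)
      (AddMonoidAlgebra.single (χ u (-u)) 1)).coeff (χ m (-m)) ≠ 0 := by
    have h := D.diag (zeroCone h₀) (1 - AddMonoidAlgebra.single (χ u (-u)) 1) (by
      rw [map_sub, map_one, prodDiag_single, sub_eq_zero, AddMonoidAlgebra.one_def]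
      congr 1
      rw [hχ]
      ext1
      simp)
    rw [map_sub, D.toFun_one, map_sub, map_one, sub_eq_zero] at h
    have h₁ := congrArg (fun f => f.coeff 0) h
    simp only [AddMonoidAlgebra.one_def, AddMonoidAlgebra.coeff_single, Finsupp.single_eq_same] at h₁
    obtain ⟨a, ha, h₂⟩ := AddMonoidAlgebra.exists_of_coeff_mapDomain_ne_zero
      (h₁.symm.trans_ne one_ne_zero)
    refine ⟨a.1.1, ?_⟩
    convert h₂ using 2
    rw [hχ]
    have : a.1.1 + a.2.1 = 0 := congrArg Subtype.val ha
    ext1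
    · rfl
    · exact Subtype.ext (eq_neg_of_add_eq_zero_right this).symm
  -- The coefficient moves to the constant term, and u is replaced by v = u - q m.
  rw [hshift u (-u) (-m) m, neg_add_cancel, add_neg_cancel] at hm
  have huv : q • -m + u = u - q • m := by
    rw [smul_neg]
    abel
  refine ⟨m, fun i hi ⟨m₀, hm₀⟩ => ?_⟩
  have huv' : q • m + -u = -(u - q • m) := by abel
  rw [huv, huv'] at hm
  generalize u - q • m = v at hm
  obtain ⟨σ, hσ⟩ : ∃ σ : Φ.Cone, σ.1 = {i} := ⟨⟨_, hi⟩, rfl⟩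
  have hmem : ∀ {w : Fin n → ℤ}, w ∈ Φ.dualMonoid σ.1 ↔ 0 ≤ w ⬝ᵥ Φ.ray i := by
    intro w
    change (∀ j ∈ σ.1, _) ↔ _
    rw [hσ]
    simp
  have hdot : (q • m₀) ⬝ᵥ Φ.ray i = q := by
    rw [← Nat.cast_smul_eq_nsmul ℤ, smul_dotProduct, hm₀, smul_eq_mul, mul_one]
  have hneg : ¬ (0 ≤ (-m₀ + 0) ⬝ᵥ Φ.ray i) := by
    rw [add_zero, neg_dotProduct, hm₀]
    simp
  by_contra! hlt
  obtain hv | hv := le_abs.mp hlt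
  -- If ⟨v, v_i⟩ ≥ q, then x^(v - q m₀) ⊗ x^(-v) is regular on U_i × T, but its image contains
  -- x^(-m₀) ⊗ 1, and ⟨-m₀, v_i⟩ = -1.
  · rw [hshift v (-v) (-m₀) 0] at hm
    have hw : q • -m₀ + v ∈ Φ.dualMonoid σ.1 := by
      rw [hmem, add_dotProduct, smul_neg, neg_dotProduct, hdot]
      omega
    have h := D.map_face (zeroCone_le h₀ σ) le_rfl
      (AddMonoidAlgebra.single (⟨_, hw⟩, ⟨q • 0 + -v, mem_dualMonoid_zeroCone h₀ _⟩) 1)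
    rw [prodFaceMap_single] at h
    rw [hχ] at hm
    replace hm : (D.toFun (zeroCone h₀) (zeroCone h₀) _).coeff _ ≠ 0 := hm
    erw [h] at hm
    obtain ⟨a, ha, -⟩ := AddMonoidAlgebra.exists_of_coeff_mapDomain_ne_zero hm
    rw [hχ] at ha
    have := a.1.2
    rw [hmem, show a.1.1 = _ from congrArg (fun x => x.1.1) ha] at this
    exact hneg this
  -- If ⟨v, v_i⟩ ≤ -q, the same argument applies to the second factor.
  · rw [hshift v (-v) 0 (-m₀)] at hm
    have hw : q • -m₀ + -v ∈ Φ.dualMonoid σ.1 := by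
      rw [hmem, add_dotProduct, smul_neg, neg_dotProduct, neg_dotProduct, hdot]
      omega
    have h := D.map_face le_rfl (zeroCone_le h₀ σ)
      (AddMonoidAlgebra.single (⟨q • 0 + v, mem_dualMonoid_zeroCone h₀ _⟩, ⟨_, hw⟩) 1)
    rw [prodFaceMap_single] at h
    rw [hχ] at hm
    erw [h] at hm
    obtain ⟨a, ha, -⟩ := AddMonoidAlgebra.exists_of_coeff_mapDomain_ne_zero hm
    rw [hχ] at ha
    have := a.2.2
    rw [hmem, show a.2.1 = _ from congrArg (fun x => x.2.1) ha] at this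
    exact hneg this

variable {Φ R} in
/-- A diagonal splitting, in terms of the functions on the `U_σ × U_τ`. -/
def DiagonalSplitting.ofSchemeSplitting {q : ℕ} (hq : 0 < q)
    (π : SchemeSplitting (Φ.squareFrobenius R q))
    (hπ : π.IsCompatible (pullback.diagonal (Φ.toSpec R))) : Φ.DiagonalSplitting R q :=
  let P := pullback (Φ.toSpec R) (Φ.toSpec R)
  let V (σ τ : Φ.Cone) : P.Opens := (Φ.prodι R σ τ).opensRange
  have le (σ τ : Φ.Cone) : Φ.squareFrobenius R q ⁻¹ᵁ V σ τ ≤ V σ τ :=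
    (Φ.squareFrobenius_preimage R hq σ τ).le
  have ge (σ τ : Φ.Cone) : V σ τ ≤ Φ.squareFrobenius R q ⁻¹ᵁ V σ τ :=
    (Φ.squareFrobenius_preimage R hq σ τ).ge
  -- The splitting starts from functions on (F × F)⁻¹ V, which is V itself for a chart V.
  let f (σ τ : Φ.Cone) : Γ(P, V σ τ) →+ Γ(P, V σ τ) :=
    (π.toFun (V σ τ)).comp (P.presheaf.map (homOfLE (le σ τ)).op).hom.toAddMonoidHom
  have hf {σ τ : Φ.Cone} (s : Γ(P, V σ τ)) : f σ τ s =
    π.toFun (V σ τ) (P.presheaf.map (homOfLE (le σ τ)).op s) := rfl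
  have hsmul {σ τ : Φ.Cone} (r s : Γ(P, V σ τ)) :
      f σ τ ((Φ.squareFrobenius R q).appLE _ _ (ge σ τ) r * s) = r * f σ τ s := by
    rw [hf, hf, map_mul, ← π.map_smul]
    congr 2
    rw [← CommRingCat.comp_apply, Scheme.Hom.appLE_map, Scheme.Hom.appLE_eq_app]
  { toFun := fun σ τ => (Φ.prodSections R σ τ).symm.toAddMonoidHom.comp
      ((f σ τ).comp (Φ.prodSections R σ τ).toAddMonoidHom)
    map_face := by
      intro σ τ σ' τ' h h' s
      change (Φ.prodSections R σ' τ').symm (f σ' τ' (Φ.prodSections R σ' τ' _)) =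
        Φ.prodFaceMap R h h' ((Φ.prodSections R σ τ).symm (f σ τ (Φ.prodSections R σ τ s)))
      rw [RingEquiv.symm_apply_eq, ← prodSections_res, ← prodSections_res,
        RingEquiv.apply_symm_apply, hf, hf, ← π.restrict, Scheme.map_map, Scheme.map_map]
      rfl
    map_single_mul := by
      intro σ τ m s
      change (Φ.prodSections R σ τ).symm (f σ τ (Φ.prodSections R σ τ _)) =
        _ * (Φ.prodSections R σ τ).symm (f σ τ (Φ.prodSections R σ τ s))
      rw [RingEquiv.symm_apply_eq, map_mul (Φ.prodSections R σ τ),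
        map_mul (Φ.prodSections R σ τ), RingEquiv.apply_symm_apply, ← hsmul,
        prodSections_frobenius, prodFrobenius_single]
    toFun_one := by
      intro σ τ
      change (Φ.prodSections R σ τ).symm (f σ τ (Φ.prodSections R σ τ _)) = _
      rw [RingEquiv.symm_apply_eq, map_one (Φ.prodSections R σ τ), hf, map_one,
        ← map_one ((Φ.squareFrobenius R q).app (V σ τ)).hom]
      exact π.comp_comorphism _ _
    diag := by
      intro σ s hs
      change Φ.prodDiag R σ.1 ((Φ.prodSections R σ σ).symm (f σ σ (Φ.prodSections R σ σ s))) = 0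
      rw [← prodSections_diagonal, RingEquiv.apply_symm_apply, hf]
      apply hπ
      rw [Scheme.app_map, (Φ.prodSections_diagonal σ s).mpr hs, map_zero] }

variable {Φ R} in
/-- A diagonal Frobenius splitting, in terms of the functions on the `U_σ × U_τ`. -/
def DiagonalSplitting.ofFrobeniusSplitting {p : ℕ}
    (π : FrobeniusSplitting p (pullback (Φ.toSpec R) (Φ.toSpec R)))
    (hπ : π.IsCompatible (pullback.diagonal (Φ.toSpec R))) : Φ.DiagonalSplitting R p where
  toFun σ τ := (Φ.prodSections R σ τ).symm.toAddMonoidHom.comp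
    ((π.toFun (Φ.prodι R σ τ).opensRange).comp (Φ.prodSections R σ τ).toAddMonoidHom)
  map_face {σ τ σ' τ'} h h' s := by
    change (Φ.prodSections R σ' τ').symm (π.toFun _ (Φ.prodSections R σ' τ' _)) =
      Φ.prodFaceMap R h h' ((Φ.prodSections R σ τ).symm (π.toFun _ (Φ.prodSections R σ τ s)))
    rw [RingEquiv.symm_apply_eq, ← prodSections_res, ← prodSections_res,
      RingEquiv.apply_symm_apply, ← π.restrict]
  -- x^(p m) = (x^m)^p, so the absolute Frobenius and the toric endomorphism agree on monomials with
  -- coefficient 1.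
  map_single_mul {σ τ} m s := by
    change (Φ.prodSections R σ τ).symm (π.toFun _ (Φ.prodSections R σ τ _)) =
      _ * (Φ.prodSections R σ τ).symm (π.toFun _ (Φ.prodSections R σ τ s))
    rw [RingEquiv.symm_apply_eq, map_mul (Φ.prodSections R σ τ),
        map_mul (Φ.prodSections R σ τ), RingEquiv.apply_symm_apply, ← π.map_smul,
      ← map_pow, AddMonoidAlgebra.single_pow, one_pow]
  toFun_one σ τ := by
    change (Φ.prodSections R σ τ).symm (π.toFun _ (Φ.prodSections R σ τ _)) = _
    rw [RingEquiv.symm_apply_eq, map_one (Φ.prodSections R σ τ), ← one_pow p]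
    refine (π.comp_comorphism _ _).trans (one_pow p).symm
  diag σ s hs := by
    change Φ.prodDiag R σ.1 ((Φ.prodSections R σ σ).symm (π.toFun _ (Φ.prodSections R σ σ s))) = 0
    rw [← prodSections_diagonal, RingEquiv.apply_symm_apply]
    exact hπ _ _ ((Φ.prodSections_diagonal σ s).mpr hs)

end

end SimplicialFan

/-! ### The Hirzebruch surfaces with a > 2. -/

theorem isEmpty_diagonalSplitting_hirzebruchFan {a : ℕ} (ha : 2 < a) (R : Type u) [CommRing R]
    [Nontrivial R] {q : ℕ} (hq : 2 ≤ q) : IsEmpty ((hirzebruchFan a).DiagonalSplitting R q) := by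
  constructor
  intro D
  -- j is q / 3 rounded up, and 3 j ≤ q + 2 ≤ 2 q because q ≥ 2. Every integer congruent to j modulo
  -- q then has absolute value at least q / 3.
  obtain ⟨j, hj₁, hj₂⟩ : ∃ j : ℕ, q ≤ 3 * j ∧ 3 * j ≤ 2 * q := ⟨(q + 2) / 3, by omega, by omega⟩
  obtain ⟨m, hm⟩ := D.exists_abs_lt (empty_mem_hirzebruchFan a) ![0, j]
  have hc : ∀ i, {i} ∈ (hirzebruchFan a).cones := by
    intro i
    fin_cases i <;> simp [hirzebruchFan]
  obtain ⟨e₀, e₁, e₂, -⟩ := dotProduct_hirzebruchRay a (![0, (j : ℤ)] - q • m)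
  have h₀ := hm 0 (hc 0) ⟨![1, 0], by simp [hirzebruchFan, hirzebruchRay, dotProduct]⟩
  have h₁ := hm 1 (hc 1) ⟨![0, 1], by simp [hirzebruchFan, hirzebruchRay, dotProduct]⟩
  have h₂ := hm 2 (hc 2) ⟨![-1, 0], by simp [hirzebruchFan, hirzebruchRay, dotProduct]⟩
  have h₀ : |(![0, (j : ℤ)] - q • m) ⬝ᵥ hirzebruchRay a 0| < q := h₀
  have h₁ : |(![0, (j : ℤ)] - q • m) ⬝ᵥ hirzebruchRay a 1| < q := h₁
  have h₂ : |(![0, (j : ℤ)] - q • m) ⬝ᵥ hirzebruchRay a 2| < q := h₂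
  rw [e₀] at h₀
  rw [e₁] at h₁
  rw [e₂] at h₂
  have hsm : ∀ i, (q • m) i = q * m i := fun i => by simp
  simp only [Pi.sub_apply, Matrix.cons_val_zero, Matrix.cons_val_one, hsm, zero_sub, abs_neg,
    abs_mul (q : ℤ) (m 0), Nat.abs_cast] at h₀ h₁ h₂
  -- The first coordinate of the representative is a multiple of q smaller than q in absolute value,
  -- so |a y - x| is just a |y| ≥ 3 (q / 3).
  have hm₀ : m 0 = 0 := by
    rw [← Int.abs_lt_one_iff]
    nlinarith
  rw [hm₀, mul_zero, neg_zero, sub_zero, abs_mul, Nat.abs_cast] at h₂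
  have h₃ : (q : ℤ) ≤ 3 * |j - q * m 1| := by
    obtain h | h := le_or_gt (m 1) 0
    · have : (q : ℤ) * m 1 ≤ 0 := by nlinarith
      have := le_abs_self (j - q * m 1)
      linarith [(by exact_mod_cast hj₁ : (q : ℤ) ≤ 3 * j)]
    · have : (q : ℤ) ≤ q * m 1 := by nlinarith
      have := neg_le_abs (j - q * m 1)
      linarith [(by exact_mod_cast hj₂ : 3 * (j : ℤ) ≤ 2 * q)]
  have h₄ : (3 : ℤ) ≤ a := by exact_mod_cast ha
  nlinarith [abs_nonneg (j - q * m 1)]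

theorem not_isDiagonallySplit_hirzebruchFan {a : ℕ} (ha : 2 < a) (R : Type u) [CommRing R]
    [Nontrivial R] {q : ℕ} (hq : 2 ≤ q) : ¬ (hirzebruchFan a).IsDiagonallySplit R q := by
  rintro ⟨π, hπ⟩
  exact (isEmpty_diagonalSplitting_hirzebruchFan ha R hq).false
    (SimplicialFan.DiagonalSplitting.ofSchemeSplitting (by omega) π hπ)

theorem not_isDiagonallyFrobeniusSplit_hirzebruchFan {a : ℕ} (ha : 2 < a) (R : Type u) [CommRing R]
    [Nontrivial R] {p : ℕ} (hp : 2 ≤ p) :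
    ¬ IsDiagonallyFrobeniusSplit p ((hirzebruchFan a).toSpec R) := by
  rintro ⟨π, hπ⟩
  exact (isEmpty_diagonalSplitting_hirzebruchFan ha R hp).false
    (SimplicialFan.DiagonalSplitting.ofFrobeniusSplitting π hπ)

/-! ## Isomorphism invariance -/

noncomputable section

namespace FrobeniusSplitting

variable {p : ℕ} {P Q : Scheme.{u}} (e : P ⟶ Q) [IsIso e]

/-- The comorphism of an isomorphism. -/
def appEquiv (U : Q.Opens) : Γ(Q, U) ≃+* Γ(P, e ⁻¹ᵁ U) :=
  (asIso (e.app U)).commRingCatIsoToRingEquiv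

theorem appEquiv_apply (U : Q.Opens) (s : Γ(Q, U)) : appEquiv e U s = e.app U s := rfl

/-- The transport of a Frobenius splitting along an isomorphism. -/
def ofIso (π : FrobeniusSplitting p P) : FrobeniusSplitting p Q where
  toFun U := (appEquiv e U).symm.toAddMonoidHom.comp
    ((π.toFun (e ⁻¹ᵁ U)).comp (appEquiv e U).toAddMonoidHom)
  restrict U V i s := by
    change (appEquiv e V).symm (π.toFun _ (appEquiv e V _)) =
      Q.presheaf.map i.op ((appEquiv e U).symm (π.toFun _ (appEquiv e U s)))
    rw [RingEquiv.symm_apply_eq, appEquiv_apply, appEquiv_apply, Scheme.app_map, Scheme.app_map,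
      π.restrict, ← appEquiv_apply e U ((appEquiv e U).symm _), RingEquiv.apply_symm_apply]
    rfl
  map_smul U r s := by
    change (appEquiv e U).symm (π.toFun _ (appEquiv e U _)) =
      r * (appEquiv e U).symm (π.toFun _ (appEquiv e U s))
    rw [RingEquiv.symm_apply_eq, map_mul (appEquiv e U), map_mul (appEquiv e U), map_pow,
      π.map_smul, RingEquiv.apply_symm_apply]
  comp_comorphism U r := by
    change (appEquiv e U).symm (π.toFun _ (appEquiv e U _)) = r
    rw [RingEquiv.symm_apply_eq, map_pow, π.comp_comorphism]

theorem IsCompatible.ofIso {X Y : Scheme.{u}} {π : FrobeniusSplitting p P} {i : X ⟶ P}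
    (h : π.IsCompatible i) (j : Y ⟶ Q) (f : X ⟶ Y) [IsIso f] (hf : i ≫ e = f ≫ j) :
    (π.ofIso e).IsCompatible j := by
  intro U s hs
  have key : ∀ t : Γ(Q, U), i.app (e ⁻¹ᵁ U) (e.app U t) = 0 ↔ j.app U t = 0 := by
    intro t
    have h₁ : (i ≫ e).app U t = 0 ↔ (f ≫ j).app U t = 0 := by rw [hf]
    have h₂ : (f ≫ j).app U t = f.app (j ⁻¹ᵁ U) (j.app U t) :=
      congrArg (fun φ => φ.hom t) (f.comp_app j U)
    have h₃ : (i ≫ e).app U t = i.app (e ⁻¹ᵁ U) (e.app U t) :=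
      congrArg (fun φ => φ.hom t) (i.comp_app e U)
    rw [h₂, h₃] at h₁
    refine h₁.trans (map_eq_zero_iff _ ?_)
    exact (ConcreteCategory.bijective_of_isIso (f.app (j ⁻¹ᵁ U))).injective
  rw [← key, ← appEquiv_apply e]
  change i.app _ (appEquiv e U ((appEquiv e U).symm (π.toFun _ (appEquiv e U s)))) = 0
  rw [RingEquiv.apply_symm_apply]
  exact h _ _ ((key s).mpr hs)

end FrobeniusSplitting

theorem IsDiagonallyFrobeniusSplit.of_iso {p : ℕ} {X Y S : Scheme.{u}} {f : X ⟶ S} {g : Y ⟶ S}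
    (h : IsDiagonallyFrobeniusSplit p f) (e : Over.mk f ≅ Over.mk g) :
    IsDiagonallyFrobeniusSplit p g := by
  obtain ⟨π, hπ⟩ := h
  have hw : e.hom.left ≫ g = f := Over.w e.hom
  have : IsIso e.hom.left := inferInstanceAs (IsIso ((Over.forget S).map e.hom))
  have hw' : f ≫ 𝟙 S = e.hom.left ≫ g := by rw [hw, Category.comp_id]
  refine ⟨π.ofIso (pullback.map f f g g e.hom.left e.hom.left (𝟙 S) hw' hw'),
    hπ.ofIso _ _ e.hom.left ?_⟩
  apply pullback.hom_ext
  · rw [Category.assoc, Category.assoc, pullback.diagonal_fst]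
    refine (congrArg (pullback.diagonal f ≫ ·) (pullback.lift_fst _ _ _)).trans ?_
    simp
  · rw [Category.assoc, Category.assoc, pullback.diagonal_snd]
    refine (congrArg (pullback.diagonal f ≫ ·) (pullback.lift_snd _ _ _)).trans ?_
    simp

end

/-! ## Morphisms from affine schemes to `Proj` -/

namespace AlgebraicGeometry.Proj

noncomputable section

open HomogeneousLocalization

variable {ς : Type*} {S : Type u} [CommRing S] [SetLike ς S] [AddSubgroupClass ς S] (𝒜 : ℕ → ς)
  [GradedRing 𝒜] {A B : Type u} [CommRing A] [CommRing B]

/-- The map `S_(t) → A` induced by a homomorphism `f : S → A` with `f t` invertible. -/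
def awayDesc (f : S →+* A) (t : S) (hu : IsUnit (f t)) : Away 𝒜 t →+* A :=
  (IsLocalization.lift (M := Submonoid.powers t) (S := Localization.Away t) (g := f) (by
    rintro ⟨_, n, rfl⟩
    rw [map_pow]
    exact hu.pow n)).comp (algebraMap (Away 𝒜 t) (Localization.Away t))

/-- The defining property a / t^n ↦ f(a) / f(t)^n, with the denominator cleared. -/
theorem awayDesc_mk (f : S →+* A) {t : S} (hu : IsUnit (f t)) {d : ℕ} (ht : t ∈ 𝒜 d) (n : ℕ) (a : S)
    (ha : a ∈ 𝒜 (n • d)) : awayDesc 𝒜 f t hu (Away.mk 𝒜 ht n a ha) * f t ^ n = f a := by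
  rw [awayDesc, RingHom.comp_apply, HomogeneousLocalization.algebraMap_apply, Away.val_mk,
    Localization.mk_eq_mk', mul_comm, ← map_pow]
  have hg : ∀ y : Submonoid.powers t, IsUnit (f y) := by
    rintro ⟨_, n, rfl⟩
    rw [map_pow]
    exact hu.pow n
  exact ((IsLocalization.lift_mk'_spec (S := Localization.Away t) (hg := hg) a _
    ⟨t ^ n, n, rfl⟩).mp rfl).symm

variable {𝒜} in
theorem away_hom_ext {t : S} {d : ℕ} (ht : t ∈ 𝒜 d) {f g : Away 𝒜 t →+* A} (c : A) (hc : IsUnit c)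
    (h : ∀ n a ha, f (Away.mk 𝒜 ht n a ha) * c ^ n = g (Away.mk 𝒜 ht n a ha) * c ^ n) : f = g := by
  ext x
  obtain ⟨n, a, ha, rfl⟩ := Away.mk_surjective 𝒜 ht x
  exact (hc.pow n).mul_left_injective (h n a ha)

variable {d : ℕ} {t : S} (ht : t ∈ 𝒜 d) (hd : 0 < d)

/-- The morphism `Spec A ⟶ Proj S` induced by a homomorphism `f : S → A` with `f t` invertible for
some homogeneous `t`. -/
def ofUnit (f : S →+* A) (hu : IsUnit (f t)) : Spec (CommRingCat.of A) ⟶ Proj 𝒜 :=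
  Spec.map (CommRingCat.ofHom (awayDesc 𝒜 f t hu)) ≫ awayι 𝒜 t ht hd

theorem ofUnit_eq_mul (f : S →+* A) (hu : IsUnit (f t)) {e : ℕ} {g : S} (hg : g ∈ 𝒜 e)
    (hu' : IsUnit (f (t * g))) : ofUnit 𝒜 (SetLike.mul_mem_graded ht hg) (by omega) f hu' =
      ofUnit 𝒜 ht hd f hu := by
  rw [ofUnit, ofUnit, ← SpecMap_awayMap_awayι 𝒜 ht hd hg rfl, ← Category.assoc, ← Spec.map_comp,
    ← CommRingCat.ofHom_comp]
  congr 3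
  refine away_hom_ext ht (f (t * g)) hu' fun n a ha => ?_
  rw [RingHom.comp_apply, awayMap_mk, awayDesc_mk 𝒜 f hu', map_mul, map_mul, map_pow, mul_pow,
    ← mul_assoc, awayDesc_mk]

/-- Both morphisms are compared with the one that factors through D₊(t g). -/
theorem ofUnit_eq (f : S →+* A) (hu : IsUnit (f t)) {e : ℕ} {g : S} (hg : g ∈ 𝒜 e) (he : 0 < e)
    (hu' : IsUnit (f g)) : ofUnit 𝒜 ht hd f hu = ofUnit 𝒜 hg he f hu' := by
  have h : IsUnit (f (t * g)) := by
    rw [map_mul]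
    exact hu.mul hu'
  have h' : IsUnit (f (g * t)) := by
    rwa [mul_comm]
  rw [← ofUnit_eq_mul 𝒜 ht hd f hu hg h, ← ofUnit_eq_mul 𝒜 hg he f hu' ht h']
  congr 1 <;> ring

theorem map_ofUnit (f : S →+* A) (hu : IsUnit (f t)) (φ : A →+* B) :
    Spec.map (CommRingCat.ofHom φ) ≫ ofUnit 𝒜 ht hd f hu =
      ofUnit 𝒜 ht hd (φ.comp f) (hu.map φ) := by
  rw [ofUnit, ofUnit, ← Category.assoc, ← Spec.map_comp, ← CommRingCat.ofHom_comp]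
  congr 3
  refine away_hom_ext ht _ (hu.map φ) fun n a ha => ?_
  rw [RingHom.comp_apply, ← map_pow, ← map_mul, awayDesc_mk, map_pow]
  exact (awayDesc_mk 𝒜 (φ.comp f) (hu.map φ) ht n a ha).symm

/-- Homogeneous coordinates matter only up to a common factor: the powers of c cancel in fractions
of degree zero. -/
theorem ofUnit_eq_of_smul (f g : S →+* A) (c : A)
    (h : ∀ n, ∀ a ∈ 𝒜 n, g a = c ^ n * f a) (hu : IsUnit (f t)) (hu' : IsUnit (g t)) :
    ofUnit 𝒜 ht hd g hu' = ofUnit 𝒜 ht hd f hu := by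
  rw [ofUnit, ofUnit]
  congr 3
  refine away_hom_ext ht _ hu' fun n a ha => ?_
  rw [awayDesc_mk, h _ _ ha, h _ _ ht, mul_pow, mul_left_comm, awayDesc_mk, ← pow_mul, smul_eq_mul,
    mul_comm d n]

theorem ofUnit_preimage_basicOpen (f : S →+* A) (hu : IsUnit (f t)) {e : ℕ} {g : S} (hg : g ∈ 𝒜 e)
    (he : 0 < e) : ofUnit 𝒜 ht hd f hu ⁻¹ᵁ basicOpen 𝒜 g = PrimeSpectrum.basicOpen (f g) := by
  change Spec.map (CommRingCat.ofHom (awayDesc 𝒜 f t hu)) ⁻¹ᵁ (awayι 𝒜 t ht hd ⁻¹ᵁ basicOpen 𝒜 g) = _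
  rw [awayι_preimage_basicOpen 𝒜 ht hd hg he]
  change PrimeSpectrum.basicOpen (awayDesc 𝒜 f t hu (Away.isLocalizationElem ht hg)) = _
  have h := awayDesc_mk 𝒜 f hu ht e (g ^ d) (by
    convert SetLike.pow_mem_graded d hg using 2
    exact mul_comm _ _)
  obtain ⟨v, hv⟩ := hu.pow e
  have h' := congrArg PrimeSpectrum.basicOpen h
  have hv' : PrimeSpectrum.basicOpen (v : A) = ⊤ :=
    Opens.ext (Set.eq_univ_of_forall fun x hx =>
      x.2.ne_top (Ideal.eq_top_of_isUnit_mem _ hx v.isUnit))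
  rw [← hv, PrimeSpectrum.basicOpen_mul, hv', inf_top_eq,
    map_pow, PrimeSpectrum.basicOpen_pow _ _ hd] at h'
  exact h'

theorem ofUnit_toSpecZero (f : S →+* A) (hu : IsUnit (f t)) :
    ofUnit 𝒜 ht hd f hu ≫ toSpecZero 𝒜 =
      Spec.map (CommRingCat.ofHom (f.comp (algebraMap (𝒜 0) S))) := by
  rw [ofUnit, Category.assoc, awayι_toSpecZero, ← Spec.map_comp, ← CommRingCat.ofHom_comp]
  congr 2
  ext a
  have : fromZeroRingHom 𝒜 (Submonoid.powers t) a =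
      Away.mk 𝒜 ht 0 (a : S) (by rw [zero_smul]; exact a.2) := by
    ext
    change Localization.mk (a : S) 1 = Localization.mk _ _
    congr 1
    exact Subtype.ext (pow_zero t).symm
  rw [RingHom.comp_apply, this]
  have h := awayDesc_mk 𝒜 f hu ht 0 (a : S) (by rw [zero_smul]; exact a.2)
  rwa [pow_zero, mul_one] at h

/-- `Proj.ofUnit` is a closed immersion over `D₊(t)` if `f` generates `A` in the appropriate sense;
in that case its range is cut out by the homogeneous elements of the kernel of `f`. -/
theorem mem_range_ofUnit (f : S →+* A) (hu : IsUnit (f t))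
    (hs : Function.Surjective (awayDesc 𝒜 f t hu)) (x : Proj 𝒜) (hx : t ∉ x.asHomogeneousIdeal)
    (h : ∀ n, 0 < n → ∀ a ∈ 𝒜 n, f a = 0 → a ∈ x.asHomogeneousIdeal) :
    x ∈ Set.range (ofUnit 𝒜 ht hd f hu) := by
  obtain ⟨z, rfl⟩ : x ∈ (awayι 𝒜 t ht hd).opensRange := by
    rw [opensRange_awayι]
    exact hx
  suffices z ∈ Set.range (PrimeSpectrum.comap (awayDesc 𝒜 f t hu)) by
    obtain ⟨y, rfl⟩ := this
    exact ⟨y, rfl⟩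
  rw [range_comap_of_surjective _ _ hs]
  intro b hb
  obtain ⟨n, a, ha, rfl⟩ := Away.mk_surjective 𝒜 ht b
  -- The extra factor t makes the degree positive even when n = 0, as `h` requires.
  have hta := SetLike.mul_mem_graded ht ha
  have hfa : f (t * a) = 0 := by
    rw [map_mul, ← awayDesc_mk 𝒜 f hu ht n a ha, RingHom.mem_ker.mp hb, zero_mul, mul_zero]
  have h₁ := h _ (by omega) _ hta hfa
  by_contra hz
  refine absurd h₁ ?_
  rw [← mem_basicOpen]
  change z ∈ awayι 𝒜 t ht hd ⁻¹ᵁ basicOpen 𝒜 (t * a)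
  rw [awayι_preimage_basicOpen 𝒜 ht hd hta (by omega)]
  intro h₂
  have h₃ : Away.isLocalizationElem ht hta = Away.mk 𝒜 ht n a ha ^ d := by
    ext
    rw [val_pow, Away.val_mk, Away.val_mk, Localization.mk_pow, Localization.mk_eq_mk_iff,
      Localization.r_iff_exists]
    refine ⟨1, ?_⟩
    simp only [OneMemClass.coe_one, one_mul, SubmonoidClass.mk_pow, smul_eq_mul]
    ring
  rw [h₃] at h₂
  exact hz (z.2.mem_of_pow_mem _ h₂)

end

end AlgebraicGeometry.Proj

/-! ## A Schubert surface in the flag variety of `G₂` -/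

noncomputable section

theorem MvPolynomial.IsHomogeneous.aeval_eq_pow_mul {κ R A : Type*} [CommRing R] [CommRing A]
    [Algebra R A] {g : MvPolynomial κ R} {d : ℕ} (hg : g.IsHomogeneous d) {x y : κ → A} (c : A)
    (h : ∀ i, y i = c * x i) : MvPolynomial.aeval y g = c ^ d * MvPolynomial.aeval x g := by
  rw [MvPolynomial.aeval_def, MvPolynomial.aeval_def, MvPolynomial.eval₂_eq, MvPolynomial.eval₂_eq,
    Finset.mul_sum]
  refine Finset.sum_congr rfl fun m hm => ?_
  have hm' : ∑ i ∈ m.support, m i = d :=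
    (DFunLike.congr_fun Finsupp.degree_eq_weight_one m).trans
      (hg (MvPolynomial.mem_support_iff.mp hm))
  simp_rw [h, mul_pow]
  rw [Finset.prod_mul_distrib, Finset.prod_pow_eq_pow_sum, hm']
  ring

/-- The coefficients of `s e₁ + t e₅`. -/
def lineCoef : Fin 8 → ℤ := ![0, 1, 0, 0, 0, 1, 0, 0]

/-- The exponents of `s` in `s e₁ + t e₅`. -/
def lineDeg : Fin 8 → ℕ := ![0, 1, 0, 0, 0, 0, 0, 0]

/-- The coefficients of `s t (e₀ - e₇) + t² e₃ - s² e₆`. -/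
def normalCoef : Fin 8 → ℤ := ![1, 0, 0, 1, 0, 0, -1, -1]

/-- The exponents of `s` in `s t (e₀ - e₇) + t² e₃ - s² e₆`. -/
def normalDeg : Fin 8 → ℕ := ![1, 0, 0, 0, 0, 0, 2, 1]

/-- The exponent of `μ` in the coordinates of `lineVec ∧ y`, see `wedge_eq`. -/
def wedgeHeight (i : Fin 8 × Fin 8) : ℕ := if i = (1, 5) ∨ i = (5, 1) then 0 else 1

/-- The coefficients of the coordinates of `lineVec ∧ y`, see `wedge_eq`. -/
def wedgeCoef (i : Fin 8 × Fin 8) : ℤ :=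
  if i = (1, 5) then 1 else if i = (5, 1) then -1 else
    lineCoef i.1 * normalCoef i.2 - lineCoef i.2 * normalCoef i.1

/-- The exponents of `s` in the coordinates of `lineVec ∧ y`, see `wedge_eq`. -/
def wedgeDeg (i : Fin 8 × Fin 8) : ℕ :=
  if i = (1, 5) ∨ i = (5, 1) then 0 else
    if lineCoef i.1 = 0 then lineDeg i.2 + normalDeg i.1 else lineDeg i.1 + normalDeg i.2

/-- The indices of the coordinates on `V ⊗ V ⊗ V`. -/
abbrev FlagIndex : Type := Fin 8 × Fin 8 × Fin 8

/-- The coefficients of the coordinates of the surface, see `flagCoord_eq`. -/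
def surfaceCoef (i : FlagIndex) : ℤ := lineCoef i.1 * wedgeCoef i.2

/-- The exponents of `s` in the coordinates of the surface, see `flagCoord_eq`. -/
def surfaceDeg (i : FlagIndex) : ℕ := lineDeg i.1 + wedgeDeg i.2

/-- The exponents lie in the trapezoid with vertices (0, 0), (1, 0), (4, 1), (0, 1), a polygon of
F₃. Indices with coefficient zero are included, so that all coordinates can be treated alike on the
charts. -/
theorem surfaceDeg_le (i : FlagIndex) : (wedgeHeight i.2 = 0 ∧ surfaceDeg i ≤ 1) ∨
    (wedgeHeight i.2 = 1 ∧ surfaceDeg i ≤ 4) := by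
  have h₁ : ∀ a, lineDeg a ≤ 1 := by decide
  have h₂ : ∀ i, (wedgeHeight i = 0 ∧ wedgeDeg i = 0) ∨
    (wedgeHeight i = 1 ∧ wedgeDeg i ≤ 3) := by decide
  have := h₁ i.1
  have := h₂ i.2
  rw [surfaceDeg]
  omega

/-! ### Monomial coordinates on the surface. -/

section Coordinates

variable {k : Type u} [CommRing k]

/-- The vector `s e₁ + t e₅`. -/
def lineVec (s t : k) : Fin 8 → k := ![0, s, 0, 0, 0, t, 0, 0]

/-- The vector `α e₁ + β e₅ + μ (s t (e₀ - e₇) + t² e₃ - s² e₆)`. -/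
def planeVec (s t α β μ : k) : Fin 8 → k :=
  ![μ * (s * t), α, 0, μ * t ^ 2, 0, β, -(μ * s ^ 2), -(μ * (s * t))]

/-- The coordinates of the surface, in terms of homogeneous coordinates of a toric surface. -/
def surfaceCoord (s t l μ : k) (i : FlagIndex) : k :=
  surfaceCoef i * (l ^ (1 - wedgeHeight i.2) * μ ^ wedgeHeight i.2 * s ^ surfaceDeg i *
    t ^ (1 + 3 * wedgeHeight i.2 - surfaceDeg i))

/-- α and β enter only through the minor s β - t α of the entries 1 and 5. Every other minor is zero
or a signed monomial in s, t and μ. -/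
theorem wedge_eq (s t α β μ : k) (i : Fin 8 × Fin 8) :
    lineVec s t i.1 * planeVec s t α β μ i.2 - lineVec s t i.2 * planeVec s t α β μ i.1 =
      wedgeCoef i * ((s * β - t * α) ^ (1 - wedgeHeight i) * μ ^ wedgeHeight i * s ^ wedgeDeg i *
        t ^ (3 * wedgeHeight i - wedgeDeg i)) := by
  obtain ⟨b, c⟩ := i
  fin_cases b <;> fin_cases c <;>
    simp [lineVec, planeVec, wedgeCoef, wedgeHeight, wedgeDeg, lineCoef, lineDeg, normalCoef,
      normalDeg] <;> ring

theorem lineVec_eq (s t : k) (a : Fin 8) :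
    lineVec s t a = lineCoef a * (s ^ lineDeg a * t ^ (1 - lineDeg a)) := by
  fin_cases a <;> simp [lineVec, lineCoef, lineDeg]

theorem lineVec_mul_wedge_eq (s t α β μ : k) (i : FlagIndex) : lineVec s t i.1 *
      (lineVec s t i.2.1 * planeVec s t α β μ i.2.2 - lineVec s t i.2.2 * planeVec s t α β μ i.2.1) =
    surfaceCoord s t (s * β - t * α) μ i := by
  have h₁ : ∀ a, lineDeg a ≤ 1 := by decide
  have h₂ : ∀ i, wedgeDeg i ≤ 3 * wedgeHeight i := by decide
  rw [wedge_eq, lineVec_eq, surfaceCoord, surfaceCoef, surfaceDeg,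
    show 1 + 3 * wedgeHeight i.2 - (lineDeg i.1 + wedgeDeg i.2) =
      (1 - lineDeg i.1) + (3 * wedgeHeight i.2 - wedgeDeg i.2) by
        have := h₁ i.1
        have := h₂ i.2
        omega]
  push_cast
  ring

end Coordinates

theorem flagCoord_eq {k : Type u} [Field k] (s t α β μ : k) :
    flagCoord (lineVec s t) (planeVec s t α β μ) = surfaceCoord s t (s * β - t * α) μ :=
  funext fun i => lineVec_mul_wedge_eq s t α β μ i

/-! ### Forms that vanish on the surface. -/

section Forms

variable {k : Type u} [Field k]

/-- The form `g` vanishes on the surface with the coordinates `surfaceCoord`. -/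
def VanishesOnSurface (g : MvPolynomial FlagIndex k) : Prop :=
  ∀ u v : kˣ, MvPolynomial.aeval (surfaceCoord (u : k) 1 1 (v : k)) g = 0

/-- Every coordinate is linear in (l, μ), of degree 1 in (s, t) next to l and of degree 4 next to μ.
So t and l can be normalized to 1 at the cost of the common factor l t. -/
theorem surfaceCoord_scale (s t l m : kˣ) (i : FlagIndex) :
    surfaceCoord (s : k) (t : k) (l : k) (m : k) i =
      ((l * t : kˣ) : k) * surfaceCoord ((s / t : kˣ) : k) 1 1 ((m * t ^ 3 / l : kˣ) : k) i := by
  simp only [surfaceCoord, one_pow, mul_one, one_mul, Units.val_mul, Units.val_div_eq_div_val,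
    Units.val_pow_eq_pow_val]
  have hl := l.ne_zero
  have ht := t.ne_zero
  obtain ⟨h, h'⟩ | ⟨h, h'⟩ := surfaceDeg_le i
  · rw [h]
    generalize surfaceDeg i = e at h'
    interval_cases e <;> norm_num <;> field_simp
  · rw [h]
    generalize surfaceDeg i = e at h'
    interval_cases e <;> norm_num <;> field_simp

theorem VanishesOnSurface.aeval_eq_zero [Infinite k] {g : MvPolynomial FlagIndex k} {d : ℕ}
    (hg : g.IsHomogeneous d) (h : VanishesOnSurface g) (s t l m : k) :
    MvPolynomial.aeval (surfaceCoord s t l m) g = 0 := by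
  obtain ⟨G, hG⟩ : ∃ G : MvPolynomial (Fin 4) k, ∀ x : Fin 4 → k,
      MvPolynomial.eval x G = MvPolynomial.aeval (surfaceCoord (x 0) (x 1) (x 2) (x 3)) g := by
    refine ⟨MvPolynomial.aeval (surfaceCoord (MvPolynomial.X 0) (MvPolynomial.X 1)
      (MvPolynomial.X 2) (MvPolynomial.X 3)) g, fun x => ?_⟩
    rw [← MvPolynomial.coe_aeval_eq_eval, RingHom.coe_coe, ← AlgHom.comp_apply,
      MvPolynomial.comp_aeval]
    congr 2
    funext i
    simp [surfaceCoord]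
  -- By homogeneity and scaling, G vanishes where all four variables are nonzero. Multiplied by
  -- their product it vanishes everywhere, hence is zero over an infinite field.
  have key : G * (MvPolynomial.X 0 * MvPolynomial.X 1 * MvPolynomial.X 2 * MvPolynomial.X 3) = 0 := by
    refine MvPolynomial.funext fun x => ?_
    rw [map_mul, map_mul, map_mul, map_mul, map_zero, hG]
    simp only [MvPolynomial.eval_X]
    by_cases hx : x 0 * x 1 * x 2 * x 3 = 0
    · rw [hx, mul_zero]
    · have h₀ : IsUnit (x 0 * x 1 * x 2 * x 3) := isUnit_iff_ne_zero.mpr hx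
      simp only [IsUnit.mul_iff] at h₀
      obtain ⟨⟨⟨⟨s, hs⟩, ⟨t, ht⟩⟩, ⟨l, hl⟩⟩, ⟨m, hm⟩⟩ := h₀
      rw [← hs, ← ht, ← hl, ← hm, hg.aeval_eq_pow_mul _ (surfaceCoord_scale s t l m), h, mul_zero,
        zero_mul]
  have hG₀ : G = 0 := by
    refine (mul_eq_zero.mp key).resolve_right ?_
    simp [MvPolynomial.X_ne_zero]
  have := hG ![s, t, l, m]
  rw [hG₀, map_zero] at this
  exact this.symm

end Forms

/-! ### Evaluation of Laurent polynomials -/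

section Laurent

variable {k : Type u} [Field k]

/-- The character `(u, v) ↦ u ^ a v ^ b` of the torus. -/
def torusCharacter (k : Type u) [Field k] (a : Fin 2 → ℤ) : kˣ × kˣ →* k where
  toFun w := (w.1 ^ a 0 * w.2 ^ a 1 : kˣ)
  map_one' := by simp
  map_mul' := by
    intro x y
    rw [← Units.val_mul, Prod.fst_mul, Prod.snd_mul, mul_zpow, mul_zpow, mul_mul_mul_comm]

/-- If u^n = 1 for all units u of an infinite field, then n = 0, as x^|n| - 1 has finitely many
roots for n ≠ 0. -/
theorem torusCharacter_injective [Infinite k] : Function.Injective (torusCharacter k) := by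
  have key : ∀ n : ℤ, (∀ u : kˣ, u ^ n = 1) → n = 0 := by
    intro n hn
    by_contra h0
    have hpos : 0 < n.natAbs := Int.natAbs_pos.mpr h0
    have hpow : ∀ u : kˣ, u ^ n.natAbs = 1 := by
      intro u
      rw [← zpow_natCast]
      obtain h | h := Int.natAbs_eq n
      · rw [← h, hn]
      · rw [← inv_inj, ← zpow_neg, ← h, hn, inv_one]
    have : NeZero n.natAbs := ⟨hpos.ne'⟩
    have hfin : (Set.univ : Set k).Finite := by
      refine ((Polynomial.nthRootsFinset n.natAbs (1 : k)).finite_toSet.insert 0).subset fun x _ => ?_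
      by_cases hx : x = 0
      · exact Or.inl hx
      · refine Or.inr ((Polynomial.mem_nthRootsFinset hpos 1).mpr ?_)
        have := congrArg Units.val (hpow (Units.mk0 x hx))
        simpa using this
    exact Set.infinite_univ hfin
  intro a b hab
  have h : ∀ u v : kˣ, u ^ a 0 * v ^ a 1 = u ^ b 0 * v ^ b 1 := fun u v =>
    Units.ext (DFunLike.congr_fun hab (u, v))
  funext i
  fin_cases i
  · refine sub_eq_zero.mp (key _ fun u => ?_)
    have := h u 1
    simp only [one_zpow, mul_one] at this
    simp [zpow_sub, this]
  · refine sub_eq_zero.mp (key _ fun u => ?_)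
    have := h 1 u
    simp only [one_zpow, one_mul] at this
    simp [zpow_sub, this]

/-- The evaluation of Laurent polynomials at a point of the torus. -/
def laurentEval (P : AddSubmonoid (Fin 2 → ℤ)) (w : kˣ × kˣ) : AddMonoidAlgebra k P →ₐ[k] k :=
  AddMonoidAlgebra.lift k k P
    { toFun := fun m => torusCharacter k m.toAdd.1 w
      map_one' := by simp [torusCharacter]
      map_mul' := by
        intro m m'
        simp [torusCharacter, zpow_add]
        ring }

theorem laurentEval_single (P : AddSubmonoid (Fin 2 → ℤ)) (w : kˣ × kˣ) (m : P) (r : k) :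
    laurentEval P w (AddMonoidAlgebra.single m r) = r * torusCharacter k m.1 w := by
  refine (AddMonoidAlgebra.lift_single _ _ _).trans ?_
  rw [smul_eq_mul]
  rfl

/-- Distinct characters of the torus are linearly independent (Dedekind). -/
theorem eq_zero_of_laurentEval_eq_zero [Infinite k] {P : AddSubmonoid (Fin 2 → ℤ)}
    {p : AddMonoidAlgebra k P} (h : ∀ w, laurentEval P w p = 0) : p = 0 := by
  have hli := (linearIndependent_monoidHom (kˣ × kˣ) k).comp (fun m : P => torusCharacter k m.1)
    (torusCharacter_injective.comp Subtype.val_injective)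
  rw [linearIndependent_iff] at hli
  have := hli p.coeff (by
    funext w
    rw [Finsupp.linearCombination_apply, Finsupp.sum, Finset.sum_apply, Pi.zero_apply, ← h w]
    conv_rhs => rw [← p.sum_coeff_single, Finsupp.sum, map_sum]
    refine Finset.sum_congr rfl fun m _ => ?_
    rw [laurentEval_single]
    rfl)
  exact AddMonoidAlgebra.coeffAddEquiv.injective this

end Laurent

end

/-! ### The Borel orbit of `surfaceFlag`. -/

noncomputable section

open scoped Pointwise

variable {k : Type u} [Field k]

/-- For fixed x = s e₁ + t e₅ ≠ 0 the equations x y = y x = 0 are linear in y. They force y into the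
space spanned by e₁, e₅ and one vector quadratic in (s, t), which gives the pencil of planes through
⟨x⟩. -/
theorem exists_eq_planeVec {s t : k} (hst : s ≠ 0 ∨ t ≠ 0) {y : Fin 8 → k}
    (h : octonionMul (lineVec s t) y = 0) (h' : octonionMul y (lineVec s t) = 0) :
    ∃ α β μ, y = planeVec s t α β μ := by
  have e₀ := congrFun h 0
  have e₁ := congrFun h 1
  have e₃ := congrFun h 3
  have e₅ := congrFun h 5
  have e₆ := congrFun h 6
  have e₇ := congrFun h 7
  have f₁ := congrFun h' 1
  have f₅ := congrFun h' 5
  simp [octonionMul, lineVec] at e₀ e₁ e₃ e₅ e₆ e₇ f₁ f₅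
  have y₄ : y 4 = 0 := by
    rcases hst with hs | ht
    · exact e₀.resolve_left hs
    · exact e₃.resolve_left ht
  have y₂ : y 2 = 0 := by
    rcases hst with hs | ht
    · exact e₆.resolve_left hs
    · exact e₇.resolve_left ht
  -- μ is read off from the entry -μ s² if t = 0, and from the entry μ t² otherwise.
  by_cases ht : t = 0
  · have hs : s ≠ 0 := hst.resolve_right (not_not.mpr ht)
    subst ht
    have y₀ : y 0 = 0 := by simpa [hs] using f₁
    have y₃ : y 3 = 0 := by simpa [hs] using e₅
    have y₇ : y 7 = 0 := by simpa [hs] using e₁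
    refine ⟨y 1, y 5, -(y 6 / s ^ 2), ?_⟩
    funext i
    fin_cases i <;> simp [planeVec, y₀, y₂, y₃, y₄, y₇]
    field_simp
  · have y₀ : y 0 = y 3 / t ^ 2 * (s * t) := by
      field_simp
      linear_combination e₅
    have y₇ : y 7 = -(y 3 / t ^ 2 * (s * t)) := by
      field_simp
      linear_combination f₅
    have y₆ : y 6 = -(y 3 / t ^ 2 * s ^ 2) := by
      rw [y₇] at e₁
      apply mul_left_cancel₀ ht
      linear_combination (-1 : k) * e₁
    refine ⟨y 1, y 5, y 3 / t ^ 2, ?_⟩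
    funext i
    fin_cases i <;> simp [planeVec, y₂, y₄]
    · exact y₀
    · field_simp
    · exact y₆
    · exact y₇

variable (k) in
/-- A flag in the open subset of a Schubert surface. -/
def surfaceFlag : G2Flag k where
  line := Submodule.span k {lineVec 1 1}
  plane := Submodule.span k {lineVec 1 1, planeVec 1 1 (-1) 0 1}
  finrank_line := finrank_span_singleton fun h => by simpa [lineVec] using congrFun h 1
  finrank_plane := by
    have h : LinearIndependent k ![(lineVec 1 1 : Fin 8 → k), planeVec 1 1 (-1) 0 1] := by
      rw [LinearIndependent.pair_iff]
      intro s t hst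
      have h0 := congrFun hst 0
      have h5 := congrFun hst 5
      simp [lineVec, planeVec] at h0 h5
      exact ⟨h5, h0⟩
    have := finrank_span_eq_card h
    rw [Matrix.range_cons_cons_empty] at this
    simpa using this
  line_le_plane := Submodule.span_mono (by simp)
  mul_eq_zero := by
    intro x hx y hy
    obtain ⟨a, b, rfl⟩ := Submodule.mem_span_pair.mp hx
    obtain ⟨c, d, rfl⟩ := Submodule.mem_span_pair.mp hy
    funext i
    fin_cases i <;> simp [octonionMul, lineVec, planeVec] <;> ring

/-- The diagonal elements of `G₂`. -/
def torusElement (a b : kˣ) : (Fin 8 → k) ≃ₗ[k] (Fin 8 → k) :=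
  LinearEquiv.piCongrRight fun i => LinearEquiv.smulOfUnit
    ((![1, a, b, (a * b)⁻¹, a⁻¹, b⁻¹, a * b, 1] : Fin 8 → kˣ) i)

theorem torusElement_apply (a b : kˣ) (x : Fin 8 → k) (i : Fin 8) : torusElement a b x i =
    ((![1, a, b, (a * b)⁻¹, a⁻¹, b⁻¹, a * b, 1] : Fin 8 → kˣ) i : k) * x i := rfl

theorem torusElement_mem_G2 (a b : kˣ) : torusElement a b ∈ G2 k := by
  intro x y
  have ha := a.ne_zero
  have hb := b.ne_zero
  funext i
  rw [torusElement_apply]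
  fin_cases i <;> simp [octonionMul, torusElement_apply] <;> field_simp

theorem torusElement_lineVec (a b : kˣ) (s t : k) :
    torusElement a b (lineVec s t) = lineVec (a * s) (b⁻¹ * t) := by
  funext i
  rw [torusElement_apply]
  fin_cases i <;> simp [lineVec]

theorem torusElement_planeVec (a b : kˣ) (s t α β μ : k) :
    torusElement a b (planeVec s t α β μ) =
      planeVec (a * s) (b⁻¹ * t) (a * α) (b⁻¹ * β) (b / a * μ) := by
  have ha := a.ne_zero
  have hb := b.ne_zero
  funext i
  rw [torusElement_apply]
  fin_cases i <;> simp [planeVec] <;> field_simp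

theorem standardFlag_line_eq : (standardFlag k).line = Submodule.span k {lineVec 1 0} := by
  have : (lineVec 1 0 : Fin 8 → k) = Pi.single 1 1 := by
    funext i
    fin_cases i <;> simp [lineVec]
  rw [this]
  rfl

theorem standardFlag_plane_eq :
    (standardFlag k).plane = Submodule.span k {lineVec 1 0, lineVec 0 1} := by
  have h : (lineVec 1 0 : Fin 8 → k) = Pi.single 1 1 := by
    funext i
    fin_cases i <;> simp [lineVec]
  have h' : (lineVec 0 1 : Fin 8 → k) = Pi.single 5 1 := by
    funext i
    fin_cases i <;> simp [lineVec]
  rw [h, h']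
  rfl

theorem smul_span_singleton (g : (Fin 8 → k) ≃ₗ[k] (Fin 8 → k)) (x : Fin 8 → k) :
    g • Submodule.span k {x} = Submodule.span k {g x} := by
  rw [Submodule.smul_span, Set.smul_set_singleton]
  rfl

theorem smul_span_pair (g : (Fin 8 → k) ≃ₗ[k] (Fin 8 → k)) (x y : Fin 8 → k) :
    g • Submodule.span k {x, y} = Submodule.span k {g x, g y} := by
  rw [Submodule.smul_span, ← Set.image_smul, Set.image_pair]
  rfl

theorem lineVec_smul (c s t : k) : c • lineVec s t = lineVec (c * s) (c * t) := by
  funext i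
  fin_cases i <;> simp [lineVec]

theorem lineVec_add (s t s' t' : k) : lineVec s t + lineVec s' t' = lineVec (s + s') (t + t') := by
  funext i
  fin_cases i <;> simp [lineVec]

theorem torusElement_mem_G2Borel (a b : kˣ) : torusElement a b ∈ G2Borel k := by
  have h : ∀ (c : kˣ) (s t : k), lineVec (c * s) (c * t) = c • lineVec s t := fun c s t =>
    (lineVec_smul _ _ _).symm
  have h₁ : torusElement a b (lineVec (1 : k) 0) = a • lineVec 1 0 := by
    rw [torusElement_lineVec, ← h]
    simp
  have h₂ : torusElement a b (lineVec (0 : k) 1) = b⁻¹ • lineVec 0 1 := by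
    rw [torusElement_lineVec, ← h]
    simp
  refine ⟨⟨torusElement_mem_G2 a b, ?_⟩, ?_⟩
  · refine MulAction.mem_stabilizer_iff.mpr ?_
    rw [standardFlag_line_eq, smul_span_singleton, h₁]
    exact Submodule.span_singleton_group_smul_eq _ _ _
  · refine MulAction.mem_stabilizer_iff.mpr ?_
    rw [standardFlag_plane_eq, smul_span_pair, h₁, h₂, Submodule.span_insert, Submodule.span_insert, Submodule.span_singleton_group_smul_eq,
      Submodule.span_singleton_group_smul_eq]

/-- The action of `G₂` on its flag variety. -/
def G2Flag.smul (E : G2Flag k) (g : (Fin 8 → k) ≃ₗ[k] (Fin 8 → k)) (hg : g ∈ G2 k) : G2Flag k where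
  line := g • E.line
  plane := g • E.plane
  finrank_line := (LinearEquiv.finrank_map_eq g E.line).trans E.finrank_line
  finrank_plane := (LinearEquiv.finrank_map_eq g E.plane).trans E.finrank_plane
  line_le_plane := Submodule.map_mono E.line_le_plane
  mul_eq_zero := by
    rintro _ ⟨x, hx, rfl⟩ _ ⟨y, hy, rfl⟩
    refine (hg x y).symm.trans ?_
    rw [E.mul_eq_zero x hx y hy, map_zero]

/-- A form vanishes on the orbit of `surfaceFlag` if and only if it vanishes on the surface. -/
theorem vanishesOnOrbit_iff [Infinite k] {g : MvPolynomial FlagIndex k} {d : ℕ}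
    (hg : g.IsHomogeneous d) : (∀ E' ∈ borelOrbit (surfaceFlag k), ∀ x y : Fin 8 → k,
      E'.line = Submodule.span k {x} → E'.plane = Submodule.span k {x, y} →
        MvPolynomial.eval (flagCoord x y) g = 0) ↔ VanishesOnSurface g := by
  constructor
  · intro h u v
    -- The torus element (a, b) moves the point u = v = 1 of the surface to u = a b, v = a⁻² b⁻¹.
    -- Solving for a and b gives these values.
    have hb := torusElement_mem_G2Borel (k := k) (u * v)⁻¹ (u ^ 2 * v)
    obtain ⟨a, ha⟩ : ∃ a, a = (u * v)⁻¹ := ⟨_, rfl⟩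
    obtain ⟨b, hb'⟩ : ∃ b, b = u ^ 2 * v := ⟨_, rfl⟩
    rw [← ha, ← hb'] at hb
    have := h ((surfaceFlag k).smul _ hb.1.1) ⟨_, hb, rfl, rfl⟩ (lineVec a (b⁻¹ : kˣ))
      (planeVec a (b⁻¹ : kˣ) (-a) 0 (b / a : kˣ)) ?_ ?_
    · rw [flagCoord_eq, ← MvPolynomial.coe_aeval_eq_eval, RingHom.coe_coe,
        show (a : k) * 0 - (b⁻¹ : kˣ) * -a = ((a * b⁻¹ : kˣ) : k) by push_cast; ring,
        hg.aeval_eq_pow_mul _ (surfaceCoord_scale a b⁻¹ (a * b⁻¹) (b / a))] at this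
      have hs : a / b⁻¹ = u := by
        rw [ha, hb']
        apply Units.ext
        have := u.ne_zero
        have := v.ne_zero
        push_cast
        field_simp
      have hm : b / a * b⁻¹ ^ 3 / (a * b⁻¹) = v := by
        rw [ha, hb']
        apply Units.ext
        have := u.ne_zero
        have := v.ne_zero
        push_cast
        field_simp
      rw [hs, hm] at this
      exact (mul_eq_zero.mp this).resolve_left (pow_ne_zero _ (Units.ne_zero _))
    · refine (smul_span_singleton _ _).trans ?_
      rw [torusElement_lineVec, mul_one, mul_one]
    · refine (smul_span_pair _ _ _).trans ?_
      rw [torusElement_lineVec, torusElement_planeVec]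
      simp
  · rintro h E' ⟨b, hb, hl, hp⟩ x y hx hy
    -- The Borel subgroup preserves the standard plane, which contains the line of `surfaceFlag`. So
    -- the lines in the orbit stay in that plane, and no further description of the subgroup is
    -- needed.
    obtain ⟨s, t, rfl⟩ : ∃ s t, x = lineVec s t := by
      have h₁ : x ∈ b • (surfaceFlag k).line := by
        rw [hl, hx]
        exact Submodule.mem_span_singleton_self x
      have h₂ : x ∈ b • (standardFlag k).plane := by
        refine Submodule.map_mono ?_ h₁
        rw [standardFlag_plane_eq]
        refine Submodule.span_le.mpr (Set.singleton_subset_iff.mpr ?_)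
        refine Submodule.mem_span_pair.mpr ⟨1, 1, ?_⟩
        rw [one_smul, one_smul, lineVec_add, zero_add, add_zero]
      rw [MulAction.mem_stabilizer_iff.mp hb.2, standardFlag_plane_eq] at h₂
      obtain ⟨s, t, rfl⟩ := Submodule.mem_span_pair.mp h₂
      refine ⟨s, t, ?_⟩
      rw [lineVec_smul, lineVec_smul, lineVec_add]
      simp
    have hst : s ≠ 0 ∨ t ≠ 0 := by
      by_contra! h0
      have h₁ := E'.finrank_line
      rw [hx, h0.1, h0.2, ← zero_mul (1 : k), ← lineVec_smul, zero_smul,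
        Submodule.span_zero_singleton, finrank_bot] at h₁
      exact zero_ne_one h₁
    have hxm : lineVec s t ∈ E'.plane := by
      rw [hy]
      exact Submodule.subset_span (by simp)
    have hym : y ∈ E'.plane := by
      rw [hy]
      exact Submodule.subset_span (by simp)
    obtain ⟨α, β, μ, rfl⟩ := exists_eq_planeVec hst (E'.mul_eq_zero _ hxm _ hym)
      (E'.mul_eq_zero _ hym _ hxm)
    rw [flagCoord_eq, ← MvPolynomial.coe_aeval_eq_eval, RingHom.coe_coe]
    exact h.aeval_eq_zero hg _ _ _ _

end

/-! ### The embedding of the Hirzebruch surface -/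

noncomputable section

/-- The exponents of the coordinates of the surface. -/
def surfaceWeight (i : FlagIndex) : Fin 2 → ℤ := ![surfaceDeg i, wedgeHeight i.2]

/-- The coordinates whose exponents are the vertices of a polygon of `F₃`. -/
def vertexIndex : Fin 4 → FlagIndex := ![(5, 1, 5), (1, 1, 5), (1, 6, 1), (5, 5, 3)]

/-- The cones of `F₃` that correspond to the vertices. -/
def vertexCone : Fin 4 → Finset (Fin 4) := ![{0, 1}, {1, 2}, {2, 3}, {0, 3}]

/-- A vertex whose cone contains a given cone. -/
def vertexOf (σ : Finset (Fin 4)) : Fin 4 :=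
  if σ ⊆ {0, 1} then 0 else if σ ⊆ {1, 2} then 1 else if σ ⊆ {2, 3} then 2 else 3

theorem surfaceCoef_vertexIndex (v : Fin 4) : surfaceCoef (vertexIndex v) = 1 := by
  revert v
  decide

theorem subset_vertexCone {σ : Finset (Fin 4)} (h : σ ∈ (hirzebruchFan 3).cones) :
    σ ⊆ vertexCone (vertexOf σ) := by
  have : ∀ σ : Finset (Fin 4), (¬ (0 ∈ σ ∧ 2 ∈ σ) ∧ ¬ (1 ∈ σ ∧ 3 ∈ σ)) →
    σ ⊆ vertexCone (vertexOf σ) := by decide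
  exact this σ h

theorem vertexCone_mem (v : Fin 4) : vertexCone v ∈ (hirzebruchFan 3).cones := by
  have : ∀ v, ¬ (0 ∈ vertexCone v ∧ 2 ∈ vertexCone v) ∧
    ¬ (1 ∈ vertexCone v ∧ 3 ∈ vertexCone v) := by decide
  exact this v

theorem vertexOf_vertexCone (v : Fin 4) : vertexOf (vertexCone v) = v := by
  revert v
  decide

theorem surfaceWeight_vertexIndex (v : Fin 4) :
    surfaceWeight (vertexIndex v) = (![![0, 0], ![1, 0], ![4, 1], ![0, 1]] : Fin 4 → Fin 2 → ℤ) v := by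
  revert v
  decide

theorem surfaceWeight_dotProduct (i j : FlagIndex) :
    (surfaceWeight i - surfaceWeight j) ⬝ᵥ hirzebruchRay 3 0 = surfaceDeg i - surfaceDeg j ∧
    (surfaceWeight i - surfaceWeight j) ⬝ᵥ hirzebruchRay 3 1 =
      wedgeHeight i.2 - wedgeHeight j.2 ∧
    (surfaceWeight i - surfaceWeight j) ⬝ᵥ hirzebruchRay 3 2 =
      3 * (wedgeHeight i.2 - wedgeHeight j.2) - (surfaceDeg i - surfaceDeg j) ∧
    (surfaceWeight i - surfaceWeight j) ⬝ᵥ hirzebruchRay 3 3 =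
      -(wedgeHeight i.2 - wedgeHeight j.2) := by
  obtain ⟨h₀, h₁, h₂, h₃⟩ := dotProduct_hirzebruchRay 3 (surfaceWeight i - surfaceWeight j)
  exact ⟨h₀, h₁, h₂, h₃⟩

theorem vertexIndex_data : (surfaceDeg (vertexIndex 0) = 0 ∧ wedgeHeight (vertexIndex 0).2 = 0) ∧
    (surfaceDeg (vertexIndex 1) = 1 ∧ wedgeHeight (vertexIndex 1).2 = 0) ∧
    (surfaceDeg (vertexIndex 2) = 4 ∧ wedgeHeight (vertexIndex 2).2 = 1) ∧
    (surfaceDeg (vertexIndex 3) = 0 ∧ wedgeHeight (vertexIndex 3).2 = 1) := by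
  decide

/-- `vertexCone v` is the inner normal cone of the trapezoid at the vertex v, and all exponents lie
in the trapezoid. -/
theorem surfaceWeight_sub_mem_vertexCone (v : Fin 4) (i : FlagIndex) :
    ∀ j ∈ vertexCone v, 0 ≤ (surfaceWeight i - surfaceWeight (vertexIndex v)) ⬝ᵥ
      hirzebruchRay 3 j := by
  have hi := surfaceDeg_le i
  have hv := vertexIndex_data
  fin_cases v
  · suffices 0 ≤ (surfaceWeight i - surfaceWeight (vertexIndex 0)) ⬝ᵥ hirzebruchRay 3 0 ∧
      0 ≤ (surfaceWeight i - surfaceWeight (vertexIndex 0)) ⬝ᵥ hirzebruchRay 3 1 by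
        simpa [vertexCone] using this
    have := surfaceWeight_dotProduct i (vertexIndex 0)
    omega
  · suffices 0 ≤ (surfaceWeight i - surfaceWeight (vertexIndex 1)) ⬝ᵥ hirzebruchRay 3 1 ∧
      0 ≤ (surfaceWeight i - surfaceWeight (vertexIndex 1)) ⬝ᵥ hirzebruchRay 3 2 by
        simpa [vertexCone] using this
    have := surfaceWeight_dotProduct i (vertexIndex 1)
    omega
  · suffices 0 ≤ (surfaceWeight i - surfaceWeight (vertexIndex 2)) ⬝ᵥ hirzebruchRay 3 2 ∧
      0 ≤ (surfaceWeight i - surfaceWeight (vertexIndex 2)) ⬝ᵥ hirzebruchRay 3 3 by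
        simpa [vertexCone] using this
    have := surfaceWeight_dotProduct i (vertexIndex 2)
    omega
  · suffices 0 ≤ (surfaceWeight i - surfaceWeight (vertexIndex 3)) ⬝ᵥ hirzebruchRay 3 0 ∧
      0 ≤ (surfaceWeight i - surfaceWeight (vertexIndex 3)) ⬝ᵥ hirzebruchRay 3 3 by
        simpa [vertexCone] using this
    have := surfaceWeight_dotProduct i (vertexIndex 3)
    omega

theorem surfaceWeight_sub_mem (σ : (hirzebruchFan 3).Cone) (i : FlagIndex) :
    surfaceWeight i - surfaceWeight (vertexIndex (vertexOf σ.1)) ∈ (hirzebruchFan 3).dualMonoid σ.1 :=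
  fun j hj => surfaceWeight_sub_mem_vertexCone _ i j (subset_vertexCone σ.2 hj)

/-- The difference of two vertices cuts out the common face of their cones. -/
theorem surfaceWeight_sub_vertexIndex (v w j : Fin 4) (hj : j ∈ vertexCone w) :
    (j ∈ vertexCone v → (surfaceWeight (vertexIndex v) - surfaceWeight (vertexIndex w)) ⬝ᵥ
      hirzebruchRay 3 j = 0) ∧
    (j ∉ vertexCone v → 0 < (surfaceWeight (vertexIndex v) - surfaceWeight (vertexIndex w)) ⬝ᵥ
      hirzebruchRay 3 j) := by
  rw [surfaceWeight_vertexIndex, surfaceWeight_vertexIndex]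
  revert v w j
  decide

/-- Coordinates whose quotients by the coordinate of the vertex generate the dual cone. -/
theorem exists_generators (v : Fin 4) : ∃ i₁ i₂ : FlagIndex, surfaceCoef i₁ = 1 ∧
    surfaceCoef i₂ = 1 ∧ ∀ u ∈ (hirzebruchFan 3).dualMonoid (vertexCone v), ∃ n₁ n₂ : ℕ,
      u = n₁ • (surfaceWeight i₁ - surfaceWeight (vertexIndex v)) +
        n₂ • (surfaceWeight i₂ - surfaceWeight (vertexIndex v)) := by
  rw [surfaceWeight_vertexIndex]
  -- The neighbouring lattice points on the two edges at each vertex. Their coordinates have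
  -- coefficient 1, so they generate in every characteristic.
  have e₁ : surfaceWeight ((![(1, 1, 5), (5, 1, 5), (1, 1, 0), (1, 5, 3)] : Fin 4 → FlagIndex) v) =
      (![![1, 0], ![0, 0], ![3, 1], ![1, 1]] : Fin 4 → Fin 2 → ℤ) v := by
    revert v
    decide
  have e₂ : surfaceWeight ((![(5, 5, 3), (1, 6, 1), (1, 1, 5), (5, 1, 5)] : Fin 4 → FlagIndex) v) =
      (![![0, 1], ![4, 1], ![1, 0], ![0, 0]] : Fin 4 → Fin 2 → ℤ) v := by
    clear e₁
    revert v
    decide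
  refine ⟨(![(1, 1, 5), (5, 1, 5), (1, 1, 0), (1, 5, 3)] : Fin 4 → FlagIndex) v,
    (![(5, 5, 3), (1, 6, 1), (1, 1, 5), (5, 1, 5)] : Fin 4 → FlagIndex) v, by revert v; decide,
    by revert v; decide, fun u hu => ?_⟩
  have hu : ∀ j ∈ vertexCone v, 0 ≤ u ⬝ᵥ hirzebruchRay 3 j := hu
  obtain ⟨h₀, h₁, h₂, h₃⟩ := dotProduct_hirzebruchRay 3 u
  rw [e₁, e₂]
  fin_cases v
  · have g₀ := hu 0 (by decide)
    have g₁ := hu 1 (by decide)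
    rw [h₀] at g₀
    rw [h₁] at g₁
    refine ⟨(u 0).toNat, (u 1).toNat, ?_⟩
    funext i
    fin_cases i <;> simp [g₀, g₁]
  · have g₁ := hu 1 (by decide)
    have g₂ := hu 2 (by decide)
    rw [h₁] at g₁
    rw [h₂] at g₂
    push_cast at g₂
    refine ⟨(3 * u 1 - u 0).toNat, (u 1).toNat, ?_⟩
    funext i
    fin_cases i
    · simp [g₁]
      omega
    · simp [g₁]
  · have g₂ := hu 2 (by decide)
    have g₃ := hu 3 (by decide)
    rw [h₂] at g₂
    rw [h₃] at g₃
    push_cast at g₂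
    refine ⟨(3 * u 1 - u 0).toNat, (-u 1).toNat, ?_⟩
    funext i
    fin_cases i <;> (simp; omega)
  · have g₀ := hu 0 (by decide)
    have g₃ := hu 3 (by decide)
    rw [h₀] at g₀
    rw [h₃] at g₃
    refine ⟨(u 0).toNat, (-u 1).toNat, ?_⟩
    funext i
    fin_cases i
    · simp [g₀]
    · simp [g₀]
      omega

/-- Every exponent lies on an edge of the polygon that is divisible by `4`. -/
theorem exists_vertices (i : FlagIndex) : ∃ v w a b, a + b = 4 ∧
    4 * surfaceDeg i = a * surfaceDeg (vertexIndex v) + b * surfaceDeg (vertexIndex w) ∧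
    4 * wedgeHeight i.2 = a * wedgeHeight (vertexIndex v).2 + b * wedgeHeight (vertexIndex w).2 := by
  obtain ⟨h₀, h₁, h₂, h₃⟩ := vertexIndex_data
  obtain ⟨h, h'⟩ | ⟨h, h'⟩ := surfaceDeg_le i
  · refine ⟨0, 1, 4 - 4 * surfaceDeg i, 4 * surfaceDeg i, by omega, ?_, ?_⟩
    · rw [h₀.1, h₁.1]
      omega
    · rw [h₀.2, h₁.2, h]
      omega
  · refine ⟨3, 2, 4 - surfaceDeg i, surfaceDeg i, by omega, ?_, ?_⟩
    · rw [h₃.1, h₂.1]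
      omega
    · rw [h₃.2, h₂.2, h]
      omega

end

/-! ### The morphism from F₃ to projective space. -/

noncomputable section

attribute [local instance] MvPolynomial.gradedAlgebra

theorem torusCharacter_add (k : Type u) [Field k] (a b : Fin 2 → ℤ) :
    torusCharacter k (a + b) = torusCharacter k a * torusCharacter k b := by
  refine MonoidHom.ext fun w => ?_
  rw [MonoidHom.mul_apply]
  simp only [torusCharacter, MonoidHom.coe_mk, OneHom.coe_mk, ← Units.val_mul, Pi.add_apply, zpow_add]
  congr 1
  exact mul_mul_mul_comm _ _ _ _

section Charts

variable (k : Type u) [Field k]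

/-- The functions on a chart of `F₃`. -/
abbrev ChartRing (σ : (hirzebruchFan 3).Cone) : Type u :=
  AddMonoidAlgebra k ((hirzebruchFan 3).dualMonoid σ.1)

/-- The coordinates of the embedding of `F₃`, on a chart. -/
def chartCoord (σ : (hirzebruchFan 3).Cone) (i : FlagIndex) : ChartRing k σ :=
  AddMonoidAlgebra.single ⟨_, surfaceWeight_sub_mem σ i⟩ (surfaceCoef i : k)

/-- The evaluation of forms at the coordinates of the embedding of `F₃`. -/
def chartHom (σ : (hirzebruchFan 3).Cone) : MvPolynomial FlagIndex k →ₐ[k] ChartRing k σ :=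
  MvPolynomial.aeval (chartCoord k σ)

theorem chartHom_X (σ : (hirzebruchFan 3).Cone) (i : FlagIndex) :
    chartHom k σ (MvPolynomial.X i) = chartCoord k σ i :=
  MvPolynomial.aeval_X _ _

theorem chartCoord_vertex (σ : (hirzebruchFan 3).Cone) :
    chartCoord k σ (vertexIndex (vertexOf σ.1)) = 1 := by
  rw [chartCoord, AddMonoidAlgebra.one_def, surfaceCoef_vertexIndex, Int.cast_one]
  congr 1
  exact Subtype.ext (sub_self _)

variable {k} in
-- At a point of the torus, `chartHom k σ g` and g on the surface differ by a nonzero factor, and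
-- over an infinite field a Laurent polynomial is determined by its values.
theorem chartHom_eq_zero_iff [Infinite k] (σ : (hirzebruchFan 3).Cone)
    {g : MvPolynomial FlagIndex k} {d : ℕ} (hg : g.IsHomogeneous d) :
    chartHom k σ g = 0 ↔ VanishesOnSurface g := by
  have key : ∀ w : kˣ × kˣ, MvPolynomial.aeval (surfaceCoord (w.1 : k) 1 1 (w.2 : k)) g =
      torusCharacter k (surfaceWeight (vertexIndex (vertexOf σ.1))) w ^ d *
        laurentEval _ w (chartHom k σ g) := by
    intro w
    rw [chartHom, ← AlgHom.comp_apply, MvPolynomial.comp_aeval]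
    refine hg.aeval_eq_pow_mul _ fun i => ?_
    rw [chartCoord, laurentEval_single, mul_left_comm, ← MonoidHom.mul_apply, ← torusCharacter_add,
      add_sub_cancel]
    simp [surfaceCoord, torusCharacter, surfaceWeight, mul_comm]
  constructor
  · intro h u v
    rw [key (u, v), h, map_zero, mul_zero]
  · intro h
    refine eq_zero_of_laurentEval_eq_zero fun w => ?_
    have := key w
    rw [h w.1 w.2] at this
    refine (mul_eq_zero.mp this.symm).resolve_left (pow_ne_zero _ ?_)
    exact (w.1 ^ surfaceWeight _ 0 * w.2 ^ surfaceWeight _ 1).ne_zero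

/-- A smaller cone may be normalized by a different vertex. This multiplies all coordinates by one
common factor, which does not affect the morphism to projective space. -/
theorem faceMap_chartCoord {σ τ : (hirzebruchFan 3).Cone} (h : τ ≤ σ) (i : FlagIndex) :
    (hirzebruchFan 3).faceMap k (σ := σ.1) (τ := τ.1) h (chartCoord k σ i) =
      (hirzebruchFan 3).faceMap k (σ := σ.1) (τ := τ.1) h
        (chartCoord k σ (vertexIndex (vertexOf τ.1))) * chartCoord k τ i := by
  simp only [chartCoord]
  rw [SimplicialFan.faceMap_single, SimplicialFan.faceMap_single, AddMonoidAlgebra.single_mul_single,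
    surfaceCoef_vertexIndex, Int.cast_one, one_mul]
  congr 1
  refine Subtype.ext ?_
  change surfaceWeight i - _ = (surfaceWeight _ - _) + (surfaceWeight i - surfaceWeight _)
  abel

theorem faceMap_chartHom {σ τ : (hirzebruchFan 3).Cone} (h : τ ≤ σ)
    {g : MvPolynomial FlagIndex k} {d : ℕ} (hg : g.IsHomogeneous d) :
    (hirzebruchFan 3).faceMap k (σ := σ.1) (τ := τ.1) h (chartHom k σ g) =
      (hirzebruchFan 3).faceMap k (σ := σ.1) (τ := τ.1) h
        (chartCoord k σ (vertexIndex (vertexOf τ.1))) ^ d * chartHom k τ g := by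
  refine Eq.trans ?_ (hg.aeval_eq_pow_mul _ (faceMap_chartCoord k h))
  rw [chartHom, MvPolynomial.aeval_def, MvPolynomial.aeval_def, MvPolynomial.hom_eval₂]
  congr 1
  ext r
  simp [SimplicialFan.faceMap]

theorem X_mem (i : FlagIndex) :
    (MvPolynomial.X i : MvPolynomial FlagIndex k) ∈ MvPolynomial.homogeneousSubmodule FlagIndex k 1 :=
  MvPolynomial.isHomogeneous_X k i

theorem isUnit_chartHom_X (σ : (hirzebruchFan 3).Cone) :
    IsUnit ((chartHom k σ).toRingHom (MvPolynomial.X (vertexIndex (vertexOf σ.1)))) := by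
  change IsUnit (chartHom k σ _)
  rw [chartHom_X, chartCoord_vertex]
  exact isUnit_one

/-- The embedding of `F₃`, on a chart. -/
def chartEmbedding (σ : (hirzebruchFan 3).Cone) : Spec (CommRingCat.of (ChartRing k σ)) ⟶ flagSpace k :=
  Proj.ofUnit (MvPolynomial.homogeneousSubmodule FlagIndex k) (X_mem k _) one_pos
    (chartHom k σ).toRingHom (isUnit_chartHom_X k σ)

theorem faceMap_chartEmbedding {σ τ : (hirzebruchFan 3).Cone} (h : τ ≤ σ) :
    Spec.map (CommRingCat.ofHom ((hirzebruchFan 3).faceMap k (σ := σ.1) (τ := τ.1) h)) ≫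
      chartEmbedding k σ = chartEmbedding k τ := by
  have hc : ∀ n, ∀ a ∈ MvPolynomial.homogeneousSubmodule FlagIndex k n,
      (((hirzebruchFan 3).faceMap k (σ := σ.1) (τ := τ.1) h).comp (chartHom k σ).toRingHom) a =
        (hirzebruchFan 3).faceMap k (σ := σ.1) (τ := τ.1) h
          (chartCoord k σ (vertexIndex (vertexOf τ.1))) ^ n * (chartHom k τ).toRingHom a :=
    fun n a ha => faceMap_chartHom k h ha
  have hu := (isUnit_chartHom_X k σ).map ((hirzebruchFan 3).faceMap k (σ := σ.1) (τ := τ.1) h)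
  have hu' : IsUnit ((chartHom k τ).toRingHom (MvPolynomial.X (vertexIndex (vertexOf σ.1)))) := by
    have := hc 1 _ (X_mem k (vertexIndex (vertexOf σ.1)))
    rw [RingHom.comp_apply] at this
    rw [this] at hu
    exact isUnit_of_mul_isUnit_right hu
  refine (Proj.map_ofUnit _ _ _ _ _ _).trans ?_
  refine (Proj.ofUnit_eq_of_smul _ _ _ (chartHom k τ).toRingHom _ _ hc hu' hu).trans ?_
  exact Proj.ofUnit_eq _ _ _ _ _ _ _ _

/-- The embedding of `F₃` in projective space. -/
def surfaceEmbedding : (hirzebruchFan 3).toricScheme k ⟶ flagSpace k :=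
  colimit.desc ((hirzebruchFan 3).diagram k)
    { pt := flagSpace k
      ι :=
        { app := chartEmbedding k
          naturality := fun _ _ f =>
            (faceMap_chartEmbedding k (leOfHom f)).trans (Category.comp_id _).symm } }

theorem coneι_surfaceEmbedding (σ : (hirzebruchFan 3).Cone) :
    (hirzebruchFan 3).coneι k σ ≫ surfaceEmbedding k = chartEmbedding k σ :=
  colimit.ι_desc _ _

theorem surfaceEmbedding_toSpec :
    surfaceEmbedding k ≫ flagSpaceToSpec k = (hirzebruchFan 3).toSpec k := by
  refine colimit.hom_ext fun σ => ?_
  refine (Category.assoc _ _ _).symm.trans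
    ((congrArg (· ≫ _) (coneι_surfaceEmbedding k σ)).trans
      (Eq.trans ?_ (SimplicialFan.coneι_toSpec _ k σ).symm))
  rw [chartEmbedding, flagSpaceToSpec]
  refine (Category.assoc _ _ _).symm.trans ?_
  refine (congrArg (· ≫ _) (Proj.ofUnit_toSpecZero _ _ _ _ _)).trans ?_
  rw [← Spec.map_comp, ← CommRingCat.ofHom_comp]
  congr 2
  exact RingHom.ext fun r => (chartHom k σ).commutes r

theorem chartEmbedding_preimage_basicOpen (σ : (hirzebruchFan 3).Cone)
    {g : MvPolynomial FlagIndex k} {d : ℕ} (hg : g.IsHomogeneous d) (hd : 0 < d) :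
    chartEmbedding k σ ⁻¹ᵁ Proj.basicOpen (MvPolynomial.homogeneousSubmodule FlagIndex k) g =
      PrimeSpectrum.basicOpen (chartHom k σ g) :=
  Proj.ofUnit_preimage_basicOpen _ _ _ _ _ hg hd

end Charts

end

/-! ### The morphism is an immersion. -/

noncomputable section

attribute [local instance] MvPolynomial.gradedAlgebra

variable (k : Type u) [Field k]

theorem vertex_sub_dotProduct {σ τ : (hirzebruchFan 3).Cone}
    (hσ : vertexCone (vertexOf σ.1) = σ.1) {i : Fin 4} (hi : i ∈ τ.1) :
    (i ∈ σ.1 → (surfaceWeight (vertexIndex (vertexOf σ.1)) -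
      surfaceWeight (vertexIndex (vertexOf τ.1))) ⬝ᵥ (hirzebruchFan 3).ray i = 0) ∧
    (i ∉ σ.1 → 0 < (surfaceWeight (vertexIndex (vertexOf σ.1)) -
      surfaceWeight (vertexIndex (vertexOf τ.1))) ⬝ᵥ (hirzebruchFan 3).ray i) := by
  have := surfaceWeight_sub_vertexIndex (vertexOf σ.1) (vertexOf τ.1) i (subset_vertexCone τ.2 hi)
  rwa [hσ] at this

/-- Here σ is the normal cone of a vertex v. On U_τ, normalized at a vertex w, the coordinate of v
is the monomial with exponent v - w. It cuts out the common face of τ and σ, so it is invertible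
exactly on U_τ ∩ U_σ. -/
theorem surfaceEmbedding_preimage_basicOpen {σ : (hirzebruchFan 3).Cone}
    (hσ : vertexCone (vertexOf σ.1) = σ.1) :
    surfaceEmbedding k ⁻¹ᵁ Proj.basicOpen (MvPolynomial.homogeneousSubmodule FlagIndex k)
      (MvPolynomial.X (vertexIndex (vertexOf σ.1))) = ((hirzebruchFan 3).coneι k σ).opensRange := by
  have key : ∀ (τ : (hirzebruchFan 3).Cone) (y : Spec (CommRingCat.of (ChartRing k τ))),
      surfaceEmbedding k ((hirzebruchFan 3).coneι k τ y) ∈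
        Proj.basicOpen (MvPolynomial.homogeneousSubmodule FlagIndex k)
          (MvPolynomial.X (vertexIndex (vertexOf σ.1))) ↔
      y ∈ PrimeSpectrum.basicOpen (chartCoord k τ (vertexIndex (vertexOf σ.1))) := by
    intro τ y
    rw [← chartHom_X, ← chartEmbedding_preimage_basicOpen k τ (X_mem k _) one_pos,
      ← coneι_surfaceEmbedding]
    rfl
  ext x
  constructor
  · intro hx
    obtain ⟨τ, y, rfl⟩ := SimplicialFan.exists_coneι_eq _ _ x
    have hy := (key τ y).mp hx
    let κ : (hirzebruchFan 3).Cone := ⟨τ.1 ∩ σ.1, (hirzebruchFan 3).face_mem _ τ.2 _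
      Finset.inter_subset_left⟩
    have hκ : κ ≤ τ := (Finset.inter_subset_left : τ.1 ∩ σ.1 ⊆ τ.1)
    have hκ' : κ ≤ σ := (Finset.inter_subset_right : τ.1 ∩ σ.1 ⊆ σ.1)
    have hr := SimplicialFan.range_diagram_map (Φ := hirzebruchFan 3) k (homOfLE hκ)
      ⟨_, surfaceWeight_sub_mem τ (vertexIndex (vertexOf σ.1))⟩
      (fun i hi => (vertex_sub_dotProduct hσ (Finset.mem_inter.mp hi).1).1
        (Finset.mem_inter.mp hi).2)
      (fun i hi => (vertex_sub_dotProduct hσ (Finset.mem_sdiff.mp hi).1).2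
        fun h => (Finset.mem_sdiff.mp hi).2 (Finset.mem_inter.mpr ⟨(Finset.mem_sdiff.mp hi).1, h⟩))
    rw [chartCoord, surfaceCoef_vertexIndex, Int.cast_one] at hy
    have hy' : y ∈ Set.range (((hirzebruchFan 3).diagram k).map (homOfLE hκ)) := by
      rw [hr]
      exact hy
    obtain ⟨z, rfl⟩ := hy'
    refine ⟨Spec.map (CommRingCat.ofHom
      ((hirzebruchFan 3).faceMap k (σ := σ.1) (τ := κ.1) hκ')) z, ?_⟩
    change (Spec.map _ ≫ SimplicialFan.coneι _ k σ) z = _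
    rw [SimplicialFan.faceMap_coneι, ← SimplicialFan.faceMap_coneι _ k hκ]
    rfl
  · rintro ⟨y, rfl⟩
    refine (key σ y).mpr ?_
    rw [chartCoord_vertex, PrimeSpectrum.basicOpen_one]
    trivial

theorem awayDesc_chartHom_surjective {σ : (hirzebruchFan 3).Cone}
    (hσ : vertexCone (vertexOf σ.1) = σ.1) : Function.Surjective
      (Proj.awayDesc (MvPolynomial.homogeneousSubmodule FlagIndex k) (chartHom k σ).toRingHom
        (MvPolynomial.X (vertexIndex (vertexOf σ.1))) (isUnit_chartHom_X k σ)) := by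
  intro p
  induction p using AddMonoidAlgebra.induction_linear with
  | zero => exact ⟨0, map_zero _⟩
  | add p q hp hq =>
    obtain ⟨a, rfl⟩ := hp
    obtain ⟨b, rfl⟩ := hq
    exact ⟨a + b, map_add _ _ _⟩
  | single u r =>
    obtain ⟨i₁, i₂, h₁, h₂, h⟩ := exists_generators (vertexOf σ.1)
    obtain ⟨n₁, n₂, hu⟩ := h u.1 (hσ.symm ▸ u.2)
    have hm : (MvPolynomial.C r * (MvPolynomial.X i₁ ^ n₁ * MvPolynomial.X i₂ ^ n₂) :
        MvPolynomial FlagIndex k) ∈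
          MvPolynomial.homogeneousSubmodule FlagIndex k ((n₁ + n₂) • 1) := by
      have := (MvPolynomial.isHomogeneous_C FlagIndex r).mul
        (((MvPolynomial.isHomogeneous_X k i₁).pow n₁).mul
          ((MvPolynomial.isHomogeneous_X k i₂).pow n₂))
      rw [MvPolynomial.mem_homogeneousSubmodule]
      convert this using 1
      simp
    refine ⟨HomogeneousLocalization.Away.mk _ (X_mem k _) _ _ hm, ?_⟩
    have := Proj.awayDesc_mk (MvPolynomial.homogeneousSubmodule FlagIndex k)
      (chartHom k σ).toRingHom (isUnit_chartHom_X k σ) (X_mem k _) _ _ hm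
    have e : (chartHom k σ).toRingHom (MvPolynomial.X (vertexIndex (vertexOf σ.1))) = 1 :=
      (chartHom_X k σ _).trans (chartCoord_vertex k σ)
    rw [e, one_pow, mul_one] at this
    refine this.trans ?_
    change chartHom k σ _ = _
    rw [map_mul, map_mul, map_pow, map_pow, chartHom_X, chartHom_X, chartCoord, chartCoord, h₁, h₂,
      Int.cast_one, AddMonoidAlgebra.single_pow, AddMonoidAlgebra.single_pow,
      AddMonoidAlgebra.single_mul_single, chartHom, MvPolynomial.aeval_C,
      ← Algebra.smul_def, AddMonoidAlgebra.smul_single]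
    congr 1
    · exact Subtype.ext hu.symm
    · simp

/-- Over D₊(X_v), for v a vertex, the morphism is `Spec` of a surjection, hence a closed immersion,
and these open sets cover the image. Closedness of the image comes separately, from
`range_surfaceEmbedding`. -/
theorem isPreimmersion_surfaceEmbedding : IsPreimmersion (surfaceEmbedding k) := by
  let V (v : Fin 4) : (hirzebruchFan 3).Cone := ⟨vertexCone v, vertexCone_mem v⟩
  have hV : ∀ v, vertexCone (vertexOf (V v).1) = (V v).1 := fun v => by
    rw [vertexOf_vertexCone]
  let c (v : Fin 4) : _ ⟶ flagSpace k := Proj.awayι (MvPolynomial.homogeneousSubmodule FlagIndex k)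
    (MvPolynomial.X (vertexIndex (vertexOf (V v).1))) (X_mem k _) one_pos
  have hi (v : Fin 4) : IsOpenImmersion (c v) := inferInstanceAs (IsOpenImmersion (Proj.awayι
    (MvPolynomial.homogeneousSubmodule FlagIndex k) _ (X_mem k _) one_pos))
  have hc : ∀ v, surfaceEmbedding k ⁻¹ᵁ (c v).opensRange =
      ((hirzebruchFan 3).coneι k (V v)).opensRange := fun v => by
    rw [← surfaceEmbedding_preimage_basicOpen k (hV v)]
    exact congrArg _ (Proj.opensRange_awayι _ _ _ _)
  have : MorphismProperty.RespectsRight @IsPreimmersion @IsOpenImmersion :=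
    ⟨fun _ _ _ _ => inferInstance⟩
  refine IsZariskiLocalAtTarget.of_range_subset_iSup (fun v => (c v).opensRange) ?_ fun v => ?_
  · rintro _ ⟨x, rfl⟩
    obtain ⟨τ, y, rfl⟩ := SimplicialFan.exists_coneι_eq _ _ x
    refine Opens.mem_iSup.mpr ⟨vertexOf τ.1, ?_⟩
    change _ ∈ surfaceEmbedding k ⁻¹ᵁ (c (vertexOf τ.1)).opensRange
    rw [hc, ← SimplicialFan.faceMap_coneι _ k (σ := τ) (τ := V (vertexOf τ.1))
      (subset_vertexCone τ.2)]
    exact ⟨_, rfl⟩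
  · have hp := IsOpenImmersion.isPullback _ _ _ _ (coneι_surfaceEmbedding k (V v) : _ = _ ≫ c v)
      (hc v)
    have : MorphismProperty.RespectsIso (@IsPreimmersion : MorphismProperty Scheme.{u}) :=
      MorphismProperty.RespectsIso.mk _ (fun _ _ _ => inferInstance) (fun _ _ _ => inferInstance)
    refine (MorphismProperty.arrow_mk_iso_iff (@IsPreimmersion : MorphismProperty Scheme.{u})
      (morphismRestrictOpensRange (surfaceEmbedding k) (c v))).mpr ?_
    rw [← hp.flip.isoPullback_inv_snd]
    have := IsClosedImmersion.spec_of_surjective (CommRingCat.ofHom _)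
      (awayDesc_chartHom_surjective k (hV v))
    exact @IsPreimmersion.comp _ _ _ _ _ inferInstance
      (IsClosedImmersion.iff_isPreimmersion.mp this).1

end

/-! ### The image is the orbit closure. -/

noncomputable section

attribute [local instance] MvPolynomial.gradedAlgebra

variable (k : Type u) [Field k]

theorem adjoin_range_X_eq_top : Algebra.adjoin (MvPolynomial.homogeneousSubmodule FlagIndex k 0)
    (Set.range (MvPolynomial.X : FlagIndex → MvPolynomial FlagIndex k)) = ⊤ := by
  refine eq_top_iff.mpr fun p _ => ?_
  induction p using MvPolynomial.induction_on with
  | C a =>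
    exact (Algebra.adjoin _ _).algebraMap_mem
      (⟨MvPolynomial.C a, MvPolynomial.isHomogeneous_C _ _⟩ :
        MvPolynomial.homogeneousSubmodule FlagIndex k 0)
  | add p q hp hq => exact add_mem (hp trivial) (hq trivial)
  | mul_X p i hp => exact mul_mem (hp trivial) (Algebra.subset_adjoin ⟨i, rfl⟩)

variable {k}

theorem X_pow_sub_isHomogeneous (i j l : FlagIndex) (c : k) {a b : ℕ} (hab : a + b = 4) :
    (MvPolynomial.X i ^ 4 - MvPolynomial.C c * (MvPolynomial.X j ^ a * MvPolynomial.X l ^ b) :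
      MvPolynomial FlagIndex k).IsHomogeneous 4 := by
  refine (by simpa using (MvPolynomial.isHomogeneous_X k i).pow 4 :
    (MvPolynomial.X i ^ 4 : MvPolynomial FlagIndex k).IsHomogeneous 4).sub ?_
  have := (MvPolynomial.isHomogeneous_C FlagIndex c).mul
    (((MvPolynomial.isHomogeneous_X k j).pow a).mul ((MvPolynomial.isHomogeneous_X k l).pow b))
  rwa [one_mul, one_mul, zero_add, hab] at this

theorem vanishesOnSurface_X_pow_sub (i : FlagIndex) {v w : Fin 4} {a b : ℕ}
    (h : 4 * surfaceDeg i = a * surfaceDeg (vertexIndex v) + b * surfaceDeg (vertexIndex w))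
    (h' : 4 * wedgeHeight i.2 =
      a * wedgeHeight (vertexIndex v).2 + b * wedgeHeight (vertexIndex w).2) :
    VanishesOnSurface (MvPolynomial.X i ^ 4 - MvPolynomial.C ((surfaceCoef i : k) ^ 4) *
      (MvPolynomial.X (vertexIndex v) ^ a * MvPolynomial.X (vertexIndex w) ^ b)) := by
  intro s m
  simp only [map_sub, map_mul, map_pow, MvPolynomial.aeval_X, MvPolynomial.aeval_C, surfaceCoord,
    surfaceCoef_vertexIndex, one_pow, mul_one, one_mul, Int.cast_one, Algebra.algebraMap_self,
    RingHom.id_apply]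
  rw [mul_pow, mul_pow (_ ^ _), mul_pow (_ ^ _), mul_pow (_ ^ _), ← pow_mul, ← pow_mul, ← pow_mul,
    ← pow_mul, ← pow_mul, ← pow_mul, mul_mul_mul_comm, ← pow_add, ← pow_add, sub_eq_zero,
    mul_comm _ 4, mul_comm _ 4, h, h', mul_comm a, mul_comm b, mul_comm a, mul_comm b]

/-- On the orbit closure X_i^4 = c X_v^a X_w^b with vertices v, w and a + b = 4. If all vertex
coordinates vanished at y, then all coordinates would, which is impossible in projective space. -/
theorem exists_vertex_notMem [Infinite k] (y : flagSpace k) (hy : y ∈ orbitClosure (surfaceFlag k)) :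
    ∃ v, MvPolynomial.X (vertexIndex v) ∉
      ProjectiveSpectrum.asHomogeneousIdeal (𝒜 := MvPolynomial.homogeneousSubmodule FlagIndex k) y := by
  by_contra! h
  have hp : (ProjectiveSpectrum.asHomogeneousIdeal
    (𝒜 := MvPolynomial.homogeneousSubmodule FlagIndex k) y).toIdeal.IsPrime :=
      ProjectiveSpectrum.isPrime (𝒜 := MvPolynomial.homogeneousSubmodule FlagIndex k) y
  have hX : ∀ i, MvPolynomial.X i ∈ (ProjectiveSpectrum.asHomogeneousIdeal
      (𝒜 := MvPolynomial.homogeneousSubmodule FlagIndex k) y).toIdeal := by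
    intro i
    obtain ⟨v, w, a, b, hab, h₁, h₂⟩ := exists_vertices i
    have hg := X_pow_sub_isHomogeneous i (vertexIndex v) (vertexIndex w)
      ((surfaceCoef i : k) ^ 4) hab
    have hm := hy ⟨⟨4, hg⟩, (vanishesOnOrbit_iff hg).mpr (vanishesOnSurface_X_pow_sub i h₁ h₂)⟩
    refine hp.mem_of_pow_mem 4 ((Submodule.sub_mem_iff_left _ (Ideal.mul_mem_left _ _ ?_)).mp hm)
    obtain ha | hb : 0 < a ∨ 0 < b := by omega
    · exact Ideal.mul_mem_right _ _ (Ideal.pow_mem_of_mem _ (h v) _ ha)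
    · exact Ideal.mul_mem_left _ _ (Ideal.pow_mem_of_mem _ (h w) _ hb)
  have htop := Proj.iSup_basicOpen_eq_top' (MvPolynomial.homogeneousSubmodule FlagIndex k)
    MvPolynomial.X (fun i => ⟨1, X_mem k i⟩) (adjoin_range_X_eq_top k)
  obtain ⟨i, hi⟩ := Opens.mem_iSup.mp (htop.ge (Set.mem_univ y) : y ∈ _)
  exact hi (hX i)

theorem range_surfaceEmbedding [Infinite k] :
    Set.range (surfaceEmbedding k) = (orbitClosure (surfaceFlag k) : Set (flagSpace k)) := by
  ext y
  constructor
  · rintro ⟨x, rfl⟩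
    obtain ⟨σ, z, rfl⟩ := SimplicialFan.exists_coneι_eq _ _ x
    rintro g ⟨⟨d, hg⟩, hv⟩
    have h0 := (chartHom_eq_zero_iff σ hg).mpr ((vanishesOnOrbit_iff hg).mp hv)
    -- The description of the preimage of D₊(g) needs positive degree. A form of degree zero is a
    -- constant, and one that vanishes on the surface is 0.
    obtain rfl | hd := Nat.eq_zero_or_pos d
    · obtain ⟨c, rfl⟩ : ∃ c, g = MvPolynomial.C c :=
        ⟨_, MvPolynomial.totalDegree_eq_zero_iff_eq_C.mp (Nat.le_zero.mp hg.totalDegree_le)⟩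
      have hc : algebraMap k (ChartRing k σ) c = 0 := by
        rwa [chartHom, MvPolynomial.aeval_C] at h0
      have hc' : c = 0 := FaithfulSMul.algebraMap_injective k (ChartRing k σ) (hc.trans (map_zero _).symm)
      rw [hc', map_zero]
      exact zero_mem (ProjectiveSpectrum.asHomogeneousIdeal
        (𝒜 := MvPolynomial.homogeneousSubmodule FlagIndex k) _)
    · by_contra hn
      have hz : z ∈ chartEmbedding k σ ⁻¹ᵁ
          Proj.basicOpen (MvPolynomial.homogeneousSubmodule FlagIndex k) g := by
        rw [← coneι_surfaceEmbedding]
        exact hn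
      rw [chartEmbedding_preimage_basicOpen k σ hg hd, h0, PrimeSpectrum.basicOpen_zero] at hz
      exact hz
  · intro hy
    obtain ⟨v, hv⟩ := exists_vertex_notMem y hy
    let σ : (hirzebruchFan 3).Cone := ⟨vertexCone v, vertexCone_mem v⟩
    have hσ : vertexOf σ.1 = v := vertexOf_vertexCone v
    have hσ' : vertexCone (vertexOf σ.1) = σ.1 := by rw [hσ]
    obtain ⟨z, hz⟩ := Proj.mem_range_ofUnit (MvPolynomial.homogeneousSubmodule FlagIndex k)
      (X_mem k _) one_pos _ _ (awayDesc_chartHom_surjective k hσ') y (by rwa [hσ])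
      (fun n _ a ha h => hy ⟨⟨n, ha⟩, (vanishesOnOrbit_iff ha).mpr ((chartHom_eq_zero_iff σ ha).mp h)⟩)
    refine ⟨(hirzebruchFan 3).coneι k σ z, ?_⟩
    rw [← hz]
    exact congrArg (fun f => f z) (coneι_surfaceEmbedding k σ)

variable (k) in
/-- A Schubert variety in the flag variety of `G₂` is isomorphic to `F₃`. -/
theorem nonempty_iso_hirzebruchFan_three [Infinite k] :
    Nonempty (Over.mk (schubertToSpec (surfaceFlag k)) ≅ Over.mk ((hirzebruchFan 3).toSpec k)) := by
  have := isPreimmersion_surfaceEmbedding k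
  have hr := range_surfaceEmbedding (k := k)
  have : IsClosedImmersion (surfaceEmbedding k) := .of_isPreimmersion _ (by
    rw [hr]
    exact (orbitClosure _).isClosed)
  let I := Scheme.IdealSheafData.vanishingIdeal (orbitClosure (surfaceFlag k))
  -- Functions that vanish on F₃ vanish on the orbit closure, so the reduced closure factors through
  -- the closed immersion of F₃.
  have H : (surfaceEmbedding k).ker ≤ I.subschemeι.ker := by
    rw [I.ker_subschemeι, ← Scheme.IdealSheafData.le_support_iff_le_vanishingIdeal,
      ← SetLike.coe_subset_coe, Scheme.Hom.support_ker, hr]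
    exact subset_closure
  let l := IsClosedImmersion.lift (surfaceEmbedding k) I.subschemeι H
  have hl : l ≫ surfaceEmbedding k = I.subschemeι := IsClosedImmersion.lift_fac _ _ _
  have : IsClosedImmersion (l ≫ surfaceEmbedding k) := by
    rw [hl]
    infer_instance
  have : IsClosedImmersion l := .of_comp_isClosedImmersion l (surfaceEmbedding k)
  have : Surjective l := ⟨fun x => by
    have hx : surfaceEmbedding k x ∈ Set.range I.subschemeι := by
      rw [I.range_subschemeι, Scheme.IdealSheafData.coe_support_vanishingIdeal, ← hr]
      exact ⟨x, rfl⟩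
    obtain ⟨z, hz⟩ := hx
    refine ⟨z, (surfaceEmbedding k).isClosedEmbedding.injective ?_⟩
    rw [← hz, ← hl]
    rfl⟩
  have := SimplicialFan.isIntegral_toricScheme (Φ := hirzebruchFan 3) k (empty_mem_hirzebruchFan 3)
  -- F₃ is integral, hence reduced, so it has no proper closed subscheme with the same underlying
  -- space.
  have := isIso_of_isClosedImmersion_of_surjective l
  refine ⟨Over.isoMk (@asIso _ _ _ _ l this) ?_⟩
  change l ≫ (hirzebruchFan 3).toSpec k = I.subschemeι ≫ flagSpaceToSpec k
  rw [← surfaceEmbedding_toSpec, ← Category.assoc, hl]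

end

theorem mainTheorem4 :
    (∀ (R : Type u) [CommRing R] [IsDomain R],
      (∀ q : ℕ, 2 ≤ q → (hirzebruchFan 0).IsDiagonallySplit R q) ∧
      (∀ q : ℕ, 2 ≤ q → (hirzebruchFan 1).IsDiagonallySplit R q) ∧
      (∀ q : ℕ, 2 ≤ q → Odd q → (hirzebruchFan 2).IsDiagonallySplit R q) ∧
      (∀ a : ℕ, 2 < a → ∀ q : ℕ, 2 ≤ q → ¬ (hirzebruchFan a).IsDiagonallySplit R q)) ∧
    (∀ (k : Type u) [Field k] [IsAlgClosed k], ∃ E : G2Flag k,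
      Nonempty (Over.mk (schubertToSpec E) ≅ Over.mk ((hirzebruchFan 3).toSpec k)) ∧
      (∀ p : ℕ, p.Prime → CharP k p → ¬ IsDiagonallyFrobeniusSplit p (schubertToSpec E))) := by
  refine ⟨fun R _ _ => ⟨fun q hq => isDiagonallySplit_hirzebruchFan_of_le_one 0 (by omega) R q hq,
    fun q hq => isDiagonallySplit_hirzebruchFan_of_le_one 1 (by omega) R q hq,
    fun q _ hq => isDiagonallySplit_hirzebruchFan_two R q hq,
    fun a ha q hq => not_isDiagonallySplit_hirzebruchFan ha R hq⟩, fun k _ _ => ?_⟩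
  obtain ⟨e⟩ := nonempty_iso_hirzebruchFan_three k
  exact ⟨surfaceFlag k, ⟨e⟩, fun p hp _ h =>
    not_isDiagonallyFrobeniusSplit_hirzebruchFan (by omega) k hp.two_le (h.of_iso e)⟩
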